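/- Let $r\ge 1$ and let $X_1,\dots,X_r$ be locally compact Hadamard spaces, i.e. locally compact, complete, geodesic metric spaces satisfying the CAT(0)-inequality. Let $X=X_1\times\cdots\times X_r$ with the $\ell^2$-product metric $d=\sqrt{d_1^2+\cdots+d_r^2}$. Let $\partial X_i$ and $\partial X$ be the geometric boundaries (classes of asymptotic geodesic rays) with the cone topology, and let $\partial^F X=\partial X_1\times\cdots\times\partial X_r$ be the Furstenberg boundary with the product topology. A point of $\partial X$ is called regular if it is represented by a geodesic ray of the form $t\mapsto(\sigma_1(\theta_1t),\dots,\sigma_r(\theta_rt))$ with geodesic rays $\sigma_i$ in $X_i$ and $\theta_i>0$, $\sum_i\theta_i^2=1$; its image under $\pi^F$ is the point $(\sigma_1(\infty),\dots,\sigma_r(\infty))\in\partial^FX$. An isometry $h$ of a Hadamard space $Y$ is axial if there are $l>0$ and a geodesic line $\sigma$ (an axis of $h$) with $h(\sigma(t))=\sigma(t+l)$ for all $t\in\mathbb R$; then $h^+=\sigma(\infty)$ and $h^-=\sigma(-\infty)$. It is rank one if it has an axis which does not bound a flat half-plane. Two axial isometries $g,h$ of $Y$ are independent if for every $y\in Y$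 the map $\mathbb Z\times\mathbb Z\to[0,\infty)$, $(m,n)\mapsto d(g^my,h^ny)$ is proper. An element $\gamma=(\gamma_1,\dots,\gamma_r)$ of $\mathrm{Is}(X_1)\times\cdots\times\mathrm{Is}(X_r)$ is regular axial if every $\gamma_i$ is a rank one isometry of $X_i$, and then $\gamma^\pm=(\gamma_1^\pm,\dots,\gamma_r^\pm)\in\partial^FX$. Two regular axial elements $g,h$ are independent if $g_i$ and $h_i$ are independent for every $i$. Let $\Gamma<\mathrm{Is}(X_1)\times\cdots\times\mathrm{Is}(X_r)$ be a group which acts properly discontinuously on $X$ and contains two independent regular axial elements. Let $L_\Gamma=\overline{\Gamma x}\cap\partial X$ be its geometric limit set, where $x\in X$ is arbitrary and the closure is taken in $X\cup\partial X$ with the cone topology. Let $F_\Gamma\subset\partial^FX$ be the Furstenberg limit set, i.e. the image under $\pi^F$ of the set of regular points of $L_\Gamma$, and let $$\Delta=\{(\xi,\eta)\in\partial^FX\times\partial^FX:\ \xi_i=\eta_i\text{ for some }i\in\{1,\dots,r\}\}.$$ Then the set of pairs $(\gamma^+,\gamma^-)$, where $\gamma$ ranges over the regular axial elements of $\Gamma$,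 is a dense subset of $(F_\Gamma\times F_\Gamma)\setminus\Delta$. -/

import Mathlib

open scoped NNReal Topology

noncomputable section

/-- `σ` restricted to `[0, l]` is a geodesic path (parametrized by arc length) of length `l`. -/
def IsGeodesicPath {X : Type*} [MetricSpace X] (l : ℝ) (σ : ℝ → X) : Prop :=
  ∀ s ∈ Set.Icc (0 : ℝ) l, ∀ t ∈ Set.Icc (0 : ℝ) l, dist (σ s) (σ t) = |s - t|

/-- Every pair of points is joined by a geodesic path. -/
def IsGeodesicSpace (X : Type*) [MetricSpace X] : Prop :=
  ∀ x y : X, ∃ σ : ℝ → X, IsGeodesicPath (dist x y) σ ∧ σ 0 = x ∧ σ (dist x y) = y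

/-- The CAT(0)-inequality for all geodesic triangles. Two sides `σ`, `τ` of a triangle issue from a
common vertex; `x'`, `y'`, `z'` is a comparison triangle in the Euclidean plane, and `p'`, `q'` are
the comparison points of the points `σ s`, `τ t` on these two sides. -/
def SatisfiesCAT0 (X : Type*) [MetricSpace X] : Prop :=
  ∀ (a b : ℝ) (σ τ : ℝ → X), IsGeodesicPath a σ → IsGeodesicPath b τ → σ 0 = τ 0 →
    ∀ x' y' z' : EuclideanSpace ℝ (Fin 2),
      dist x' y' = a → dist x' z' = b → dist y' z' = dist (σ a) (τ b) →
    ∀ s ∈ Set.Icc (0 : ℝ) a, ∀ t ∈ Set.Icc (0 : ℝ) b,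
    ∀ p' q' : EuclideanSpace ℝ (Fin 2),
      dist x' p' = s → dist p' y' = a - s → dist x' q' = t → dist q' z' = b - t →
      dist (σ s) (τ t) ≤ dist p' q'

/-- Hadamard spaces: complete geodesic metric spaces with the CAT(0)-inequality. -/
structure IsHadamardSpace (X : Type*) [MetricSpace X] : Prop where
  complete : CompleteSpace X
  geodesic : IsGeodesicSpace X
  cat0 : SatisfiesCAT0 X

/-- Geodesic rays `[0, ∞) → X`. -/
structure GeodesicRay (X : Type*) [MetricSpace X] where
  toFun : ℝ≥0 → X
  isometry : Isometry toFun

instance (X : Type*) [MetricSpace X] : CoeFun (GeodesicRay X) (fun _ => ℝ≥0 → X) :=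
  ⟨GeodesicRay.toFun⟩

/-- Geodesic lines `ℝ → X`. -/
structure GeodesicLine (X : Type*) [MetricSpace X] where
  toFun : ℝ → X
  isometry : Isometry toFun

instance (X : Type*) [MetricSpace X] : CoeFun (GeodesicLine X) (fun _ => ℝ → X) :=
  ⟨GeodesicLine.toFun⟩

/-- Two geodesic rays are asymptotic if they stay at bounded distance. -/
def asymptoticSetoid (X : Type*) [MetricSpace X] : Setoid (GeodesicRay X) where
  r σ τ := ∃ C : ℝ, ∀ t : ℝ≥0, dist (σ t) (τ t) ≤ C
  iseqv :=
    { refl := fun _ => ⟨0, fun _ => (dist_self _).le⟩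
      symm := fun ⟨C, hC⟩ => ⟨C, fun t => (dist_comm _ _).trans_le (hC t)⟩
      trans := fun ⟨C, hC⟩ ⟨D, hD⟩ =>
        ⟨C + D, fun t => (dist_triangle _ _ _).trans (add_le_add (hC t) (hD t))⟩ }

/-- The geometric boundary `∂X` (as a set). -/
def GeometricBoundary (X : Type*) [MetricSpace X] : Type _ :=
  Quotient (asymptoticSetoid X)

/-- The point `σ(∞)` of the geometric boundary represented by a geodesic ray. -/
def GeodesicRay.endpoint {X : Type*} [MetricSpace X] (σ : GeodesicRay X) : GeometricBoundary X :=
  Quotient.mk (asymptoticSetoid X) σ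

/-- The ray `t ↦ σ(t)`, `t ≥ 0`. -/
def GeodesicLine.posRay {X : Type*} [MetricSpace X] (σ : GeodesicLine X) : GeodesicRay X where
  toFun t := σ t
  isometry := σ.isometry.comp isometry_subtype_coe

/-- The ray `t ↦ σ(-t)`, `t ≥ 0`. -/
def GeodesicLine.negRay {X : Type*} [MetricSpace X] (σ : GeodesicLine X) : GeodesicRay X where
  toFun t := σ (-t)
  isometry := σ.isometry.comp ((IsometryEquiv.neg ℝ).isometry.comp isometry_subtype_coe)

/-- The underlying set of `X ∪ ∂X`. -/
inductive GeometricCompletion (X : Type*) [MetricSpace X] where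
  | inner (x : X) : GeometricCompletion X
  | bdry (ξ : GeometricBoundary X) : GeometricCompletion X

/-- The basic cone neighbourhood `U(c, R, ε)` of the end point of a ray `c`: all `z ∈ X ∪ ∂X` which
are at distance more than `R` from `x = c(0)` (points of `∂X` are at infinite distance) and for
which the geodesic path or ray from `x` to `z` is at time `R` at distance less than `ε`
from `c(R)`. -/
def coneNhd {X : Type*} [MetricSpace X] (c : GeodesicRay X) (R : ℝ≥0) (ε : ℝ) :
    Set (GeometricCompletion X) :=
  {z | match z with
    | .inner y => (R : ℝ) < dist (c 0) y ∧
        ∃ τ : ℝ → X, IsGeodesicPath (dist (c 0) y) τ ∧ τ 0 = c 0 ∧ τ (dist (c 0) y) = y ∧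
          dist (τ R) (c R) < ε
    | .bdry η => ∃ c' : GeodesicRay X, c' 0 = c 0 ∧ c'.endpoint = η ∧ dist (c' R) (c R) < ε}

/-- The cone topology on `X ∪ ∂X`. -/
instance coneTopology (X : Type*) [MetricSpace X] : TopologicalSpace (GeometricCompletion X) :=
  TopologicalSpace.generateFrom
    ({s | ∃ V : Set X, IsOpen V ∧ s = GeometricCompletion.inner '' V} ∪
      {s | ∃ (c : GeodesicRay X) (R : ℝ≥0) (ε : ℝ), 0 < R ∧ 0 < ε ∧ s = coneNhd c R ε})

/-- The cone topology on `∂X`. -/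
instance boundaryTopology (X : Type*) [MetricSpace X] : TopologicalSpace (GeometricBoundary X) :=
  TopologicalSpace.induced GeometricCompletion.bdry (coneTopology X)

/-- `σ` bounds a flat half-plane: there is an isometric embedding `f` of the Euclidean half-plane
`[0, ∞) × ℝ` with `f(0, t) = σ(t)`. -/
def GeodesicLine.BoundsFlatHalfPlane {X : Type*} [MetricSpace X] (σ : GeodesicLine X) : Prop :=
  ∃ f : ℝ≥0 → ℝ → X,
    (∀ (a b : ℝ≥0) (s t : ℝ), dist (f a s) (f b t) = √(((a : ℝ) - b) ^ 2 + (s - t) ^ 2)) ∧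
    ∀ t : ℝ, σ t = f 0 t

/-- `σ` is an axis of the isometry `h`: `h` translates `σ` by some `l > 0`. -/
def IsAxis {X : Type*} [MetricSpace X] (h : X ≃ᵢ X) (σ : GeodesicLine X) : Prop :=
  ∃ l : ℝ, 0 < l ∧ ∀ t : ℝ, h (σ t) = σ (t + l)

/-- Rank one isometries: those having an axis which does not bound a flat half-plane. -/
def IsRankOneIsometry {X : Type*} [MetricSpace X] (h : X ≃ᵢ X) : Prop :=
  ∃ σ : GeodesicLine X, IsAxis h σ ∧ ¬ σ.BoundsFlatHalfPlane

/-- `ξ = h⁺` is the attractive and `η = h⁻` the repulsive fixed point of the axial isometry `h`,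
i.e. `ξ = σ(∞)` and `η = σ(-∞)` for an axis `σ` of `h`. -/
def HasFixedPoints {X : Type*} [MetricSpace X] (h : X ≃ᵢ X) (ξ η : GeometricBoundary X) : Prop :=
  ∃ σ : GeodesicLine X, IsAxis h σ ∧ σ.posRay.endpoint = ξ ∧ σ.negRay.endpoint = η

/-- Independence: for every `x`, the map `(m, n) ↦ d(gᵐ x, hⁿ x)` on `ℤ × ℤ` is proper. -/
def AreIndependent {X : Type*} [MetricSpace X] (g h : X ≃ᵢ X) : Prop :=
  ∀ x : X, Filter.Tendsto (fun p : ℤ × ℤ => dist ((g ^ p.1) x) ((h ^ p.2) x))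
    Filter.cofinite Filter.atTop

/-- The action of `Is(X₁) × ⋯ × Is(X_r)` on the product `X` with its `ℓ²`-metric. -/
def productAct {ι : Type*} [Fintype ι] {X : ι → Type*} [∀ i, MetricSpace (X i)]
    (γ : ∀ i, X i ≃ᵢ X i) (x : PiLp 2 X) : PiLp 2 X :=
  WithLp.toLp 2 (fun i => γ i (x i))

/-- Every compact set meets only finitely many of its translates by elements of `Γ`. -/
def ActsProperlyDiscontinuously {ι : Type*} [Fintype ι] {X : ι → Type*} [∀ i, MetricSpace (X i)]
    (Γ : Subgroup (∀ i, X i ≃ᵢ X i)) : Prop :=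
  ∀ K : Set (PiLp 2 X), IsCompact K → {γ | γ ∈ Γ ∧ (productAct γ '' K ∩ K).Nonempty}.Finite

/-- All components are rank one isometries. -/
def IsRegularAxial {ι : Type*} {X : ι → Type*} [∀ i, MetricSpace (X i)]
    (γ : ∀ i, X i ≃ᵢ X i) : Prop :=
  ∀ i, IsRankOneIsometry (γ i)

/-- The Furstenberg boundary: the product of the boundaries with the product topology. -/
abbrev FurstenbergBoundary {ι : Type*} (X : ι → Type*) [∀ i, MetricSpace (X i)] : Type _ :=
  ∀ i, GeometricBoundary (X i)

/-- `ζ` is a regular boundary point of the product, with image `ξ` in the Furstenberg boundary: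
`ζ` is represented by a ray `σ(t) = (c_i(θ_i t))_i`, where `c_i` are rays representing `ξ_i`, and
the slope `θ` is a unit vector all of whose coordinates are positive. -/
def IsFurstenbergProjection {ι : Type*} [Fintype ι] {X : ι → Type*} [∀ i, MetricSpace (X i)]
    (ζ : GeometricBoundary (PiLp 2 X)) (ξ : FurstenbergBoundary X) : Prop :=
  ∃ (σ : GeodesicRay (PiLp 2 X)) (θ : ι → ℝ≥0) (c : ∀ i, GeodesicRay (X i)),
    (∀ i, 0 < θ i) ∧ ∑ i, θ i ^ 2 = 1 ∧ (∀ t i, σ t i = c i (θ i * t)) ∧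
    σ.endpoint = ζ ∧ ∀ i, (c i).endpoint = ξ i

/-- The geometric limit set: the boundary points in the closure of the orbit `Γ x`. -/
def geometricLimitSet {ι : Type*} [Fintype ι] {X : ι → Type*} [∀ i, MetricSpace (X i)]
    (Γ : Subgroup (∀ i, X i ≃ᵢ X i)) (x : PiLp 2 X) : Set (GeometricBoundary (PiLp 2 X)) :=
  {ζ | GeometricCompletion.bdry ζ ∈
    closure {z | ∃ γ ∈ Γ, z = GeometricCompletion.inner (productAct γ x)}}

/-- The Furstenberg limit set: the image in the Furstenberg boundary of the set of regular geometric
limit points. -/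
def furstenbergLimitSet {ι : Type*} [Fintype ι] {X : ι → Type*} [∀ i, MetricSpace (X i)]
    (Γ : Subgroup (∀ i, X i ≃ᵢ X i)) (x : PiLp 2 X) : Set (FurstenbergBoundary X) :=
  {ξ | ∃ ζ ∈ geometricLimitSet Γ x, IsFurstenbergProjection ζ ξ}

/-- The pairs of boundary points which share a coordinate in some factor. -/
def generalizedDiagonal {ι : Type*} (X : ι → Type*) [∀ i, MetricSpace (X i)] :
    Set (FurstenbergBoundary X × FurstenbergBoundary X) :=
  {p | ∃ i, p.1 i = p.2 i}

/-- The set of the pairs `(γ⁺, γ⁻)` for the regular axial elements `γ` of `Γ`. -/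
def regularAxialFixedPairs {ι : Type*} {X : ι → Type*} [∀ i, MetricSpace (X i)]
    (Γ : Subgroup (∀ i, X i ≃ᵢ X i)) : Set (FurstenbergBoundary X × FurstenbergBoundary X) :=
  {p | ∃ γ ∈ Γ, IsRegularAxial γ ∧ ∀ i, HasFixedPoints (γ i) (p.1 i) (p.2 i)}

end

open Set Filter

/-! The engine is contraction. If an axis of an isometry of a proper CAT(0) space does not bound a
flat half-plane, it is contracting: a geodesic between points with distant projections to the axis
runs along it between these projections (`exists_contracting`). Otherwise, along long pieces of the
axis, the distance from suitable remote points grows almost affinely with slope at most `c < 1`.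
After translating these pieces to a compact part of the axis, a limit produces flat points at every
distance from the axis, hence flat strips of every width and a flat half-plane
(`exists_slope_bound`).

Contraction has two consequences. If `a` and `b` have contracting axes without common end points,
ping-pong shows that for large `n` the element `aⁿ b⁻ⁿ` is rank one, with attractive point near `a⁺`
and repulsive point near `b⁺` (`eventually_rankOne`). Moreover, if orbit points `γₙ x` converge to a
boundary point and `x` has bounded projections to the axis of `γₙ⁻¹ δₙ g δₙ⁻¹ γₙ`, with `δₙ x` close
to `γₙ x`, then both ends of the axis of `δₙ g δₙ⁻¹` converge to this point
(`tendsto_map_endpoint`).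

To have bounded projections in all factors at once, replace `γₙ` by `γₙ hᵏ` for one of `r + 1`
exponents `k`, where `h` is independent of `g`: each factor spoils at most one exponent
(`exists_proj_le`). So every point of the Furstenberg limit set is a limit of fixed points of
conjugates of `g`. For `(ξ, η)` outside the diagonal, the conjugates approximating `ξ` and `η`
eventually have disjoint ends in every factor, and ping-pong with a common exponent gives regular
axial elements whose fixed pairs approximate `(ξ, η)`.

Conversely, the powers of a regular axial element follow a product ray with positive slopes, so `γ⁺`
is in the Furstenberg limit set; the same for `γ⁻¹` gives `γ⁻`, and the two ends of an axis differ.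
-/

noncomputable section

/-! ### Geodesics and convexity from the Bruhat–Tits inequality -/

/-- The Bruhat–Tits form of the CAT(0)-inequality, in a formulation which includes the existence of
the points dividing `[x, y]` in a given ratio. -/
class CNSpace (X : Type*) [MetricSpace X] : Prop where
  exists_point : ∀ (x y : X) (t : ℝ), t ∈ Icc (0 : ℝ) 1 → ∃ m : X, ∀ p : X,
    dist p m ^ 2 ≤ (1 - t) * dist p x ^ 2 + t * dist p y ^ 2 - t * (1 - t) * dist x y ^ 2

section CN
variable {X : Type*} [MetricSpace X] [CNSpace X]

open Classical in
/-- The point which divides the geodesic from `x` to `y` in the ratio `t : 1 - t`. -/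
def geo (x y : X) (t : ℝ) : X :=
  if h : t ∈ Icc (0 : ℝ) 1 then (CNSpace.exists_point x y t h).choose else x

lemma geo_cn (x y : X) {t : ℝ} (ht : t ∈ Icc (0 : ℝ) 1) (p : X) :
    dist p (geo x y t) ^ 2 ≤
      (1 - t) * dist p x ^ 2 + t * dist p y ^ 2 - t * (1 - t) * dist x y ^ 2 := by
  rw [geo, dif_pos ht]
  exact (CNSpace.exists_point x y t ht).choose_spec p

lemma dist_left_geo (x y : X) {t : ℝ} (ht : t ∈ Icc (0 : ℝ) 1) :
    dist x (geo x y t) = t * dist x y := by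
  have h1 := geo_cn x y ht x
  have h2 := geo_cn x y ht y
  rw [dist_self] at h1 h2
  have h3 : dist x (geo x y t) ≤ t * dist x y :=
    abs_le_of_sq_le_sq' (by nlinarith) (mul_nonneg ht.1 dist_nonneg) |>.2
  have h4 : dist y (geo x y t) ≤ (1 - t) * dist x y := by
    rw [dist_comm y x] at h2
    exact abs_le_of_sq_le_sq' (by nlinarith) (mul_nonneg (by linarith [ht.2]) dist_nonneg) |>.2
  have h5 := dist_triangle_right x y (geo x y t)
  linarith

lemma dist_geo_right (x y : X) {t : ℝ} (ht : t ∈ Icc (0 : ℝ) 1) :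
    dist (geo x y t) y = (1 - t) * dist x y := by
  have h2 := geo_cn x y ht y
  rw [dist_self, dist_comm y x] at h2
  have h4 : dist y (geo x y t) ≤ (1 - t) * dist x y :=
    abs_le_of_sq_le_sq' (by nlinarith) (mul_nonneg (by linarith [ht.2]) dist_nonneg) |>.2
  have h5 := dist_triangle_right x y (geo x y t)
  have h6 := dist_left_geo x y ht
  rw [dist_comm]
  linarith

lemma eq_geo {x y z : X} {t : ℝ} (ht : t ∈ Icc (0 : ℝ) 1) (h1 : dist x z ≤ t * dist x y)
    (h2 : dist z y ≤ (1 - t) * dist x y) : z = geo x y t := by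
  have h := geo_cn x y ht z
  have h3 : dist z x ^ 2 ≤ (t * dist x y) ^ 2 := by
    rw [dist_comm]; exact pow_le_pow_left₀ dist_nonneg h1 2
  have h4 : dist z y ^ 2 ≤ ((1 - t) * dist x y) ^ 2 := pow_le_pow_left₀ dist_nonneg h2 2
  have h5 := mul_le_mul_of_nonneg_left h3 (sub_nonneg.2 ht.2)
  have h6 := mul_le_mul_of_nonneg_left h4 ht.1
  have h7 : dist z (geo x y t) ^ 2 ≤ 0 := by nlinarith
  exact dist_eq_zero.1 (pow_eq_zero_iff two_ne_zero |>.1 (le_antisymm h7 (sq_nonneg _)))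

lemma geo_symm (x y : X) {t : ℝ} (ht : t ∈ Icc (0 : ℝ) 1) : geo x y t = geo y x (1 - t) := by
  refine eq_geo ⟨by linarith [ht.2], by linarith [ht.1]⟩ ?_ ?_
  · rw [dist_comm, dist_geo_right x y ht, dist_comm y x]
  · rw [dist_comm, dist_left_geo x y ht, dist_comm y x]; simp

lemma geo_zero (x y : X) : geo x y 0 = x := (eq_geo (by simp) (by simp) (by simp)).symm
lemma geo_one (x y : X) : geo x y 1 = y := (eq_geo (by simp) (by simp) (by simp)).symm

lemma map_geo {Y : Type*} [MetricSpace Y] [CNSpace Y] {f : X → Y} (hf : Isometry f) (x y : X)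
    {t : ℝ} (ht : t ∈ Icc (0 : ℝ) 1) : f (geo x y t) = geo (f x) (f y) t := by
  refine eq_geo ht ?_ ?_
  · rw [hf.dist_eq, hf.dist_eq, dist_left_geo x y ht]
  · rw [hf.dist_eq, hf.dist_eq, dist_geo_right x y ht]

lemma dist_geo_geo (x y : X) {s t : ℝ} (hs : s ∈ Icc (0 : ℝ) 1) (ht : t ∈ Icc (0 : ℝ) 1) :
    dist (geo x y s) (geo x y t) = |s - t| * dist x y := by
  apply le_antisymm
  · have h := geo_cn x y ht (geo x y s)
    rw [dist_comm _ x, dist_left_geo x y hs, dist_geo_right x y hs] at h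
    refine abs_le_of_sq_le_sq' ?_ (by positivity) |>.2
    rw [mul_pow, sq_abs]
    nlinarith
  · have h1 := dist_triangle x (geo x y s) (geo x y t)
    have h2 := dist_triangle x (geo x y t) (geo x y s)
    rw [dist_left_geo x y hs, dist_left_geo x y ht] at h1 h2
    rw [dist_comm (geo x y t)] at h2
    rcases abs_cases (s - t) with h | h <;> rw [h.1] <;> linarith

lemma dist_geo_le (x y p : X) {t : ℝ} (ht : t ∈ Icc (0 : ℝ) 1) :
    dist p (geo x y t) ≤ (1 - t) * dist p x + t * dist p y := by
  have h := geo_cn x y ht p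
  have h1 : (dist p x - dist p y) ^ 2 ≤ dist x y ^ 2 := by
    have := abs_dist_sub_le x y p
    rw [dist_comm x p, dist_comm y p] at this
    exact sq_le_sq.2 (by rwa [abs_of_nonneg (dist_nonneg (x := x))])
  have h2 : 0 ≤ t * (1 - t) := mul_nonneg ht.1 (sub_nonneg.2 ht.2)
  have h3 := mul_le_mul_of_nonneg_left h1 h2
  refine abs_le_of_sq_le_sq' ?_ ?_ |>.2
  · nlinarith
  · have := sub_nonneg.2 ht.2
    have := ht.1
    positivity

/-- Apply the inequality to `geo x y' t` seen from `geo x y t`, then to `geo x y t` seen from `y'`;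
everything cancels except `t² d(y, y')²`. -/
lemma dist_geo_geo_left_le (x y y' : X) {t : ℝ} (ht : t ∈ Icc (0 : ℝ) 1) :
    dist (geo x y t) (geo x y' t) ≤ t * dist y y' := by
  have h := geo_cn x y' ht (geo x y t)
  rw [dist_comm _ x, dist_left_geo x y ht] at h
  have h1 := geo_cn x y ht y'
  rw [dist_comm y' x, dist_comm y' y, dist_comm y' _] at h1
  have h2 := mul_le_mul_of_nonneg_left h1 ht.1
  refine abs_le_of_sq_le_sq' ?_ (mul_nonneg ht.1 dist_nonneg) |>.2
  nlinarith

lemma dist_geo_geo_right_le (x x' y : X) {t : ℝ} (ht : t ∈ Icc (0 : ℝ) 1) :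
    dist (geo x y t) (geo x' y t) ≤ (1 - t) * dist x x' := by
  rw [geo_symm x y ht, geo_symm x' y ht]
  exact dist_geo_geo_left_le y x x' ⟨by linarith [ht.2], by linarith [ht.1]⟩

/-- The sum of the squares of the diagonals of a quadrilateral is at most the sum of the squares of
its sides. -/
lemma quadrilateral_le (x y z w : X) : dist x z ^ 2 + dist y w ^ 2 ≤
    dist x y ^ 2 + dist y z ^ 2 + dist z w ^ 2 + dist w x ^ 2 := by
  have ht : (1 / 2 : ℝ) ∈ Icc (0 : ℝ) 1 := by norm_num
  have h1 := geo_cn x z ht y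
  have h2 := geo_cn x z ht w
  have h3 := dist_triangle_right y w (geo x z (1 / 2))
  rw [dist_comm y x] at h1
  rw [dist_comm w z] at h2
  have h4 : dist y w ^ 2 ≤ (dist y (geo x z (1 / 2)) + dist w (geo x z (1 / 2))) ^ 2 :=
    pow_le_pow_left₀ dist_nonneg h3 2
  nlinarith [sq_nonneg (dist y (geo x z (1 / 2)) - dist w (geo x z (1 / 2)))]

lemma isGeodesicPath_geo (x y : X) :
    IsGeodesicPath (dist x y) (fun s => geo x y (s / dist x y)) := by
  intro s hs t ht
  rcases eq_or_lt_of_le (dist_nonneg (x := x) (y := y)) with h | h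
  · rw [← h] at hs ht
    have h1 : s = 0 := le_antisymm hs.2 hs.1
    have h2 : t = 0 := le_antisymm ht.2 ht.1
    simp [h1, h2]
  · have h1 : ∀ u ∈ Icc 0 (dist x y), u / dist x y ∈ Icc (0 : ℝ) 1 := fun u hu =>
      ⟨div_nonneg hu.1 h.le, (div_le_one h).2 hu.2⟩
    rw [dist_geo_geo x y (h1 s hs) (h1 t ht), ← sub_div, abs_div, abs_of_pos h,
      div_mul_cancel₀ _ h.ne']

lemma IsGeodesicPath.eq_geo {l : ℝ} {σ : ℝ → X} (h : IsGeodesicPath l σ) {t : ℝ}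
    (ht : t ∈ Icc (0 : ℝ) 1) (hl : 0 ≤ l) : σ (t * l) = geo (σ 0) (σ l) t := by
  have h0 : (0 : ℝ) ∈ Icc 0 l := ⟨le_rfl, hl⟩
  have h1 : l ∈ Icc 0 l := ⟨hl, le_rfl⟩
  have h2 : t * l ∈ Icc 0 l := ⟨mul_nonneg ht.1 hl, by nlinarith [ht.2]⟩
  have h3 : 0 ≤ (1 - t) * l := mul_nonneg (sub_nonneg.2 ht.2) hl
  refine _root_.eq_geo ht ?_ ?_
  · rw [h _ h0 _ h2, h _ h0 _ h1, zero_sub, zero_sub, abs_neg, abs_neg, abs_of_nonneg h2.1,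
      abs_of_nonneg hl]
  · rw [h _ h2 _ h1, h _ h0 _ h1, zero_sub, abs_neg, abs_of_nonneg hl, abs_sub_comm,
      abs_of_nonneg (by linarith)]
    linarith

lemma continuous_geo (x y : X) : ContinuousOn (geo x y) (Icc 0 1) := by
  have : LipschitzOnWith (nndist x y) (geo x y) (Icc 0 1) :=
    LipschitzOnWith.of_dist_le_mul fun s hs t ht => by
      rw [dist_geo_geo x y hs ht, coe_nndist, Real.dist_eq, mul_comm]
  exact this.continuousOn

end CN

/-! ### Nearest-point projection to a geodesic line -/

namespace GeodesicLine
variable {X : Type*} [MetricSpace X]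

lemma dist_eq (σ : GeodesicLine X) (s t : ℝ) : dist (σ s) (σ t) = |s - t| := by
  rw [σ.isometry.dist_eq, Real.dist_eq]

/-- The line with the opposite parametrization. -/
def rev (σ : GeodesicLine X) : GeodesicLine X where
  toFun t := σ (-t)
  isometry := σ.isometry.comp (IsometryEquiv.neg ℝ).isometry

@[simp] lemma rev_apply (σ : GeodesicLine X) (t : ℝ) : σ.rev t = σ (-t) := rfl

/-- The image of a line under an isometry. -/
def map (g : X ≃ᵢ X) (σ : GeodesicLine X) : GeodesicLine X where
  toFun t := g (σ t)
  isometry := g.isometry.comp σ.isometry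

@[simp] lemma map_apply (g : X ≃ᵢ X) (σ : GeodesicLine X) (t : ℝ) : σ.map g t = g (σ t) := rfl

lemma exists_proj (σ : GeodesicLine X) (x : X) : ∃ u : ℝ, ∀ s, dist x (σ u) ≤ dist x (σ s) := by
  have hc : Continuous fun s => dist x (σ s) := continuous_const.dist σ.isometry.continuous
  refine hc.exists_forall_le ?_
  refine tendsto_atTop_mono (f := fun s : ℝ => ‖s‖ - dist x (σ 0)) (fun s => ?_)
    (tendsto_atTop_add_const_right _ _ tendsto_norm_cocompact_atTop)
  have := dist_triangle_left (σ 0) (σ s) x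
  rw [σ.dist_eq, zero_sub, abs_neg] at this
  rw [Real.norm_eq_abs]
  linarith

/-- The parameter of the point of the line `σ` which is nearest to `x`. -/
def proj (σ : GeodesicLine X) (x : X) : ℝ := (σ.exists_proj x).choose

lemma dist_proj_le (σ : GeodesicLine X) (x : X) (s : ℝ) :
    dist x (σ (σ.proj x)) ≤ dist x (σ s) := (σ.exists_proj x).choose_spec s

variable [CNSpace X]

lemma eq_geo (σ : GeodesicLine X) (u v : ℝ) {t : ℝ} (ht : t ∈ Icc (0 : ℝ) 1) :
    σ ((1 - t) * u + t * v) = geo (σ u) (σ v) t := by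
  refine _root_.eq_geo ht ?_ ?_
  · rw [σ.dist_eq, σ.dist_eq, show u - ((1 - t) * u + t * v) = t * (u - v) by ring, abs_mul,
      abs_of_nonneg ht.1]
  · rw [σ.dist_eq, σ.dist_eq, show ((1 - t) * u + t * v) - v = (1 - t) * (u - v) by ring, abs_mul,
      abs_of_nonneg (sub_nonneg.2 ht.2)]

lemma cn (σ : GeodesicLine X) (p : X) (u v : ℝ) {t : ℝ} (ht : t ∈ Icc (0 : ℝ) 1) :
    dist p (σ ((1 - t) * u + t * v)) ^ 2 ≤
      (1 - t) * dist p (σ u) ^ 2 + t * dist p (σ v) ^ 2 - t * (1 - t) * (u - v) ^ 2 := by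
  have := geo_cn (σ u) (σ v) ht p
  rwa [← σ.eq_geo u v ht, σ.dist_eq, sq_abs] at this

lemma midpoint_cn (σ : GeodesicLine X) (p : X) (u s : ℝ) :
    2 * dist p (σ u) ^ 2 + 2 * s ^ 2 ≤ dist p (σ (u + s)) ^ 2 + dist p (σ (u - s)) ^ 2 := by
  have := σ.cn p (u + s) (u - s) (t := 1 / 2) (by norm_num)
  rw [show (1 - 1 / 2 : ℝ) * (u + s) + 1 / 2 * (u - s) = u by ring] at this
  nlinarith

lemma dist_convex (σ : GeodesicLine X) (p : X) (u v : ℝ) {t : ℝ} (ht : t ∈ Icc (0 : ℝ) 1) :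
    dist p (σ ((1 - t) * u + t * v)) ≤ (1 - t) * dist p (σ u) + t * dist p (σ v) := by
  rw [σ.eq_geo u v ht]
  exact dist_geo_le _ _ _ ht

lemma proj_sq (σ : GeodesicLine X) (x : X) (s : ℝ) :
    dist x (σ (σ.proj x)) ^ 2 + (s - σ.proj x) ^ 2 ≤ dist x (σ s) ^ 2 := by
  have hE : dist x (σ (σ.proj x)) ^ 2 ≤ dist x (σ s) ^ 2 :=
    pow_le_pow_left₀ dist_nonneg (σ.dist_proj_le x s) 2
  set u := σ.proj x with hu
  by_contra! hlt
  set w := (s - u) ^ 2 with hw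
  set E := dist x (σ s) ^ 2 - dist x (σ u) ^ 2 with hEd
  have hE0 : 0 ≤ E := by linarith
  have hwE : E < w := by linarith
  have hw0 : 0 < w := by linarith
  -- Minimality at `u` against the point at ratio `t` gives `E ≥ (1 - t) w`, which fails for any `t
  -- < 1 - E / w`; this `t` is half of that bound.
  set t := (w - E) / (2 * w) with ht
  have ht0 : 0 < t := div_pos (by linarith) (by linarith)
  have htw : t * w = (w - E) / 2 := by rw [ht]; field_simp
  have ht1 : t ≤ 1 := by
    rw [ht, div_le_one (by linarith)]; linarith
  have h1 := σ.cn x u s ⟨ht0.le, ht1⟩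
  have h2 : dist x (σ u) ^ 2 ≤ dist x (σ ((1 - t) * u + t * s)) ^ 2 :=
    pow_le_pow_left₀ dist_nonneg (σ.dist_proj_le x _) 2
  have h3 : 0 ≤ t * (E - (1 - t) * w) := by
    have : (u - s) ^ 2 = w := by rw [hw]; ring
    rw [this] at h1
    nlinarith
  have h4 : 0 ≤ E - (1 - t) * w := nonneg_of_mul_nonneg_right h3 ht0
  nlinarith

lemma abs_sub_proj_le (σ : GeodesicLine X) (x : X) (s : ℝ) : |s - σ.proj x| ≤ dist x (σ s) := by
  have := σ.proj_sq x s
  exact abs_le_of_sq_le_sq (by nlinarith [sq_nonneg (dist x (σ (σ.proj x)))]) dist_nonneg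

lemma proj_eq (σ : GeodesicLine X) {x : X} {u : ℝ} (h : ∀ s, dist x (σ u) ≤ dist x (σ s)) :
    σ.proj x = u := by
  have h1 := σ.proj_sq x u
  have h2 := pow_le_pow_left₀ dist_nonneg (h (σ.proj x)) 2
  have : (u - σ.proj x) ^ 2 = 0 := le_antisymm (by linarith) (sq_nonneg _)
  have := pow_eq_zero_iff two_ne_zero |>.1 this
  linarith

lemma proj_self (σ : GeodesicLine X) (u : ℝ) : σ.proj (σ u) = u :=
  σ.proj_eq fun s => by simp

/-- Add `proj_sq` for `x` and for `y` to the quadrilateral inequality for `x`, `y` and their two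
nearest points. -/
lemma abs_proj_sub_proj_le (σ : GeodesicLine X) (x y : X) :
    |σ.proj x - σ.proj y| ≤ dist x y := by
  have h1 := σ.proj_sq x (σ.proj y)
  have h2 := σ.proj_sq y (σ.proj x)
  have h3 := quadrilateral_le x (σ (σ.proj x)) (σ (σ.proj y)) y
  rw [σ.dist_eq, sq_abs, dist_comm _ y, dist_comm _ y, dist_comm y x] at h3
  exact abs_le_of_sq_le_sq (by nlinarith) dist_nonneg

lemma continuous_proj (σ : GeodesicLine X) : Continuous σ.proj :=
  (LipschitzWith.of_dist_le_mul (K := 1) fun x y => by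
    simpa [Real.dist_eq] using σ.abs_proj_sub_proj_le x y).continuous

lemma proj_rev (σ : GeodesicLine X) (x : X) : σ.rev.proj x = -σ.proj x :=
  σ.rev.proj_eq fun s => by simpa using σ.dist_proj_le x (-s)

lemma proj_map (g : X ≃ᵢ X) (σ : GeodesicLine X) (x : X) : (σ.map g).proj (g x) = σ.proj x :=
  (σ.map g).proj_eq fun s => by
    simpa [g.isometry.dist_eq] using σ.dist_proj_le x s

lemma proj_map' (g : X ≃ᵢ X) (σ : GeodesicLine X) (x : X) :
    (σ.map g).proj x = σ.proj (g.symm x) := by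
  conv_lhs => rw [← g.apply_symm_apply x]
  rw [proj_map]

/-- Points between `x` and its nearest point on `σ` have the same nearest point. -/
lemma proj_geo (σ : GeodesicLine X) (x : X) {t : ℝ} (ht : t ∈ Icc (0 : ℝ) 1) :
    σ.proj (geo x (σ (σ.proj x)) t) = σ.proj x :=
  σ.proj_eq fun s => by
    have h1 := dist_triangle x (geo x (σ (σ.proj x)) t) (σ s)
    have h2 := σ.dist_proj_le x s
    rw [dist_left_geo _ _ ht] at h1
    rw [dist_geo_right _ _ ht]
    linarith

end GeodesicLine

/-! ### From the CAT(0)-inequality to the Bruhat–Tits inequality; properness -/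

section Hadamard
variable {X : Type*} [MetricSpace X]

lemma dist_plane (a b c d : ℝ) : dist (!₂[a, b] : EuclideanSpace ℝ (Fin 2)) !₂[c, d] =
    √((a - c) ^ 2 + (b - d) ^ 2) := by
  rw [EuclideanSpace.dist_eq]
  simp [Fin.sum_univ_two, Real.dist_eq, sq_abs]

/-- Only the comparison of a vertex with a point of the opposite side is needed: in the Euclidean
plane the Bruhat–Tits inequality is an equality. -/
lemma IsHadamardSpace.cnSpace (hX : IsHadamardSpace X) : CNSpace X := by
  refine ⟨fun x y t ht => ?_⟩
  obtain ⟨σ, hσ, hσ0, hσ1⟩ := hX.geodesic x y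
  rcases eq_or_lt_of_le (dist_nonneg (x := x) (y := y)) with h0 | ha
  · have hxy : x = y := dist_eq_zero.1 h0.symm
    refine ⟨x, fun p => ?_⟩
    subst hxy
    simp only [dist_self]
    nlinarith
  refine ⟨σ (t * dist x y), fun p => ?_⟩
  obtain ⟨τ, hτ, hτ0, hτ1⟩ := hX.geodesic x p
  set a := dist x y with hadef
  set b := dist x p with hb
  set e := dist y p with he
  have hb0 : 0 ≤ b := dist_nonneg
  have he0 : 0 ≤ e := dist_nonneg
  have t1 : e ≤ a + b := by have := dist_triangle_left y p x; linarith
  have t2 : b ≤ a + e := dist_triangle x y p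
  have t3 : a ≤ b + e := by
    have := dist_triangle_right x y p; linarith
  -- Law of cosines: the comparison triangle has vertices `(0, 0)`, `(a, 0)`, `(u, v)`.
  set u := (a ^ 2 + b ^ 2 - e ^ 2) / (2 * a) with hu
  have hua : 2 * a * u = a ^ 2 + b ^ 2 - e ^ 2 := by rw [hu]; field_simp
  have hub : u ^ 2 ≤ b ^ 2 := by
    have h1 : u ≤ b := by
      rw [hu, div_le_iff₀ (by linarith)]
      nlinarith
    have h2 : -b ≤ u := by
      rw [hu, le_div_iff₀ (by linarith)]
      nlinarith
    exact sq_le_sq' h2 h1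
  set v := √(b ^ 2 - u ^ 2) with hv
  have hv2 : v ^ 2 = b ^ 2 - u ^ 2 := Real.sq_sqrt (by linarith)
  have hs : t * a ∈ Icc 0 a := ⟨mul_nonneg ht.1 ha.le, by nlinarith [ht.2]⟩
  have hsq : ∀ {w z : ℝ}, 0 ≤ z → w = z ^ 2 → √w = z := fun hz h => by
    rw [h, Real.sqrt_sq hz]
  have key := hX.cat0 a b σ τ hσ hτ (hσ0.trans hτ0.symm) !₂[0, 0] !₂[a, 0] !₂[u, v]
    (by rw [dist_plane]; exact hsq ha.le (by ring))
    (by rw [dist_plane]; exact hsq hb0 (by linear_combination hv2))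
    (by rw [dist_plane, hσ1, hτ1]; exact hsq he0 (by linear_combination hv2 - hua))
    (t * a) hs b ⟨hb0, le_rfl⟩ !₂[t * a, 0] !₂[u, v]
    (by rw [dist_plane]; exact hsq hs.1 (by ring))
    (by rw [dist_plane]; exact hsq (by linarith [hs.2]) (by ring))
    (by rw [dist_plane]; exact hsq hb0 (by linear_combination hv2))
    (by rw [dist_plane]; exact hsq (by simp) (by ring))
  rw [hτ1, dist_plane] at key
  have h1 := pow_le_pow_left₀ dist_nonneg key 2
  rw [Real.sq_sqrt (by positivity)] at h1
  rw [dist_comm p, dist_comm p x, dist_comm p y, ← hb, ← he]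
  linear_combination h1 + hv2 - t * hua

/-- Hopf–Rinow: locally compact complete geodesic spaces are proper. -/
lemma properSpace_of_geo [CNSpace X] [CompleteSpace X] [LocallyCompactSpace X] :
    ProperSpace X := by
  have main : ∀ (x : X) (r : ℝ), IsCompact (Metric.closedBall x r) := by
    intro x
    set S := {r : ℝ | IsCompact (Metric.closedBall x r)} with hS
    have hdown : ∀ r ∈ S, ∀ s ≤ r, s ∈ S := fun r hr s hs =>
      hr.of_isClosed_subset Metric.isClosed_closedBall (Metric.closedBall_subset_closedBall hs)
    have h0 : (0 : ℝ) ∈ S := by simp [hS]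
    -- The set of radii of compact balls is open: a compact ball has a compact thickening, which
    -- contains a larger ball because points can be moved inwards along geodesics.
    have hup : ∀ r ∈ S, 0 ≤ r → ∃ δ > 0, r + δ ∈ S := by
      intro r hr hr0
      obtain ⟨δ, hδ, hc⟩ := IsCompact.exists_isCompact_cthickening (hr : IsCompact _)
      refine ⟨δ, hδ, hc.of_isClosed_subset Metric.isClosed_closedBall fun y hy => ?_⟩
      rw [Metric.mem_closedBall, dist_comm] at hy
      rcases le_or_gt (dist x y) r with h | h
      · exact Metric.self_subset_cthickening _ (by rwa [Metric.mem_closedBall, dist_comm])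
      have hd : 0 < dist x y := by linarith
      have ht : r / dist x y ∈ Icc (0 : ℝ) 1 := ⟨by positivity, (div_le_one hd).2 h.le⟩
      refine Metric.mem_cthickening_of_dist_le y (geo x y (r / dist x y)) _ _ ?_ ?_
      · rw [Metric.mem_closedBall, dist_comm, dist_left_geo _ _ ht, div_mul_cancel₀ _ hd.ne']
      · rw [dist_comm, dist_geo_right _ _ ht, sub_mul, div_mul_cancel₀ _ hd.ne']
        linarith
    by_contra! hne
    obtain ⟨R, hR⟩ := hne
    have hbdd : BddAbove S := ⟨R, fun r hr => by
      by_contra! h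
      exact hR (hdown r hr R h.le)⟩
    set ρ := sSup S with hρ
    have hρ0 : 0 ≤ ρ := le_csSup hbdd h0
    -- It contains its supremum: the ball of radius `ρ` lies within `ε / 2` of a smaller compact
    -- ball, hence is totally bounded.
    have hρS : ρ ∈ S := by
      refine isCompact_iff_totallyBounded_isComplete.2
        ⟨?_, Metric.isClosed_closedBall.isComplete⟩
      rw [Metric.totallyBounded_iff]
      intro ε hε
      obtain ⟨r, hr, hrρ⟩ := exists_lt_of_lt_csSup ⟨0, h0⟩ (show ρ - ε / 2 < sSup S by linarith)
      have hmax : max r 0 ∈ S := by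
        rcases le_total r 0 with h | h
        · rwa [max_eq_right h]
        · rwa [max_eq_left h]
      obtain ⟨T, hT, hcov⟩ := Metric.totallyBounded_iff.1
        (hmax : IsCompact (Metric.closedBall x (max r 0))).totallyBounded (ε / 2) (by linarith)
      refine ⟨T, hT, fun y hy => ?_⟩
      rw [Metric.mem_closedBall, dist_comm] at hy
      have hz : ∃ z ∈ Metric.closedBall x (max r 0), dist y z ≤ ε / 2 := by
        rcases le_or_gt (dist x y) (max r 0) with h | h
        · exact ⟨y, by rwa [Metric.mem_closedBall, dist_comm], by simp; linarith⟩
        have hd : 0 < dist x y := (le_max_right r 0).trans_lt h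
        have ht : max r 0 / dist x y ∈ Icc (0 : ℝ) 1 := ⟨by positivity, (div_le_one hd).2 h.le⟩
        refine ⟨geo x y (max r 0 / dist x y), ?_, ?_⟩
        · rw [Metric.mem_closedBall, dist_comm, dist_left_geo _ _ ht, div_mul_cancel₀ _ hd.ne']
        · rw [dist_comm, dist_geo_right _ _ ht, sub_mul, div_mul_cancel₀ _ hd.ne']
          have := le_max_left r 0
          linarith
      obtain ⟨z, hz, hyz⟩ := hz
      obtain ⟨w, hw, hzw⟩ := mem_iUnion₂.1 (hcov hz)
      refine mem_iUnion₂.2 ⟨w, hw, ?_⟩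
      rw [Metric.mem_ball] at hzw ⊢
      linarith [dist_triangle y z w]
    obtain ⟨δ, hδ, h⟩ := hup ρ hρS hρ0
    linarith [le_csSup hbdd h]
  exact ⟨main⟩

lemma IsHadamardSpace.properSpace [LocallyCompactSpace X] (hX : IsHadamardSpace X) :
    ProperSpace X := by
  have := hX.cnSpace
  have := hX.complete
  exact properSpace_of_geo

end Hadamard

/-! ### Geodesics in the product -/

section Product
variable {ι : Type*} [Fintype ι] {X : ι → Type*} [∀ i, MetricSpace (X i)]

lemma piLp_dist_sq (x y : PiLp 2 X) : dist x y ^ 2 = ∑ i, dist (x i) (y i) ^ 2 := by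
  rw [PiLp.dist_eq_sum (by norm_num)]
  simp only [ENNReal.toReal_ofNat, Real.rpow_ofNat]
  rw [← Real.sqrt_eq_rpow, Real.sq_sqrt (Finset.sum_nonneg fun i _ => sq_nonneg _)]

lemma piLp_dist_apply_le (x y : PiLp 2 X) (i : ι) : dist (x i) (y i) ≤ dist x y := by
  refine abs_le_of_sq_le_sq' ?_ dist_nonneg |>.2
  rw [piLp_dist_sq]
  exact Finset.single_le_sum (f := fun i => dist (x i) (y i) ^ 2) (fun i _ => sq_nonneg _)
    (Finset.mem_univ i)

variable [∀ i, CNSpace (X i)]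

lemma piLp_geo_cn (x y : PiLp 2 X) {t : ℝ} (ht : t ∈ Icc (0 : ℝ) 1) (p : PiLp 2 X) :
    dist p (WithLp.toLp 2 fun i => geo (x i) (y i) t : PiLp 2 X) ^ 2 ≤
      (1 - t) * dist p x ^ 2 + t * dist p y ^ 2 - t * (1 - t) * dist x y ^ 2 := by
  simp only [piLp_dist_sq, Finset.mul_sum, ← Finset.sum_add_distrib, ← Finset.sum_sub_distrib]
  exact Finset.sum_le_sum fun i _ => geo_cn (x i) (y i) ht (p i)

instance : CNSpace (PiLp 2 X) := ⟨fun x y _ ht => ⟨_, piLp_geo_cn x y ht⟩⟩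

/-- The coordinatewise point satisfies the inequality that characterizes `geo x y t`; evaluated at
`geo x y t` its right-hand side vanishes. -/
lemma piLp_geo_apply (x y : PiLp 2 X) {t : ℝ} (ht : t ∈ Icc (0 : ℝ) 1) (i : ι) :
    (geo x y t) i = geo (x i) (y i) t := by
  have h := piLp_geo_cn x y ht (geo x y t)
  rw [dist_comm _ x, dist_left_geo x y ht, dist_geo_right x y ht] at h
  have h0 : dist (geo x y t) (WithLp.toLp 2 fun i => geo (x i) (y i) t : PiLp 2 X) ^ 2 ≤ 0 := by
    nlinarith
  have h1 := dist_eq_zero.1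
    (pow_eq_zero_iff two_ne_zero |>.1 (le_antisymm h0 (sq_nonneg _)))
  rw [h1]

end Product

/-! ### Limits along an ultrafilter -/

/-- Taking limits along one fixed ultrafilter makes all bounded sequences converge simultaneously
and so replaces diagonal subsequences. -/
lemma exists_ultralimit {X : Type*} [MetricSpace X] [ProperSpace X] (u : ℕ → X) (p : X) (R : ℝ)
    (h : ∀ᶠ n in (hyperfilter ℕ : Filter ℕ), dist (u n) p ≤ R) :
    ∃ x, Tendsto u (hyperfilter ℕ) (𝓝 x) := by
  have h1 : (((hyperfilter ℕ).map u : Ultrafilter X) : Filter X) ≤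
      𝓟 (Metric.closedBall p R) := by
    rw [le_principal_iff]
    exact h
  obtain ⟨x, -, hx⟩ := (isCompact_closedBall p R).ultrafilter_le_nhds _ h1
  exact ⟨x, hx⟩

lemma tendsto_hyperfilter {X : Type*} {l : Filter X} {u : ℕ → X} (h : Tendsto u atTop l) :
    Tendsto u (hyperfilter ℕ) l :=
  h.mono_left (by rw [← Nat.cofinite_eq_atTop]; exact hyperfilter_le_cofinite)

lemma eventually_hyperfilter {p : ℕ → Prop} (h : ∀ᶠ n in atTop, p n) :
    ∀ᶠ n in (hyperfilter ℕ : Filter ℕ), p n :=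
  (show (hyperfilter ℕ : Filter ℕ) ≤ atTop by
    rw [← Nat.cofinite_eq_atTop]; exact hyperfilter_le_cofinite) h

/-! ### Flat points, flat strips and flat half-planes -/

namespace GeodesicLine
variable {X : Type*} [MetricSpace X]

/-- The point `p` lies in a half-plane bounded by `σ` with coordinates `(D, s₀)`, as far as the
distances from the points of `σ` are concerned. -/
def IsFlatPoint (σ : GeodesicLine X) (p : X) (s₀ D : ℝ) : Prop :=
  ∀ s, dist p (σ s) ^ 2 = (s - s₀) ^ 2 + D ^ 2

/-- The Euclidean line through `(s, a)` and `(t, b)` meets the boundary at `u`. The distances of `p`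
and `q` from `σ u` are the Euclidean ones, and their difference is the Euclidean distance of the two
points, so the triangle inequality suffices. -/
lemma IsFlatPoint.le_dist_of_lt {σ : GeodesicLine X} {p q : X} {s t a b : ℝ} (ha : 0 ≤ a)
    (hab : a < b) (hp : σ.IsFlatPoint p s a) (hq : σ.IsFlatPoint q t b) :
    (s - t) ^ 2 + (a - b) ^ 2 ≤ dist p q ^ 2 := by
  have hba : 0 < b - a := sub_pos.2 hab
  set k := (s - t) / (b - a) with hk
  have hkm : k * (b - a) = s - t := by rw [hk]; field_simp
  set u := s + a * k with hu
  set H := √(k ^ 2 + 1) with hH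
  have hH2 : H ^ 2 = k ^ 2 + 1 := Real.sq_sqrt (by positivity)
  have hH0 : 0 ≤ H := Real.sqrt_nonneg _
  have h1 : dist p (σ u) = a * H := by
    refine (pow_left_inj₀ dist_nonneg (by positivity) two_ne_zero).1 ?_
    rw [hp u, hu]
    linear_combination -a ^ 2 * hH2
  have h2 : dist q (σ u) = b * H := by
    refine (pow_left_inj₀ dist_nonneg (mul_nonneg (by linarith) hH0) two_ne_zero).1 ?_
    have h3 : u - t = b * k := by rw [hu]; linear_combination -hkm
    rw [hq u, h3]
    linear_combination -b ^ 2 * hH2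
  have h3 := dist_triangle_left q (σ u) p
  have h4 : (b - a) * H ≤ dist p q := by linarith
  have h5 := pow_le_pow_left₀ (by positivity) h4 2
  calc (s - t) ^ 2 + (a - b) ^ 2 = ((b - a) * H) ^ 2 := by
        rw [mul_pow, hH2, ← hkm]; ring
    _ ≤ _ := h5

variable [CNSpace X]

/-- A convex function on `ℝ` which is bounded by an affine function is affine. -/
lemma isFlatPoint_of_le (σ : GeodesicLine X) {q : X} {w s₀ D : ℝ}
    (h : ∀ s, dist q (σ s) ^ 2 ≤ (s - s₀) ^ 2 + D ^ 2)
    (hw : dist q (σ w) ^ 2 = (w - s₀) ^ 2 + D ^ 2) : σ.IsFlatPoint q s₀ D := by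
  intro s
  refine le_antisymm (h s) ?_
  have h1 := σ.midpoint_cn q w (s - w)
  have h2 := h (w - (s - w))
  rw [show w + (s - w) = s by ring] at h1
  nlinarith

/-- The Bruhat–Tits inequality bounds the distances to `σ` from above, with equality at `w`;
`isFlatPoint_of_le` then forces equality everywhere. -/
lemma IsFlatPoint.at_geo {σ : GeodesicLine X} {p : X} {s₀ D : ℝ} (h : σ.IsFlatPoint p s₀ D) (w : ℝ)
    {t : ℝ} (ht : t ∈ Icc (0 : ℝ) 1) :
    σ.IsFlatPoint (geo (σ w) p t) ((1 - t) * w + t * s₀) (t * D) := by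
  refine σ.isFlatPoint_of_le (w := w) (fun s => ?_) ?_
  · have h1 := geo_cn (σ w) p ht (σ s)
    rw [dist_comm, dist_comm (σ s) p, dist_comm (σ w) p, h s, h w, σ.dist_eq, sq_abs] at h1
    linear_combination h1
  · rw [dist_comm, dist_left_geo _ _ ht, mul_pow, dist_comm, h w]
    ring

lemma IsFlatPoint.dist_geo_geo_le {σ : GeodesicLine X} {p : X} {s₀ D : ℝ}
    (h : σ.IsFlatPoint p s₀ D) (w v : ℝ) {t r : ℝ} (ht : t ∈ Icc (0 : ℝ) 1)
    (hr : r ∈ Icc (0 : ℝ) 1) :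
    dist (geo (σ w) p t) (geo (σ v) p r) ^ 2 ≤
      (((1 - t) * w + t * s₀) - ((1 - r) * v + r * s₀)) ^ 2 + (t * D - r * D) ^ 2 := by
  have h1 := geo_cn (σ w) p ht (geo (σ v) p r)
  have h2 := h.at_geo v hr w
  have h3 : dist (geo (σ v) p r) p ^ 2 = (1 - r) ^ 2 * ((v - s₀) ^ 2 + D ^ 2) := by
    rw [dist_geo_right _ _ hr, mul_pow, dist_comm, h v]
  rw [dist_comm, h2, h3, dist_comm (σ w) p, h w] at h1
  linear_combination h1

/-- For `a = b` the line through the two points is parallel to the boundary, and the quadrilateral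
inequality replaces the argument of `le_dist_of_lt`. -/
lemma IsFlatPoint.le_dist {σ : GeodesicLine X} {p q : X} {s t a b : ℝ} (ha : 0 ≤ a) (hb : 0 ≤ b)
    (hp : σ.IsFlatPoint p s a) (hq : σ.IsFlatPoint q t b) :
    (s - t) ^ 2 + (a - b) ^ 2 ≤ dist p q ^ 2 := by
  rcases lt_trichotomy a b with h | h | h
  · exact hp.le_dist_of_lt ha h hq
  · subst h
    have h1 := quadrilateral_le p q (σ t) (σ s)
    rw [σ.dist_eq, sq_abs, dist_comm (σ s) p, hp t, hp s, hq t, hq s] at h1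
    linarith
  · rw [dist_comm, show (s - t) ^ 2 + (a - b) ^ 2 = (t - s) ^ 2 + (b - a) ^ 2 by ring]
    exact hq.le_dist_of_lt hb h hp

/-- A flat point at distance `D` spans a flat strip. -/
lemma IsFlatPoint.exists_strip {σ : GeodesicLine X} {p : X} {s₀ D : ℝ}
    (h : σ.IsFlatPoint p s₀ D) (hD : 0 < D) : ∃ f : ℝ → ℝ → X,
      (∀ a ∈ Ico 0 D, ∀ b ∈ Ico 0 D, ∀ s t : ℝ,
        dist (f a s) (f b t) = √((a - b) ^ 2 + (s - t) ^ 2)) ∧ ∀ t, f 0 t = σ t := by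
  -- The point with coordinates `(s, a)` lies on the segment from `p` to the point `σ w` with `(1 -
  -- a / D) w + (a / D) s₀ = s`. Solving for `w` requires `a < D`, so the strip is half open.
  refine ⟨fun a s => geo (σ ((s - a / D * s₀) / (1 - a / D))) p (a / D), ?_, ?_⟩
  · intro a ha b hb s t
    have hpar : ∀ c ∈ Ico 0 D, c / D ∈ Icc (0 : ℝ) 1 ∧ 0 < 1 - c / D ∧ c / D * D = c := by
      intro c hc
      have h1 : c / D < 1 := (div_lt_one hD).2 hc.2
      exact ⟨⟨div_nonneg hc.1 hD.le, h1.le⟩, sub_pos.2 h1, div_mul_cancel₀ _ hD.ne'⟩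
    obtain ⟨ha1, ha2, ha3⟩ := hpar a ha
    obtain ⟨hb1, hb2, hb3⟩ := hpar b hb
    have hsa : (1 - a / D) * ((s - a / D * s₀) / (1 - a / D)) + a / D * s₀ = s := by
      rw [mul_div_cancel₀ _ ha2.ne']; ring
    have htb : (1 - b / D) * ((t - b / D * s₀) / (1 - b / D)) + b / D * s₀ = t := by
      rw [mul_div_cancel₀ _ hb2.ne']; ring
    have hp := h.at_geo ((s - a / D * s₀) / (1 - a / D)) ha1
    have hq := h.at_geo ((t - b / D * s₀) / (1 - b / D)) hb1
    have hle := h.dist_geo_geo_le ((s - a / D * s₀) / (1 - a / D))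
      ((t - b / D * s₀) / (1 - b / D)) ha1 hb1
    rw [hsa, htb, ha3, hb3] at hle
    rw [hsa, ha3] at hp
    rw [htb, hb3] at hq
    have hge := hp.le_dist ha.1 hb.1 hq
    rw [add_comm ((a - b) ^ 2), ← le_antisymm hle hge, Real.sqrt_sq dist_nonneg]
  · intro t
    simp [geo_zero]

/-- If there are flat points at arbitrarily large distance from `σ`, then `σ` bounds a flat
half-plane. -/
lemma boundsFlatHalfPlane_of_isFlatPoint [ProperSpace X] (σ : GeodesicLine X)
    (h : ∀ n : ℕ, ∃ (D : ℝ) (p : X) (s₀ : ℝ), n < D ∧ σ.IsFlatPoint p s₀ D) :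
    σ.BoundsFlatHalfPlane := by
  choose D p s₀ hD hp using h
  choose f hf hf0 using fun n => (hp n).exists_strip ((Nat.cast_nonneg n).trans_lt (hD n))
  have hmem : ∀ a : ℝ≥0, ∀ᶠ n in (hyperfilter ℕ : Filter ℕ), (a : ℝ) ∈ Ico 0 (D n) := by
    intro a
    refine eventually_hyperfilter ?_
    obtain ⟨N, hN⟩ := exists_nat_ge (a : ℝ)
    filter_upwards [eventually_ge_atTop N] with n hn
    exact ⟨a.2, hN.trans_lt ((Nat.cast_le.2 hn).trans_lt (hD n))⟩
  have hlim : ∀ (a : ℝ≥0) (s : ℝ), ∃ x, Tendsto (fun n => f n a s) (hyperfilter ℕ) (𝓝 x) := by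
    intro a s
    refine exists_ultralimit _ (σ 0) √((a - 0) ^ 2 + (s - 0) ^ 2) ?_
    filter_upwards [hmem a, hmem 0] with n h1 h2
    rw [← hf0 n 0]
    exact (hf n a h1 0 h2 s 0).le
  choose F hF using hlim
  refine ⟨F, fun a b s t => ?_, fun t => ?_⟩
  · refine tendsto_nhds_unique ((hF a s).dist (hF b t)) ?_
    refine tendsto_const_nhds.congr' ?_
    filter_upwards [hmem a, hmem b] with n h1 h2
    exact (hf n a h1 b h2 s t).symm
  · refine tendsto_nhds_unique ?_ (hF 0 t)
    simp only [NNReal.coe_zero, hf0]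
    exact tendsto_const_nhds

end GeodesicLine

/-! ### Powers of an isometry on its axis -/

section Axis
variable {X : Type*} [MetricSpace X] {g : X ≃ᵢ X} {σ : GeodesicLine X} {l : ℝ}

lemma zpow_apply_axis (hg : ∀ t, g (σ t) = σ (t + l)) (n : ℤ) (t : ℝ) :
    (g ^ n) (σ t) = σ (t + n * l) := by
  have hinv : ∀ t, g⁻¹ (σ t) = σ (t - l) := fun t => by
    have h : g⁻¹ (g (σ (t - l))) = σ (t - l) := g.symm_apply_apply _
    rwa [hg, sub_add_cancel] at h
  induction n using Int.induction_on generalizing t with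
  | zero => simp
  | succ n ih =>
    rw [zpow_add_one, IsometryEquiv.mul_apply, hg, ih]
    congr 1
    push_cast
    ring
  | pred n ih =>
    rw [zpow_sub_one, IsometryEquiv.mul_apply, hinv, ih]
    congr 1
    push_cast
    ring

lemma dist_zpow_axis (hg : ∀ t, g (σ t) = σ (t + l)) (n : ℤ) (x : X) (t : ℝ) :
    dist ((g ^ n) x) (σ t) = dist x (σ (t - n * l)) := by
  have h := zpow_apply_axis hg n (t - n * l)
  rw [sub_add_cancel] at h
  rw [← h, (g ^ n).isometry.dist_eq]

lemma proj_zpow [CNSpace X] (hg : ∀ t, g (σ t) = σ (t + l)) (n : ℤ) (x : X) :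
    σ.proj ((g ^ n) x) = σ.proj x + n * l :=
  σ.proj_eq fun s => by
    rw [dist_zpow_axis hg, dist_zpow_axis hg, add_sub_cancel_right]
    exact σ.dist_proj_le x _

end Axis

/-! ### Growth of distances along a rank one axis -/

namespace GeodesicLine
variable {X : Type*} [MetricSpace X] [CNSpace X]

lemma convexOn_dist (σ : GeodesicLine X) (p : X) : ConvexOn ℝ univ fun s => dist p (σ s) := by
  refine ⟨convex_univ, fun u _ v _ a b ha hb hab => ?_⟩
  have := σ.dist_convex p u v (t := b) ⟨hb, by linarith⟩
  rw [show 1 - b = a by linarith] at this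
  simpa using this

lemma dist_mono_of_proj_le (σ : GeodesicLine X) {x : X} {s t : ℝ} (hs : σ.proj x ≤ s)
    (hst : s ≤ t) : dist x (σ s) ≤ dist x (σ t) := by
  have h1 := σ.dist_proj_le x t
  rcases eq_or_lt_of_le hs with h | h
  · rw [← h]; exact h1
  rcases eq_or_lt_of_le hst with h' | h'
  · rw [h']
  have h2 := (σ.convexOn_dist x).slope_mono_adjacent (mem_univ _) (mem_univ t) h h'
  have h3 : 0 ≤ (dist x (σ s) - dist x (σ (σ.proj x))) / (s - σ.proj x) :=
    div_nonneg (sub_nonneg.2 (σ.dist_proj_le x s)) (by linarith)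
  have h4 := h3.trans h2
  rw [le_div_iff₀ (by linarith)] at h4
  linarith

/-- If the distance from `x` grows too slowly along a long interval, then it is almost affine on
a long subinterval. -/
lemma exists_almost_affine (σ : GeodesicLine X) {c : ℝ} (hc : c ≤ 1) {N : ℕ} (hN : 1 ≤ N) {x : X}
    {u : ℝ} (hu : σ.proj x ≤ u - ((N ^ 2 + 1) * N + 1))
    (hslow : dist x (σ (u + 1)) < dist x (σ u) + c) :
    ∃ v e : ℝ, N ≤ dist x (σ v) ∧ 0 ≤ e ∧ e ≤ c ∧
      ∀ s ∈ Icc (-N : ℝ) N, dist x (σ (v + s)) ≤ dist x (σ v) + e * s + 1 / N := by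
  have hN0 : (0 : ℝ) < N := by exact_mod_cast hN
  set u₀ := u - (((N : ℝ) ^ 2 + 1) * N + 1) with hu₀
  set F := fun s => dist x (σ s) with hF
  have hconv : ConvexOn ℝ univ F := σ.convexOn_dist x
  -- Increments of the distance over `N² + 1` blocks of length `N`, the last ending at `u - 1`. By
  -- convexity they lie in `[0, cN]`, so one of the `N²` successive differences is at most `1 / N`.
  set a : ℕ → ℝ := fun j => F (u₀ + (j + 1) * N) - F (u₀ + j * N) with ha
  have ha0 : ∀ j, 0 ≤ a j := fun j => sub_nonneg.2 <| σ.dist_mono_of_proj_le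
    (hu.trans (by have : (0 : ℝ) ≤ j * N := by positivity
                  linarith)) (by nlinarith)
  have hac : ∀ j ≤ N ^ 2, a j ≤ c * N := by
    intro j hj
    have hj' : (j : ℝ) ≤ N ^ 2 := by exact_mod_cast hj
    have hlt : u₀ + (j + 1) * N < u := by rw [hu₀]; nlinarith
    have h1 := hconv.slope_mono_adjacent (mem_univ (u₀ + j * N)) (mem_univ u)
      (show u₀ + j * N < u₀ + (j + 1) * N by nlinarith) hlt
    have h2 := hconv.slope_mono_adjacent (mem_univ (u₀ + (j + 1) * N)) (mem_univ (u + 1))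
      hlt (lt_add_one u)
    have h3 : (F (u₀ + (j + 1) * N) - F (u₀ + j * N)) / (u₀ + (j + 1) * N - (u₀ + j * N)) ≤ c := by
      refine h1.trans (h2.trans ?_)
      simp only [add_sub_cancel_left, div_one]
      exact (sub_lt_iff_lt_add'.2 hslow).le
    rw [div_le_iff₀ (by nlinarith)] at h3
    linarith
  obtain ⟨j, hj, hjj⟩ : ∃ j < N ^ 2, a (j + 1) - a j ≤ 1 / N := by
    by_contra! hcon
    have h1 : ∑ j ∈ Finset.range (N ^ 2), (1 / N : ℝ) <
        ∑ j ∈ Finset.range (N ^ 2), (a (j + 1) - a j) :=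
      Finset.sum_lt_sum_of_nonempty (by simp; omega) fun j hj => hcon j (Finset.mem_range.1 hj)
    rw [Finset.sum_range_sub, Finset.sum_const, Finset.card_range, nsmul_eq_mul] at h1
    have h2 : ((N ^ 2 : ℕ) : ℝ) * (1 / N) = N := by push_cast; field_simp
    rw [h2] at h1
    have h3 := hac (N ^ 2) le_rfl
    have h4 := ha0 0
    nlinarith
  -- The common end of blocks `j` and `j + 1`. The slope `e` is that of block `j + 1`; block `j` has
  -- slope at least `e - 1 / N²`, which costs at most `1 / N` over length `N`.
  set v := u₀ + (j + 1) * N with hv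
  have e1 : a (j + 1) = F (v + N) - F v := by
    simp only [ha, hv]; push_cast; ring_nf
  have e2 : a j = F v - F (v - N) := by
    simp only [ha, hv]; ring_nf
  refine ⟨v, a (j + 1) / N, ?_, div_nonneg (ha0 _) hN0.le, ?_, ?_⟩
  · have h1 := σ.abs_sub_proj_le x v
    have h2 := le_abs_self (v - σ.proj x)
    have h3 : (0 : ℝ) ≤ j * N := by positivity
    rw [hv] at h1 h2 ⊢
    linarith
  · rw [div_le_iff₀ hN0]
    exact hac _ hj
  · intro s hs
    rcases le_total 0 s with h | h
    · have h1 := σ.dist_convex x v (v + N) (t := s / N)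
        ⟨div_nonneg h hN0.le, (div_le_one hN0).2 hs.2⟩
      rw [show (1 - s / N) * v + s / N * (v + N) = v + s by field_simp; ring] at h1
      have h2 : a (j + 1) / N * s = s / N * (dist x (σ (v + N)) - dist x (σ v)) := by
        rw [e1]; ring
      have h3 : (0 : ℝ) ≤ 1 / N := by positivity
      linarith
    · have hl0 : 0 ≤ -s / N := div_nonneg (by linarith) hN0.le
      have hl1 : -s / N ≤ 1 := (div_le_one hN0).2 (by linarith [hs.1])
      have h1 := σ.dist_convex x v (v - N) (t := -s / N) ⟨hl0, hl1⟩
      rw [show (1 - -s / N) * v + -s / N * (v - N) = v + s by field_simp; ring] at h1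
      have h2 : a (j + 1) / N * s = -(-s / N * a (j + 1)) := by ring
      have h3 : -s / N * (a (j + 1) - a j) ≤ 1 * (1 / N) :=
        (mul_le_mul_of_nonneg_left hjj hl0).trans
          (mul_le_mul_of_nonneg_right hl1 (by positivity))
      have h4 : -s / N * a j = -s / N * (dist x (σ v) - dist x (σ (v - N))) := by rw [e2]
      linarith

/-- A point on the geodesic to a remote point from which the distances are almost affine. -/
lemma dist_geo_sq_le_of_affine (σ : GeodesicLine X) {x : X} {v e s ε t : ℝ} (ht : 0 < t)
    (htT : t ≤ dist x (σ v)) (he0 : 0 ≤ e) (he1 : e ≤ 1) (hε0 : 0 ≤ ε) (hε1 : ε ≤ 1)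
    (h : dist x (σ (v + s)) ≤ dist x (σ v) + e * s + ε) :
    dist (geo (σ v) x (t / dist x (σ v))) (σ (v + s)) ^ 2 ≤
      s ^ 2 + t ^ 2 + 2 * t * (e * s + ε) + t / dist x (σ v) * (|s| + 1) ^ 2 := by
  set T := dist x (σ v) with hT
  have hT0 : 0 < T := ht.trans_le htT
  set r := t / T with hr
  have hrT : r * T = t := div_mul_cancel₀ _ hT0.ne'
  have hr0 : 0 < r := div_pos ht hT0
  have hr1 : r ≤ 1 := (div_le_one hT0).2 htT
  have h1 := geo_cn (σ v) x ⟨hr0.le, hr1⟩ (σ (v + s))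
  rw [dist_comm, dist_comm (σ v) x, ← hT, dist_comm (σ (v + s)) x, σ.dist_eq,
    add_sub_cancel_left, sq_abs] at h1
  have h2 : dist x (σ (v + s)) ^ 2 ≤ (T + (e * s + ε)) ^ 2 :=
    pow_le_pow_left₀ dist_nonneg (by linarith) 2
  have h3 : (e * s + ε) ^ 2 ≤ (|s| + 1) ^ 2 := by
    refine sq_le_sq.2 ?_
    rw [abs_of_nonneg (by positivity : 0 ≤ |s| + 1)]
    refine (abs_add_le _ _).trans ?_
    rw [abs_mul, abs_of_nonneg he0, abs_of_nonneg hε0]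
    nlinarith [abs_nonneg s]
  have h4 := mul_le_mul_of_nonneg_left h2 hr0.le
  have h5 := mul_le_mul_of_nonneg_left h3 hr0.le
  have h6 : 0 ≤ r * s ^ 2 := by positivity
  have h7 : r * (T + (e * s + ε)) ^ 2 - r * (1 - r) * T ^ 2 =
      t ^ 2 + 2 * t * (e * s + ε) + r * (e * s + ε) ^ 2 := by
    rw [← hrT]; ring
  linarith

/-- If the axis `σ` of an isometry of a proper space does not bound a flat half-plane, then the
distance from a point `x` to the points of `σ` grows at speed close to one, uniformly in `x`, as
soon as the nearest point is sufficiently far away. -/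
lemma exists_slope_bound [ProperSpace X] {g : X ≃ᵢ X} {σ : GeodesicLine X} {l : ℝ} (hl : 0 < l)
    (hg : ∀ t, g (σ t) = σ (t + l)) (hσ : ¬ σ.BoundsFlatHalfPlane) {c : ℝ} (hc : c < 1) :
    ∃ M : ℝ, 0 ≤ M ∧ ∀ (x : X) (u : ℝ), σ.proj x ≤ u - M →
      dist x (σ u) + c ≤ dist x (σ (u + 1)) := by
  by_contra! hcon
  apply hσ
  have hseq : ∀ n : ℕ, ∃ (x : X) (v e : ℝ), ((n + 1 : ℕ) : ℝ) ≤ dist x (σ v) ∧ v ∈ Icc 0 l ∧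
      0 ≤ e ∧ e ≤ c ∧ ∀ s ∈ Icc (-((n + 1 : ℕ) : ℝ)) (n + 1 : ℕ),
        dist x (σ (v + s)) ≤ dist x (σ v) + e * s + 1 / (n + 1 : ℕ) := by
    intro n
    obtain ⟨x, u, hu, hslow⟩ := hcon ((((n + 1 : ℕ) : ℝ) ^ 2 + 1) * (n + 1 : ℕ) + 1) (by positivity)
    obtain ⟨v, e, h1, h2, h3, h4⟩ := σ.exists_almost_affine hc.le (Nat.le_add_left 1 n) hu hslow
    have hd : ∀ s, dist ((g ^ (-⌊v / l⌋)) x) (σ (v - ⌊v / l⌋ * l + s)) = dist x (σ (v + s)) := by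
      intro s
      rw [dist_zpow_axis hg]
      congr 2
      push_cast
      ring
    have hd0 := hd 0
    rw [add_zero, add_zero] at hd0
    -- A power of `g` brings the parameter into `[0, l]`, so that limits exist.
    refine ⟨(g ^ (-⌊v / l⌋)) x, v - ⌊v / l⌋ * l, e, ?_, ⟨?_, ?_⟩, h2, h3, fun s hs => ?_⟩
    · rw [hd0]; exact h1
    · have := Int.floor_le (v / l)
      rw [le_div_iff₀ hl] at this
      linarith
    · have := (Int.lt_floor_add_one (v / l)).le
      rw [div_le_iff₀ hl] at this
      linarith
    · rw [hd0, hd]; exact h4 s hs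
  choose x v e hxT hv he0 hec hlin using hseq
  have hinv : Tendsto (fun n : ℕ => (1 : ℝ) / (n + 1 : ℕ)) (hyperfilter ℕ) (𝓝 0) :=
    tendsto_hyperfilter (by simpa using tendsto_one_div_add_atTop_nhds_zero_nat (𝕜 := ℝ))
  obtain ⟨v', hv'⟩ := exists_ultralimit v 0 l (Eventually.of_forall fun n => by
    rw [Real.dist_eq, sub_zero, abs_of_nonneg (hv n).1]; exact (hv n).2)
  obtain ⟨e', he'⟩ := exists_ultralimit e 0 c (Eventually.of_forall fun n => by
    rw [Real.dist_eq, sub_zero, abs_of_nonneg (he0 n)]; exact hec n)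
  have he'0 : 0 ≤ e' := ge_of_tendsto' he' he0
  have he'c : e' ≤ c := le_of_tendsto' he' hec
  -- The limit of the points at distance `t` from `σ (v n)` in the direction of `x n`. With `s' = s
  -- - v'` the limiting bound is `s'² + t² + 2 t e' s' = (s' + t e')² + t² (1 - e'²)`, which gives
  -- the flat coordinates. As `e' ≤ c < 1`, the distance `t √(1 - e'²)` is unbounded.
  have hflat : ∀ t : ℝ, 0 < t → ∃ p, σ.IsFlatPoint p (v' - t * e') (t * √(1 - e' ^ 2)) := by
    intro t ht
    have hev : ∀ᶠ n in (hyperfilter ℕ : Filter ℕ), t ≤ dist (x n) (σ (v n)) := by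
      refine eventually_hyperfilter ?_
      obtain ⟨N, hN⟩ := exists_nat_ge t
      filter_upwards [eventually_ge_atTop N] with n hn
      refine le_trans (hN.trans ?_) (hxT n)
      exact_mod_cast hn.trans n.le_succ
    set p := fun n => geo (σ (v n)) (x n) (t / dist (x n) (σ (v n))) with hp
    have hpd : ∀ᶠ n in (hyperfilter ℕ : Filter ℕ), dist (p n) (σ (v n)) = t := by
      filter_upwards [hev] with n hn
      have h0 : 0 < dist (x n) (σ (v n)) := ht.trans_le hn
      rw [hp, dist_comm, dist_left_geo _ _ ⟨by positivity, (div_le_one h0).2 hn⟩,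
        dist_comm (σ (v n)), div_mul_cancel₀ _ h0.ne']
    obtain ⟨p', hp'⟩ := exists_ultralimit p (σ 0) (t + l) (by
      filter_upwards [hpd] with n hn
      have := dist_triangle (p n) (σ (v n)) (σ 0)
      rw [hn, σ.dist_eq, sub_zero, abs_of_nonneg (hv n).1] at this
      linarith [(hv n).2])
    have hσlim : ∀ s, Tendsto (fun n => σ (v n + s)) (hyperfilter ℕ) (𝓝 (σ (v' + s))) := fun s =>
      (σ.isometry.continuous.tendsto _).comp (hv'.add_const s)
    have hd0 : dist p' (σ v') = t := by
      have h1 := hp'.dist (hσlim 0)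
      simp only [add_zero] at h1
      exact tendsto_nhds_unique h1 (tendsto_const_nhds.congr' (by
        filter_upwards [hpd] with n hn using hn.symm))
    have h1e : 0 ≤ 1 - e' ^ 2 := by nlinarith
    refine ⟨p', σ.isFlatPoint_of_le (w := v') (fun s => ?_) ?_⟩
    · rw [mul_pow, Real.sq_sqrt h1e]
      set s' := s - v' with hs'
      have hss : s = v' + s' := by rw [hs']; ring
      have hlhs := (hp'.dist (hσlim s')).pow 2
      have hrhs : Tendsto (fun n : ℕ => s' ^ 2 + t ^ 2 + 2 * t * (e n * s' + 1 / (n + 1 : ℕ)) +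
          t * (1 / (n + 1 : ℕ)) * (|s'| + 1) ^ 2) (hyperfilter ℕ)
          (𝓝 (s' ^ 2 + t ^ 2 + 2 * t * (e' * s' + 0) + t * 0 * (|s'| + 1) ^ 2)) :=
        (((he'.mul_const s').add hinv).const_mul (2 * t)).const_add _ |>.add
          ((hinv.const_mul t).mul_const _)
      have hle := le_of_tendsto_of_tendsto hlhs hrhs (by
        have hs : ∀ᶠ n : ℕ in (hyperfilter ℕ : Filter ℕ), |s'| ≤ (n + 1 : ℕ) := by
          refine eventually_hyperfilter ?_
          obtain ⟨N, hN⟩ := exists_nat_ge |s'|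
          filter_upwards [eventually_ge_atTop N] with n hn
          exact hN.trans (by exact_mod_cast hn.trans n.le_succ)
        filter_upwards [hev, hs] with n hn hsn
        have hpos : (0 : ℝ) < (n + 1 : ℕ) := by positivity
        refine (σ.dist_geo_sq_le_of_affine ht hn (he0 n) ((hec n).trans hc.le) (by positivity)
          ((div_le_one hpos).2 (by simp)) (hlin n s' (abs_le.1 hsn))).trans ?_
        have h3 : t / dist (x n) (σ (v n)) ≤ t * (1 / (n + 1 : ℕ)) := by
          rw [mul_one_div]
          exact div_le_div_of_nonneg_left ht.le hpos (hxT n)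
        have h4 := mul_le_mul_of_nonneg_right h3 (sq_nonneg (|s'| + 1))
        linarith)
      rw [hss]
      refine hle.trans (le_of_eq ?_)
      ring
    · rw [hd0, mul_pow, Real.sq_sqrt h1e]
      ring
  refine σ.boundsFlatHalfPlane_of_isFlatPoint fun n => ?_
  have hpos : 0 < √(1 - e' ^ 2) := Real.sqrt_pos.2 (by nlinarith)
  obtain ⟨p, hp⟩ := hflat ((n + 1) / √(1 - e' ^ 2)) (by positivity)
  refine ⟨_, p, _, ?_, hp⟩
  rw [div_mul_cancel₀ _ hpos.ne']
  linarith

end GeodesicLine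

/-! ### Contracting lines -/

namespace GeodesicLine
variable {X : Type*} [MetricSpace X]

lemma BoundsFlatHalfPlane.of_rev {σ : GeodesicLine X} (h : σ.rev.BoundsFlatHalfPlane) :
    σ.BoundsFlatHalfPlane := by
  obtain ⟨f, hf, hf0⟩ := h
  refine ⟨fun a s => f a (-s), fun a b s t => ?_, fun t => ?_⟩
  · rw [hf, show (-s - -t) ^ 2 = (s - t) ^ 2 by ring]
  · simp only
    rw [← hf0, rev_apply, neg_neg]

lemma inv_apply_rev {g : X ≃ᵢ X} {σ : GeodesicLine X} {l : ℝ} (hg : ∀ t, g (σ t) = σ (t + l))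
    (t : ℝ) : g⁻¹ (σ.rev t) = σ.rev (t + l) := by
  have h := zpow_apply_axis hg (-1) (-t)
  rw [zpow_neg_one] at h
  rw [rev_apply, h, rev_apply]
  congr 1
  push_cast
  ring

/-- A line is contracting if geodesics between points with distant projections to the line follow
the line between these projections. -/
structure Contracting (σ : GeodesicLine X) (C : ℝ) : Prop where
  nonneg : 0 ≤ C
  le_dist : ∀ x y, C ≤ |σ.proj x - σ.proj y| →
    dist x (σ (σ.proj x)) + |σ.proj x - σ.proj y| + dist y (σ (σ.proj y)) ≤ dist x y + C

variable [CNSpace X]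

lemma Contracting.rev {σ : GeodesicLine X} {C : ℝ} (h : σ.Contracting C) :
    σ.rev.Contracting C := by
  refine ⟨h.nonneg, fun x y hxy => ?_⟩
  have e : ∀ a b : ℝ, |-a - -b| = |a - b| := fun a b => by rw [← abs_neg]; congr 1; ring
  simp only [proj_rev, rev_apply, neg_neg, e] at hxy ⊢
  exact h.le_dist x y hxy

lemma Contracting.map {σ : GeodesicLine X} {C : ℝ} (h : σ.Contracting C) (g : X ≃ᵢ X) :
    (σ.map g).Contracting C := by
  refine ⟨h.nonneg, fun x y hxy => ?_⟩
  have := h.le_dist (g.symm x) (g.symm y) (by rwa [proj_map', proj_map'] at hxy)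
  rw [proj_map', proj_map', map_apply, map_apply]
  rw [← g.symm.isometry.dist_eq x, ← g.symm.isometry.dist_eq y, ← g.symm.isometry.dist_eq x y]
  simpa using this

/-- A geodesic between points with distant projections to a contracting line passes close to each
point of the line between these projections. -/
lemma Contracting.exists_dist_le {σ : GeodesicLine X} {C : ℝ} (h : σ.Contracting C) {x y : X}
    {t : ℝ} (hx : σ.proj x + C ≤ t) (hy : t + C ≤ σ.proj y) :
    ∃ r ∈ Icc (0 : ℝ) 1, dist (geo x y r) (σ t) ≤ C := by
  have hC := h.nonneg
  have hcont : ContinuousOn (fun r => σ.proj (geo x y r)) (Icc 0 1) :=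
    σ.continuous_proj.comp_continuousOn (continuous_geo x y)
  obtain ⟨r, hr, hrt⟩ := intermediate_value_Icc zero_le_one hcont
    (show t ∈ Icc _ _ by simp only [geo_zero, geo_one]; constructor <;> linarith)
  refine ⟨r, hr, ?_⟩
  simp only at hrt
  -- Contraction on both halves of the geodesic counts the distance of `geo x y r` from the line
  -- twice; the path from `x` to `y` along the line shows that this excess is at most `2 C`.
  have h1 := h.le_dist x (geo x y r) (by rw [hrt, abs_sub_comm]; exact le_abs.2 (by left; linarith))
  have h2 := h.le_dist (geo x y r) y (by rw [hrt, abs_sub_comm]; exact le_abs.2 (by left; linarith))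
  rw [hrt, dist_left_geo x y hr] at h1
  rw [hrt, dist_geo_right x y hr] at h2
  have h3 := dist_triangle4 x (σ (σ.proj x)) (σ (σ.proj y)) y
  rw [σ.dist_eq, dist_comm (σ _) y, abs_sub_comm, abs_of_nonneg (by linarith)] at h3
  rw [abs_sub_comm, abs_of_nonneg (by linarith)] at h1 h2
  linarith

lemma Contracting.exists_dist_le' {σ : GeodesicLine X} {C : ℝ} (h : σ.Contracting C) {x y : X}
    {t : ℝ} (hx : t + C ≤ σ.proj x) (hy : σ.proj y + C ≤ t) :
    ∃ r ∈ Icc (0 : ℝ) 1, dist (geo x y r) (σ t) ≤ C := by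
  have := h.rev.exists_dist_le (x := x) (y := y) (t := -t)
    (by rw [proj_rev]; linarith) (by rw [proj_rev]; linarith)
  simpa using this

/-- Two geodesics issuing from a common point in almost opposite directions. -/
lemma dist_sq_ge_of_opposite {o p q z y : X} {T S : ℝ} (hT : dist o z = T) (hS : dist o y = S)
    (hT1 : 1 ≤ T) (hS1 : 1 ≤ S) (hp : p = geo o z (1 / T)) (hq : q = geo o y (1 / S))
    (hpq : 1.8 ≤ dist p q) : T ^ 2 + S ^ 2 + T * S ≤ dist z y ^ 2 := by
  have hT0 : 0 < T := by linarith
  have hS0 : 0 < S := by linarith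
  have hT' : 1 / T ∈ Icc (0 : ℝ) 1 := ⟨by positivity, by rw [div_le_one hT0]; exact hT1⟩
  have hS' : 1 / S ∈ Icc (0 : ℝ) 1 := ⟨by positivity, by rw [div_le_one hS0]; exact hS1⟩
  have h1 := geo_cn o z hT' q
  have h2 := geo_cn o y hS' z
  have h3 : dist q o = 1 := by rw [hq, dist_comm, dist_left_geo _ _ hS', hS]; field_simp
  rw [← hp, dist_comm q p, h3, hT, dist_comm q z] at h1
  rw [← hq, hS, dist_comm z o, hT] at h2
  have h4 : (1.8 : ℝ) ^ 2 ≤ dist p q ^ 2 := pow_le_pow_left₀ (by norm_num) hpq 2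
  have h5 := mul_le_mul_of_nonneg_left h2 hT'.1
  have e1 : 1 / T * (1 - 1 / T) * T ^ 2 = T - 1 := by field_simp
  have e2 : 1 / T * ((1 - 1 / S) * T ^ 2 + 1 / S * dist z y ^ 2 - 1 / S * (1 - 1 / S) * S ^ 2) =
      T - T / S + dist z y ^ 2 / (T * S) - S / T + 1 / T := by field_simp; ring
  rw [e2] at h5
  -- Here `1.24 = 1.8² - 2`; only `1` is kept in the conclusion.
  have h6 : (1.24 : ℝ) ≤ dist z y ^ 2 / (T * S) - T / S - S / T := by
    have : (1 - 1 / T) * (1 : ℝ) ^ 2 = 1 - 1 / T := by ring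
    rw [this, e1] at h1
    norm_num at h4
    linarith
  have e3 : dist z y ^ 2 / (T * S) - T / S - S / T = (dist z y ^ 2 - T ^ 2 - S ^ 2) / (T * S) := by
    field_simp
  rw [e3, le_div_iff₀ (by positivity)] at h6
  nlinarith [mul_pos hT0 hS0]

/-- If moving from `σ v` to `σ w` brings one closer to `z` by almost the full unit, then the
geodesic to `z` starts almost along `σ`. The constants match: `2 - 2 · 0.995 = 0.1²`. -/
lemma dist_geo_le_of_slope (σ : GeodesicLine X) {v : ℝ} {z : X} (h1 : 1 ≤ dist z (σ v)) {w : ℝ}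
    (hw : |v - w| = 1) (h : dist z (σ w) + 0.995 ≤ dist z (σ v)) :
    dist (geo (σ v) z (1 / dist z (σ v))) (σ w) ≤ 0.1 := by
  set T := dist z (σ v) with hT
  have hT0 : 0 < T := by linarith
  have hT' : 1 / T ∈ Icc (0 : ℝ) 1 := ⟨by positivity, by rw [div_le_one hT0]; exact h1⟩
  have h2 := geo_cn (σ v) z hT' (σ w)
  rw [σ.dist_eq, abs_sub_comm, hw, dist_comm (σ w) z, dist_comm (σ v) z, ← hT, dist_comm] at h2
  have h3 : dist z (σ w) ^ 2 ≤ (T - 0.995) ^ 2 := pow_le_pow_left₀ dist_nonneg (by linarith) 2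
  have h4 := mul_le_mul_of_nonneg_left h3 hT'.1
  have e1 : 1 / T * (1 - 1 / T) * T ^ 2 = T - 1 := by field_simp
  have e2 : 1 / T * (T - 0.995) ^ 2 = T - 1.99 + 0.990025 / T := by field_simp; ring
  have h5 : (0.990025 : ℝ) / T ≤ 1 / T := by gcongr; norm_num
  refine abs_le_of_sq_le_sq' ?_ (by norm_num) |>.2
  rw [e1] at h2
  rw [e2] at h4
  norm_num at h2 h4 h5 ⊢
  linarith

/-- A line along which the distances from remote points grow at speed almost one is contracting. -/
lemma contracting_of_slope (σ : GeodesicLine X) {M : ℝ} (hM : 0 ≤ M)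
    (h : ∀ (x : X) (u : ℝ), σ.proj x ≤ u - M → dist x (σ u) + 0.995 ≤ dist x (σ (u + 1)))
    (h' : ∀ (x : X) (u : ℝ), u + M ≤ σ.proj x → dist x (σ u) + 0.995 ≤ dist x (σ (u - 1))) :
    σ.Contracting (8 * (M + 1)) := by
  -- Seen from `σ v`, the points `z` and `y` lie in almost opposite directions: the points at
  -- distance one towards them are within `0.1` of `σ (v - 1)` and `σ (v + 1)`, hence `1.8` apart.
  have hangle : ∀ (z y : X) (v : ℝ), σ.proj z ≤ v - (M + 1) → v + (M + 1) ≤ σ.proj y →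
      dist z (σ v) ^ 2 + dist y (σ v) ^ 2 + dist z (σ v) * dist y (σ v) ≤ dist z y ^ 2 := by
    intro z y v hz hy
    have hz1 : 1 ≤ dist z (σ v) := by
      have := (le_abs_self _).trans (σ.abs_sub_proj_le z v); linarith
    have hy1 : 1 ≤ dist y (σ v) := by
      have := (neg_le_abs _).trans (σ.abs_sub_proj_le y v); linarith
    have hz2 := h z (v - 1) (by linarith)
    rw [sub_add_cancel] at hz2
    have hy2 := h' y (v + 1) (by linarith)
    rw [add_sub_cancel_right] at hy2
    have hp := σ.dist_geo_le_of_slope hz1 (w := v - 1) (by simp) hz2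
    have hq := σ.dist_geo_le_of_slope hy1 (w := v + 1) (by simp) hy2
    refine dist_sq_ge_of_opposite (dist_comm _ _) (dist_comm _ _) hz1 hy1 rfl rfl ?_
    have h4 := dist_triangle4 (σ (v - 1)) (geo (σ v) z (1 / dist z (σ v)))
      (geo (σ v) y (1 / dist y (σ v))) (σ (v + 1))
    rw [dist_comm (σ (v - 1)) (geo _ _ _), σ.dist_eq, show v - 1 - (v + 1) = -2 by ring, abs_neg, abs_of_pos two_pos] at h4
    norm_num at hp hq h4 ⊢
    linarith
  -- If the geodesic from `x` to `y` were far from `σ` at `z`, the path through `σ v₂` and `σ v₁`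
  -- would be shorter: by `hangle` each of the two halves of the geodesic exceeds its outer piece of
  -- that path by half the distance from `z` to the corresponding point of `σ`.
  have hbottle : ∀ (x y : X) (r : ℝ), r ∈ Icc (0 : ℝ) 1 →
      σ.proj x + 2 * (M + 1) ≤ σ.proj (geo x y r) → σ.proj (geo x y r) + 2 * (M + 1) ≤ σ.proj y →
      dist (geo x y r) (σ (σ.proj (geo x y r))) ≤ 2 * (M + 1) := by
    intro x y r hr hx hy
    set z := geo x y r with hz
    have h1 := hangle z y (σ.proj z + (M + 1)) (by linarith) (by linarith)
    have h2 := hangle x z (σ.proj z - (M + 1)) (by linarith) (by linarith)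
    have h3 := σ.dist_proj_le z (σ.proj z + (M + 1))
    have h4 := σ.dist_proj_le z (σ.proj z - (M + 1))
    set v₁ := σ.proj z + (M + 1) with hv₁
    set v₂ := σ.proj z - (M + 1) with hv₂
    have h5 : dist y (σ v₁) + dist z (σ v₁) / 2 ≤ dist z y :=
      abs_le_of_sq_le_sq' (by nlinarith [sq_nonneg (dist z (σ v₁))]) dist_nonneg |>.2
    have h6 : dist x (σ v₂) + dist z (σ v₂) / 2 ≤ dist x z :=
      abs_le_of_sq_le_sq' (by nlinarith [sq_nonneg (dist z (σ v₂))]) dist_nonneg |>.2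
    have h7 := dist_triangle4 x (σ v₂) (σ v₁) y
    rw [σ.dist_eq, show v₂ - v₁ = -(2 * (M + 1)) by rw [hv₁, hv₂]; ring, abs_neg,
      abs_of_nonneg (by linarith), dist_comm (σ _) y] at h7
    have h8 : dist x z + dist z y = dist x y := by
      rw [hz, dist_left_geo x y hr, dist_geo_right x y hr]; ring
    linarith
  -- Passing to `z` and `w`, where the geodesic is close to `σ`, costs `2 (M + 1)` at either end and
  -- `4 (M + 1)` of projection length, in total `8 (M + 1)`.
  have hmain : ∀ x y, σ.proj x + 8 * (M + 1) ≤ σ.proj y →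
      dist x (σ (σ.proj x)) + (σ.proj y - σ.proj x) + dist y (σ (σ.proj y)) ≤
        dist x y + 8 * (M + 1) := by
    intro x y hxy
    have hz : ∀ t ∈ Icc (σ.proj x + 2 * (M + 1)) (σ.proj y - 2 * (M + 1)), ∃ r ∈ Icc (0 : ℝ) 1,
        σ.proj (geo x y r) = t ∧ dist (geo x y r) (σ t) ≤ 2 * (M + 1) := by
      intro t ht
      have hcont : ContinuousOn (fun r => σ.proj (geo x y r)) (Icc 0 1) :=
        σ.continuous_proj.comp_continuousOn (continuous_geo x y)
      obtain ⟨r, hr, hrt⟩ := intermediate_value_Icc zero_le_one hcont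
        (show t ∈ Icc _ _ by
          simp only [geo_zero, geo_one]; constructor <;> linarith [ht.1, ht.2])
      simp only at hrt
      refine ⟨r, hr, hrt, ?_⟩
      have := hbottle x y r hr (by rw [hrt]; exact ht.1) (by rw [hrt]; linarith [ht.2])
      rwa [hrt] at this
    obtain ⟨r, hr, hrt, hrd⟩ := hz (σ.proj x + 2 * (M + 1)) ⟨le_rfl, by linarith⟩
    set z := geo x y r with hzd
    have h8 : dist x z + dist z y = dist x y := by
      rw [hzd, dist_left_geo x y hr, dist_geo_right x y hr]; ring
    -- The second point is sought on the geodesic from `z` to `y`, so it comes after `z` on the way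
    -- to `y`.
    have hcont : ContinuousOn (fun r => σ.proj (geo z y r)) (Icc 0 1) :=
      σ.continuous_proj.comp_continuousOn (continuous_geo z y)
    obtain ⟨q, hq, hqt⟩ := intermediate_value_Icc zero_le_one hcont
      (show σ.proj y - 2 * (M + 1) ∈ Icc _ _ by
        simp only [geo_zero, geo_one]; constructor <;> linarith)
    simp only at hqt
    have hw := hbottle z y q hq (by rw [hqt]; linarith) (by rw [hqt]; linarith)
    rw [hqt] at hw
    set w := geo z y q with hwd
    have h9 : dist z w + dist w y = dist z y := by
      rw [hwd, dist_left_geo z y hq, dist_geo_right z y hq]; ring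
    have h10 := σ.abs_proj_sub_proj_le w z
    rw [hqt, hrt, dist_comm] at h10
    have h11 := (le_abs_self _).trans h10
    have h12 := dist_triangle x z (σ (σ.proj x + 2 * (M + 1)))
    have h13 := dist_triangle_left y (σ (σ.proj y - 2 * (M + 1))) w
    have h14 := σ.dist_proj_le x (σ.proj x + 2 * (M + 1))
    have h15 := σ.dist_proj_le y (σ.proj y - 2 * (M + 1))
    linarith
  refine ⟨by linarith, fun x y hxy => ?_⟩
  rcases le_total (σ.proj x) (σ.proj y) with hle | hle
  · rw [abs_sub_comm, abs_of_nonneg (by linarith)] at hxy ⊢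
    exact hmain x y (by linarith)
  · rw [abs_of_nonneg (by linarith)] at hxy ⊢
    have := hmain y x (by linarith)
    rw [dist_comm y x] at this
    linarith

/-- An axis of an isometry of a proper space which does not bound a flat half-plane is
contracting. -/
theorem exists_contracting [ProperSpace X] {g : X ≃ᵢ X} {σ : GeodesicLine X} (hg : IsAxis g σ)
    (hσ : ¬ σ.BoundsFlatHalfPlane) : ∃ C, σ.Contracting C := by
  obtain ⟨l, hl, hg⟩ := hg
  obtain ⟨M₁, hM₁, h₁⟩ := exists_slope_bound hl hg hσ (c := 0.995) (by norm_num)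
  obtain ⟨M₂, hM₂, h₂⟩ := exists_slope_bound hl (inv_apply_rev hg) (fun h => hσ h.of_rev)
    (c := 0.995) (by norm_num)
  refine ⟨_, σ.contracting_of_slope (M := max M₁ M₂) (hM₁.trans (le_max_left _ _))
    (fun x u hu => h₁ x u (hu.trans (by linarith [le_max_left M₁ M₂]))) fun x u hu => ?_⟩
  have := h₂ x (-u) (by rw [proj_rev]; linarith [le_max_right M₁ M₂])
  rwa [rev_apply, rev_apply, neg_neg, show -(-u + 1) = u - 1 by ring] at this

end GeodesicLine

/-! ### Geodesic rays and the cone topology -/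

section Boundary
variable {X : Type*} [MetricSpace X]

lemma GeodesicRay.dist_eq (ρ : GeodesicRay X) (s t : ℝ≥0) : dist (ρ s) (ρ t) = |(s : ℝ) - t| := by
  rw [ρ.isometry.dist_eq, NNReal.dist_eq]

lemma GeodesicRay.dist_zero (ρ : GeodesicRay X) (t : ℝ≥0) : dist (ρ 0) (ρ t) = t := by
  rw [ρ.dist_eq, NNReal.coe_zero, zero_sub, abs_neg, abs_of_nonneg t.coe_nonneg]

lemma GeodesicRay.endpoint_eq_iff {ρ ρ' : GeodesicRay X} :
    ρ.endpoint = ρ'.endpoint ↔ ∃ C : ℝ, ∀ t, dist (ρ t) (ρ' t) ≤ C :=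
  Quotient.eq (r := asymptoticSetoid X)

lemma GeometricBoundary.exists_rep (ξ : GeometricBoundary X) : ∃ ρ : GeodesicRay X,
    ρ.endpoint = ξ :=
  Quotient.exists_rep ξ

lemma isOpen_coneNhd (c : GeodesicRay X) {R : ℝ≥0} {ε : ℝ} (hR : 0 < R) (hε : 0 < ε) :
    IsOpen (coneNhd c R ε) :=
  TopologicalSpace.isOpen_generateFrom_of_mem (Or.inr ⟨c, R, ε, hR, hε, rfl⟩)

lemma tendsto_bdry_iff {α : Type*} {l : Filter α} {f : α → GeometricCompletion X}
    {ξ : GeometricBoundary X} : Tendsto f l (𝓝 (.bdry ξ)) ↔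
      ∀ (c : GeodesicRay X) (R : ℝ≥0) (ε : ℝ), 0 < R → 0 < ε → .bdry ξ ∈ coneNhd c R ε →
        ∀ᶠ n in l, f n ∈ coneNhd c R ε := by
  constructor
  · intro h c R ε hR hε hξ
    exact h.eventually ((isOpen_coneNhd c hR hε).mem_nhds hξ)
  · intro h
    refine TopologicalSpace.tendsto_nhds_generateFrom_iff.2 ?_
    rintro s (⟨V, -, rfl⟩ | ⟨c, R, ε, hR, hε, rfl⟩) hs
    · obtain ⟨x, -, hx⟩ := hs
      cases hx
    · exact h c R ε hR hε hs

lemma tendsto_boundary_iff {α : Type*} {l : Filter α} {f : α → GeometricBoundary X}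
    {ξ : GeometricBoundary X} : Tendsto f l (𝓝 ξ) ↔
      ∀ (c : GeodesicRay X) (R : ℝ≥0) (ε : ℝ), 0 < R → 0 < ε → .bdry ξ ∈ coneNhd c R ε →
        ∀ᶠ n in l, GeometricCompletion.bdry (f n) ∈ coneNhd c R ε := by
  rw [nhds_induced, tendsto_comap_iff, tendsto_bdry_iff]
  rfl

variable [CNSpace X]

lemma GeodesicRay.apply_mul (ρ : GeodesicRay X) {r : ℝ≥0} (hr : r ≤ 1) (s : ℝ≥0) :
    ρ (r * s) = geo (ρ 0) (ρ s) r := by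
  have hr1 : (r : ℝ) ≤ 1 := by exact_mod_cast hr
  refine eq_geo ⟨r.2, hr1⟩ ?_ ?_
  · rw [ρ.dist_zero, ρ.dist_zero, NNReal.coe_mul]
  · rw [ρ.dist_eq, ρ.dist_zero, NNReal.coe_mul, abs_sub_comm,
      show (s : ℝ) - r * s = (1 - r) * s by ring,
      abs_of_nonneg (mul_nonneg (sub_nonneg.2 hr1) s.coe_nonneg)]

lemma GeodesicRay.apply_toNNReal_mul (ρ : GeodesicRay X) {r : ℝ} (hr : r ∈ Icc (0 : ℝ) 1)
    (s : ℝ≥0) : ρ (r.toNNReal * s) = geo (ρ 0) (ρ s) r := by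
  rw [ρ.apply_mul (Real.toNNReal_le_one.2 hr.2), Real.coe_toNNReal _ hr.1]

/-- Comparison for geodesics from a common point. It makes asymptotic rays from one point coincide
and turns bounded distance at a late time `T` into small distance at time `R`. -/
lemma GeodesicRay.mul_dist_le {ρ ρ' : GeodesicRay X} (h0 : ρ 0 = ρ' 0) {R T : ℝ≥0} (hRT : R ≤ T) :
    T * dist (ρ R) (ρ' R) ≤ R * dist (ρ T) (ρ' T) := by
  rcases eq_or_lt_of_le (zero_le : 0 ≤ T) with h | h
  · rw [← h, NNReal.coe_zero, zero_mul]
    positivity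
  have h1 : R / T ≤ 1 := (div_le_one h).2 hRT
  have h2 : ρ R = geo (ρ 0) (ρ T) (R / T : ℝ≥0) := by
    rw [← ρ.apply_mul h1, div_mul_cancel₀ _ h.ne']
  have h3 : ρ' R = geo (ρ 0) (ρ' T) (R / T : ℝ≥0) := by
    rw [h0, ← ρ'.apply_mul h1, div_mul_cancel₀ _ h.ne']
  have h4 := dist_geo_geo_left_le (ρ 0) (ρ T) (ρ' T) (t := (R / T : ℝ≥0))
    ⟨(R / T).2, by exact_mod_cast h1⟩
  have h5 : (0 : ℝ) < T := by exact_mod_cast h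
  rw [← h2, ← h3, NNReal.coe_div, div_mul_eq_mul_div, le_div_iff₀ h5] at h4
  linarith

lemma GeodesicRay.eq_of_endpoint_eq {ρ ρ' : GeodesicRay X} (h0 : ρ 0 = ρ' 0)
    (h : ρ.endpoint = ρ'.endpoint) (R : ℝ≥0) : ρ R = ρ' R := by
  obtain ⟨C, hC⟩ := endpoint_eq_iff.1 h
  by_contra hne
  have hd := dist_pos.2 hne
  obtain ⟨n, hn⟩ := exists_nat_gt (R * C / dist (ρ R) (ρ' R))
  rw [div_lt_iff₀ hd] at hn
  have h1 := mul_dist_le h0 (le_max_left R n)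
  have h2 := mul_le_mul_of_nonneg_left (hC (max R n)) R.coe_nonneg
  have h3 : (n : ℝ) ≤ (max R n : ℝ≥0) := by exact_mod_cast le_max_right R n
  have h4 := mul_le_mul_of_nonneg_right h3 hd.le
  have h5 : (R : ℝ) * dist (ρ (max R n)) (ρ' (max R n)) ≤ R * C := h2
  linarith

variable [ProperSpace X]

/-- Each boundary point is represented by a ray issuing from a given point. -/
lemma GeodesicRay.exists_asymptotic (ρ : GeodesicRay X) (p : X) :
    ∃ ν : GeodesicRay X, ν 0 = p ∧ ν.endpoint = ρ.endpoint := by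
  have hev : ∀ t : ℝ≥0, ∀ᶠ n : ℕ in atTop, 0 < dist p (ρ n) ∧ (t : ℝ) ≤ dist p (ρ n) ∧
      (t : ℝ) ≤ n ∧ 0 < n := by
    intro t
    obtain ⟨N, hN⟩ := exists_nat_gt (dist p (ρ 0) + t)
    filter_upwards [eventually_ge_atTop N] with n hn
    have h1 := dist_triangle_left (ρ 0) (ρ n) p
    have h2 : (N : ℝ) ≤ n := by exact_mod_cast hn
    rw [ρ.dist_zero, NNReal.coe_natCast] at h1
    have h3 := t.coe_nonneg
    have h4 : (0 : ℝ) ≤ dist p (ρ 0) := dist_nonneg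
    refine ⟨by linarith, by linarith, by linarith, ?_⟩
    have h5 : (0 : ℝ) < n := by linarith
    exact_mod_cast h5
  have hpar : ∀ (t : ℝ≥0) (n : ℕ), 0 < dist p (ρ n) → (t : ℝ) ≤ dist p (ρ n) →
      (t : ℝ) / dist p (ρ n) ∈ Icc (0 : ℝ) 1 := fun t n h0 h =>
    ⟨div_nonneg t.coe_nonneg h0.le, (div_le_one h0).2 h⟩
  -- The ray is the limit of the geodesics from `p` to `ρ n`.
  set q : ℝ≥0 → ℕ → X := fun t n => geo p (ρ n) (t / dist p (ρ n)) with hq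
  have hlim : ∀ t : ℝ≥0, ∃ x, Tendsto (q t) (hyperfilter ℕ) (𝓝 x) := by
    intro t
    refine exists_ultralimit _ p t (eventually_hyperfilter ?_)
    filter_upwards [hev t] with n ⟨h0, h, _⟩
    rw [hq, dist_comm, dist_left_geo _ _ (hpar t n h0 h), div_mul_cancel₀ _ h0.ne']
  choose ν hν using hlim
  have hiso : Isometry ν := by
    refine Isometry.of_dist_eq fun s t => ?_
    refine tendsto_nhds_unique ((hν s).dist (hν t)) (tendsto_const_nhds.congr' ?_)
    refine eventually_hyperfilter ?_
    filter_upwards [hev s, hev t] with n ⟨h0, hs, _⟩ ⟨_, ht, _⟩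
    rw [hq]
    simp only
    rw [dist_geo_geo _ _ (hpar s n h0 hs) (hpar t n h0 ht), ← sub_div, abs_div, abs_of_pos h0,
      div_mul_cancel₀ _ h0.ne', NNReal.dist_eq]
  refine ⟨⟨ν, hiso⟩, ?_, ?_⟩
  · refine tendsto_nhds_unique (hν 0) ?_
    simp only [hq, NNReal.coe_zero, zero_div, geo_zero]
    exact tendsto_const_nhds
  · refine endpoint_eq_iff.2 ⟨2 * dist p (ρ 0), fun t => ?_⟩
    refine le_of_tendsto ((hν t).dist tendsto_const_nhds) (eventually_hyperfilter ?_)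
    filter_upwards [hev t] with n ⟨h0, h, hn, hn0⟩
    have hr := hpar t n h0 h
    set r : ℝ := t / dist p (ρ n) with hrd
    have h1 := dist_geo_geo_right_le p (ρ 0) (ρ n) hr
    have h2 : geo (ρ 0) (ρ n) r = ρ (r.toNNReal * n) :=
      (ρ.apply_toNNReal_mul hr n).symm
    have h3 : dist (ρ (r.toNNReal * n)) (ρ t) ≤ r * dist p (ρ 0) := by
      rw [ρ.dist_eq]
      have h4 : r * dist p (ρ n) = t := div_mul_cancel₀ _ h0.ne'
      have h5 : ((r.toNNReal * n : ℝ≥0) : ℝ) - t = r * (n - dist p (ρ n)) := by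
        rw [mul_sub, h4, NNReal.coe_mul, NNReal.coe_natCast, Real.coe_toNNReal _ hr.1]
      rw [h5, abs_mul, abs_of_nonneg hr.1]
      refine mul_le_mul_of_nonneg_left ?_ hr.1
      have h5 := abs_dist_sub_le (ρ 0) p (ρ n)
      rwa [ρ.dist_zero, NNReal.coe_natCast, dist_comm (ρ 0)] at h5
    rw [← h2] at h3
    have h6 := dist_triangle (geo p (ρ n) r) (geo (ρ 0) (ρ n) r) (ρ t)
    have h7 : (1 - r) * dist p (ρ 0) ≤ dist p (ρ 0) := by
      nlinarith [hr.1, dist_nonneg (x := p) (y := ρ 0)]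
    have h8 : r * dist p (ρ 0) ≤ dist p (ρ 0) := by
      nlinarith [hr.2, dist_nonneg (x := p) (y := ρ 0)]
    change dist (geo p (ρ n) r) (ρ t) ≤ _
    linarith

/-- Represent both points by rays from one origin and take a time `T` at which these are more than
`2` apart: the cone neighbourhoods of radius `1` at `T` are disjoint, since a boundary point has
only one ray from that origin. -/
instance : T2Space (GeometricBoundary X) := by
  refine ⟨fun ξ η hne => ?_⟩
  obtain ⟨ρ, rfl⟩ := ξ.exists_rep
  obtain ⟨ρ', rfl⟩ := η.exists_rep
  obtain ⟨ν, hν0, hν⟩ := ρ'.exists_asymptotic (ρ 0)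
  rw [← hν] at hne ⊢
  obtain ⟨T, hT⟩ : ∃ T, 2 < dist (ρ T) (ν T) := by
    by_contra! h
    exact hne (GeodesicRay.endpoint_eq_iff.2 ⟨2, h⟩)
  have hT0 : 0 < T := by
    rcases eq_or_lt_of_le (zero_le : 0 ≤ T) with h | h
    · rw [← h, hν0, dist_self] at hT
      norm_num at hT
    · exact h
  have ho : ∀ c : GeodesicRay X, IsOpen (GeometricCompletion.bdry ⁻¹' coneNhd c T 1) := fun c =>
    (isOpen_coneNhd c hT0 one_pos).preimage continuous_induced_dom
  refine ⟨_, _, ho ρ, ho ν, ⟨ρ, rfl, rfl, by simp⟩, ⟨ν, rfl, rfl, by simp⟩, ?_⟩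
  rw [Set.disjoint_left]
  rintro ζ ⟨c, hc0, hc, hcT⟩ ⟨c', hc'0, hc', hc'T⟩
  have h1 := GeodesicRay.eq_of_endpoint_eq (hc0.trans (hν0.symm.trans hc'0.symm))
    (hc.trans hc'.symm) T
  rw [← h1] at hc'T
  have h2 := dist_triangle_left (ρ T) (ν T) (c T)
  linarith

/-- If, for some `T` sufficiently large, geodesics from `ρ 0` to remote points of a ray `ν` pass
at bounded distance from `ρ T`, then the end point of `ν` lies in a given neighbourhood of the end
point of `ρ`. -/
lemma GeodesicRay.exists_mem_coneNhd (ρ : GeodesicRay X) {c : GeodesicRay X} {R : ℝ≥0} {ε : ℝ}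
    (h : .bdry ρ.endpoint ∈ coneNhd c R ε) (D : ℝ) : ∃ T₀ : ℝ≥0, ∀ T ≥ T₀, ∀ ν : GeodesicRay X,
      (∃ᶠ s in atTop, ∃ r ∈ Icc (0 : ℝ) 1, dist (geo (ρ 0) (ν s) r) (ρ T) ≤ D) →
      .bdry ν.endpoint ∈ coneNhd c R ε := by
  obtain ⟨c', hc'0, hc', hc'R⟩ := h
  obtain ⟨D₀, hD₀⟩ := endpoint_eq_iff.1 hc'
  set D₁ := D + dist (c 0) (ρ 0) + 1 + D₀ with hD₁
  set δ := ε - dist (c' R) (c R) with hδ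
  have hδ0 : 0 < δ := sub_pos.2 hc'R
  -- For `T ≥ n`, a distance of `2 D₁` at time `T` is less than `δ` at time `R`.
  obtain ⟨n, hn⟩ := exists_nat_gt (R * (2 * D₁) / δ)
  rw [div_lt_iff₀ hδ0] at hn
  refine ⟨max R n + 1, fun T hT ν hν => ?_⟩
  have hRT : R ≤ T := (le_max_left R n).trans (le_self_add.trans hT)
  have hT0 : 0 < T := (by positivity : 0 < max R n + 1).trans_le hT
  have hnT : (n : ℝ) ≤ T := by exact_mod_cast (le_max_right R n).trans (le_self_add.trans hT)
  obtain ⟨ν', hν'0, hν'⟩ := ν.exists_asymptotic (c 0)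
  obtain ⟨E, hE⟩ := endpoint_eq_iff.1 hν'
  have hE0 : 0 ≤ E := dist_nonneg.trans (hE 0)
  -- With `ν s` this far away the ratio satisfies `r E ≤ 1`, so replacing `ν s` by `ν' s` moves the
  -- point at ratio `r` by at most `1`, whatever `E` is.
  obtain ⟨m, hm⟩ := exists_nat_gt (dist (ρ 0) (ν 0) + (T + D) * E)
  obtain ⟨s, ⟨r, hr, hs⟩, hms⟩ := (hν.and_eventually (eventually_ge_atTop (m + 1 : ℝ≥0))).exists
  have hms' : (m : ℝ) + 1 ≤ s := by exact_mod_cast hms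
  have hD : 0 ≤ D := dist_nonneg.trans hs
  have hTD : 0 ≤ (T + D) * E := by positivity
  have hd : (T + D) * E + 1 ≤ dist (ρ 0) (ν s) := by
    have h1 := dist_triangle_left (ν 0) (ν s) (ρ 0)
    rw [ν.dist_zero] at h1
    linarith
  have hrE : r * E ≤ 1 := by
    have h1 : r * dist (ρ 0) (ν s) ≤ T + D := by
      rw [← dist_left_geo _ _ hr]
      have := dist_triangle_right (ρ 0) (geo (ρ 0) (ν s) r) (ρ T)
      rw [ρ.dist_zero] at this
      linarith
    have h2 := mul_le_mul_of_nonneg_right h1 hE0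
    by_contra! h3
    nlinarith
  have hνr : ν' (r.toNNReal * s) = geo (c 0) (ν' s) r := by
    rw [← hν'0]
    exact ν'.apply_toNNReal_mul hr s
  have hclose : dist (ν' (r.toNNReal * s)) (c' T) ≤ D₁ := by
    rw [hνr]
    have h1 := dist_geo_geo_left_le (c 0) (ν' s) (ν s) hr
    have h2 := dist_geo_geo_right_le (c 0) (ρ 0) (ν s) hr
    have h3 := mul_le_mul_of_nonneg_left (hE s) hr.1
    have h4 : (1 - r) * dist (c 0) (ρ 0) ≤ dist (c 0) (ρ 0) := by
      nlinarith [hr.1, dist_nonneg (x := c 0) (y := ρ 0)]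
    have h5 := dist_triangle4 (geo (c 0) (ν' s) r) (geo (c 0) (ν s) r) (geo (ρ 0) (ν s) r) (ρ T)
    have h6 := dist_triangle_right (geo (c 0) (ν' s) r) (c' T) (ρ T)
    have h7 := hD₀ T
    linarith
  -- A point of `ν'` within `D₁` of `c' T` has a parameter within `D₁` of `T`, as both rays start at
  -- `c 0`.
  have hclose' : dist (ν' T) (c' T) ≤ 2 * D₁ := by
    have h1 : dist (ν' T) (ν' (r.toNNReal * s)) ≤ D₁ := by
      rw [ν'.dist_eq]
      have h2 := abs_dist_sub_le (ν' (r.toNNReal * s)) (c' T) (c 0)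
      rw [dist_comm _ (c 0), dist_comm _ (c 0)] at h2
      conv_lhs at h2 => rw [← hν'0, ν'.dist_zero, hν'0, ← hc'0, c'.dist_zero]
      rw [abs_sub_comm]
      exact h2.trans hclose
    have := dist_triangle (ν' T) (ν' (r.toNNReal * s)) (c' T)
    linarith
  refine ⟨ν', hν'0, hν', ?_⟩
  have h1 := mul_dist_le (hν'0.trans hc'0.symm) hRT
  have h2 := mul_le_mul_of_nonneg_left hclose' R.coe_nonneg
  have hT0' : (0 : ℝ) < T := by exact_mod_cast hT0
  have h3 : (T : ℝ) * dist (ν' R) (c' R) < T * δ := by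
    have h4 := mul_le_mul_of_nonneg_right hnT hδ0.le
    have h5 : (R : ℝ) * dist (ν' T) (c' T) ≤ R * (2 * D₁) := h2
    linarith
  have h4 := lt_of_mul_lt_mul_left h3 hT0'.le
  have h5 := dist_triangle (ν' R) (c' R) (c R)
  linarith

lemma GeodesicRay.tendsto_endpoint {α : Type*} {l : Filter α} (ρ : GeodesicRay X)
    {ν : α → GeodesicRay X} {T : α → ℝ≥0} (hT : Tendsto T l atTop) (D : ℝ)
    (h : ∀ᶠ n in l, ∃ᶠ s in atTop, ∃ r ∈ Icc (0 : ℝ) 1,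
      dist (geo (ρ 0) (ν n s) r) (ρ (T n)) ≤ D) :
    Tendsto (fun n => (ν n).endpoint) l (𝓝 ρ.endpoint) := by
  refine tendsto_boundary_iff.2 fun c R ε hR hε hξ => ?_
  obtain ⟨T₀, hT₀⟩ := ρ.exists_mem_coneNhd hξ D
  filter_upwards [h, hT.eventually_ge_atTop T₀] with n hn hTn
  exact hT₀ _ hTn _ hn

end Boundary

/-! ### Pairs of contracting lines without common end points -/

namespace GeodesicLine
variable {X : Type*} [MetricSpace X]

lemma Contracting.mono {σ : GeodesicLine X} {C C' : ℝ} (h : σ.Contracting C) (hC : C ≤ C') :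
    σ.Contracting C' :=
  ⟨h.nonneg.trans hC, fun x y hxy => (h.le_dist x y (hC.trans hxy)).trans (by linarith)⟩

/-- The two lines have no common end points. -/
structure DisjointEnds (α β : GeodesicLine X) : Prop where
  pos_pos : α.posRay.endpoint ≠ β.posRay.endpoint
  pos_neg : α.posRay.endpoint ≠ β.negRay.endpoint
  neg_pos : α.negRay.endpoint ≠ β.posRay.endpoint
  neg_neg : α.negRay.endpoint ≠ β.negRay.endpoint

lemma DisjointEnds.symm {α β : GeodesicLine X} (h : α.DisjointEnds β) : β.DisjointEnds α :=
  ⟨h.pos_pos.symm, h.neg_pos.symm, h.pos_neg.symm, h.neg_neg.symm⟩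

variable [CNSpace X]

/-- The projection of a ray to a contracting line is bounded from above, unless the ray is
asymptotic to the line. -/
lemma Contracting.exists_proj_ray_le {σ : GeodesicLine X} {C : ℝ} (h : σ.Contracting C)
    {ρ : GeodesicRay X} (hne : ρ.endpoint ≠ σ.posRay.endpoint) :
    ∃ B, ∀ s, σ.proj (ρ s) ≤ B := by
  by_contra! hcon
  apply hne
  set d := dist (ρ 0) (σ 0) with hd
  have hC := h.nonneg
  refine GeodesicRay.endpoint_eq_iff.2 ⟨2 * C + d + 2 * |σ.proj (ρ 0) + C|, fun t => ?_⟩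
  change dist (ρ t) (σ t) ≤ _
  have hd0 : 0 ≤ d := dist_nonneg
  have hσ : dist (σ 0) (σ t) = t := by
    rw [σ.dist_eq, zero_sub, abs_neg, abs_of_nonneg t.coe_nonneg]
  rcases le_total (σ.proj (ρ 0) + C) t with ht | ht
  -- A point of `ρ` projecting beyond `t + C` forces `ρ` to pass within `C` of `σ t`; the time of
  -- this passage differs from `t` by at most `C + d`.
  · obtain ⟨s, hs⟩ := hcon (t + C)
    obtain ⟨r, hr, hrd⟩ := h.exists_dist_le ht hs.le
    rw [← ρ.apply_toNNReal_mul hr] at hrd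
    set u := r.toNNReal * s
    have h1 := dist_triangle (ρ t) (ρ u) (σ t)
    have h2 : dist (ρ t) (ρ u) ≤ C + d := by
      rw [ρ.dist_eq, abs_le]
      have h3 := dist_triangle4 (ρ 0) (σ 0) (σ t) (ρ u)
      have h4 := dist_triangle4 (σ 0) (ρ 0) (ρ u) (σ t)
      rw [ρ.dist_zero, hσ, dist_comm (σ t)] at h3
      rw [ρ.dist_zero, hσ, dist_comm (σ 0)] at h4
      constructor <;> linarith
    have h5 := abs_nonneg (σ.proj (ρ 0) + C)
    linarith
  · have h1 := dist_triangle4 (ρ t) (ρ 0) (σ 0) (σ t)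
    rw [dist_comm (ρ t) (ρ 0), ρ.dist_zero, hσ] at h1
    have h2 := le_abs_self (σ.proj (ρ 0) + C)
    linarith

lemma Contracting.exists_proj_line_le {σ β : GeodesicLine X} {C : ℝ} (h : σ.Contracting C)
    (hd : σ.DisjointEnds β) : ∃ B, ∀ s, |σ.proj (β s)| ≤ B := by
  obtain ⟨B₁, h₁⟩ := h.exists_proj_ray_le hd.pos_pos.symm
  obtain ⟨B₂, h₂⟩ := h.exists_proj_ray_le hd.pos_neg.symm
  obtain ⟨B₃, h₃⟩ := h.rev.exists_proj_ray_le (ρ := β.posRay) hd.neg_pos.symm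
  obtain ⟨B₄, h₄⟩ := h.rev.exists_proj_ray_le (ρ := β.negRay) hd.neg_neg.symm
  refine ⟨max (max B₁ B₂) (max B₃ B₄), fun s => ?_⟩
  simp only [proj_rev] at h₃ h₄
  rw [abs_le']
  rcases le_total 0 s with hs | hs
  · have e1 : σ.proj (β s) ≤ B₁ := h₁ ⟨s, hs⟩
    have e2 : -σ.proj (β s) ≤ B₃ := h₃ ⟨s, hs⟩
    exact ⟨e1.trans (by simp), e2.trans (by simp)⟩
  · have e0 : β.negRay ⟨-s, by linarith⟩ = β s := by
      change β (- -s) = β s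
      rw [_root_.neg_neg]
    have e1 := h₂ ⟨-s, by linarith⟩
    have e2 := h₄ ⟨-s, by linarith⟩
    rw [e0] at e1 e2
    exact ⟨e1.trans (by simp), e2.trans (by simp)⟩

/-- Of the projections of a point to two contracting lines without common end points, at most one
is large. -/
lemma exists_proj_bound {α β : GeodesicLine X} {C C' : ℝ} (hα : α.Contracting C)
    (hβ : β.Contracting C') (hd : α.DisjointEnds β) : ∃ K, 0 ≤ K ∧ (∀ s, |α.proj (β s)| ≤ K) ∧
      (∀ s, |β.proj (α s)| ≤ K) ∧ ∀ y, K < |α.proj y| → |β.proj y| ≤ K := by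
  obtain ⟨B, hB⟩ := hα.exists_proj_line_le hd
  obtain ⟨B', hB'⟩ := hβ.exists_proj_line_le hd.symm
  have hB0 := (abs_nonneg _).trans (hB 0)
  have hB'0 := (abs_nonneg _).trans (hB' 0)
  have hC' := hβ.nonneg
  refine ⟨B + B' + 2 * C', by linarith, fun s => (hB s).trans (by linarith),
    fun s => (hB' s).trans (by linarith), fun y hy => ?_⟩
  by_contra! hcon
  -- All points between `y` and its nearest point on `α` have the same large projection to `α`,
  -- whereas `β` projects into `[-B, B]`; so this segment stays away from `β`. A large projection of
  -- `y` to `β` would force it close to `β` by contraction.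
  have key : ∀ t : ℝ, ¬ ∃ r ∈ Icc (0 : ℝ) 1,
      dist (geo y (α (α.proj y)) r) (β t) ≤ C' := by
    rintro t ⟨r, hr, hrd⟩
    have h1 := (α.abs_proj_sub_proj_le (geo y (α (α.proj y)) r) (β t)).trans hrd
    rw [α.proj_geo y hr] at h1
    have h2 := hB t
    have h3 := abs_sub_abs_le_abs_sub (α.proj y) (α.proj (β t))
    linarith
  have hp := abs_le.1 (hB' (α.proj y))
  rcases lt_abs.1 hcon with h | h
  · exact key _ (hβ.exists_dist_le' (t := β.proj (α (α.proj y)) + C') (by linarith) le_rfl)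
  · exact key _ (hβ.exists_dist_le (t := β.proj (α (α.proj y)) - C') (by linarith) (by linarith))

end GeodesicLine

/-! ### Axes from minimal displacement -/

section MinimalDisplacement
variable {X : Type*} [MetricSpace X] [CNSpace X]

/-- The midpoint of `w` and `φ w` is moved by at most half of `d(w, φ² w)`, so `φ²` displaces every
point by at least twice the minimum for `φ`. -/
lemma dist_sq_apply_of_min {φ : X ≃ᵢ X} {z : X} (h : ∀ w, dist z (φ z) ≤ dist w (φ w)) :
    dist z ((φ ^ 2) z) = 2 * dist z (φ z) ∧ ∀ w, dist z ((φ ^ 2) z) ≤ dist w ((φ ^ 2) w) := by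
  have hge : ∀ w, 2 * dist z (φ z) ≤ dist w ((φ ^ 2) w) := by
    intro w
    have hh : (1 / 2 : ℝ) ∈ Icc (0 : ℝ) 1 := by norm_num
    have h1 := h (geo w (φ w) (1 / 2))
    rw [map_geo φ.isometry _ _ hh] at h1
    have h2 := dist_geo_geo_left_le (φ w) w (φ (φ w)) hh
    rw [geo_symm (φ w) w hh, show (1 - 1 / 2 : ℝ) = 1 / 2 by norm_num] at h2
    rw [pow_two, IsometryEquiv.mul_apply]
    linarith
  have hle : dist z ((φ ^ 2) z) ≤ 2 * dist z (φ z) := by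
    have := dist_triangle z (φ z) (φ (φ z))
    rw [φ.isometry.dist_eq] at this
    rw [pow_two, IsometryEquiv.mul_apply]
    linarith
  exact ⟨le_antisymm hle (hge z), fun w => hle.trans (hge w)⟩

/-- Doubling gives the powers `2ᵏ`. Since `n ≤ 2ⁿ`, the triangle inequality through `φⁿ z` allows no
loss at `n`. -/
lemma dist_pow_apply_of_min {φ : X ≃ᵢ X} {z : X} (h : ∀ w, dist z (φ z) ≤ dist w (φ w)) (n : ℕ) :
    dist z ((φ ^ n) z) = n * dist z (φ z) := by
  have hle : ∀ n : ℕ, dist z ((φ ^ n) z) ≤ n * dist z (φ z) := by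
    intro n
    induction n with
    | zero => simp
    | succ n ih =>
      have := dist_triangle z ((φ ^ n) z) ((φ ^ n) (φ z))
      rw [(φ ^ n).isometry.dist_eq] at this
      rw [pow_succ, IsometryEquiv.mul_apply]
      push_cast
      linarith
  have hpow : ∀ k : ℕ, dist z ((φ ^ 2 ^ k) z) = 2 ^ k * dist z (φ z) ∧
      ∀ w, dist z ((φ ^ 2 ^ k) z) ≤ dist w ((φ ^ 2 ^ k) w) := by
    intro k
    induction k with
    | zero => simpa using h
    | succ k ih =>
      obtain ⟨h1, h2⟩ := dist_sq_apply_of_min ih.2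
      rw [← pow_mul, ← pow_succ] at h1 h2
      exact ⟨by rw [h1, ih.1]; ring, h2⟩
  refine le_antisymm (hle n) ?_
  have hn : n ≤ 2 ^ n := Nat.lt_two_pow_self.le
  have h1 := (hpow n).1
  have h2 := dist_triangle z ((φ ^ n) z) ((φ ^ n) ((φ ^ (2 ^ n - n)) z))
  rw [(φ ^ n).isometry.dist_eq, ← IsometryEquiv.mul_apply, ← pow_add, Nat.add_sub_cancel' hn,
    h1] at h2
  have h3 := hle (2 ^ n - n)
  rw [Nat.cast_sub hn] at h3
  push_cast at h3
  linarith

/-- A sequence of equidistant points on a line determines the line. -/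
lemma exists_line_through {p : ℤ → X} {l : ℝ} (hl : 0 < l)
    (hp : ∀ j k, dist (p j) (p k) = |(j : ℝ) - k| * l) :
    ∃ τ : GeodesicLine X, ∀ t, τ t =
      geo (p ⌊t / l⌋) (p (⌊t / l⌋ + 1)) (Int.fract (t / l)) := by
  set τ : ℝ → X := fun t => geo (p ⌊t / l⌋) (p (⌊t / l⌋ + 1)) (Int.fract (t / l)) with hτ
  have hfr : ∀ t : ℝ, Int.fract (t / l) ∈ Icc (0 : ℝ) 1 := fun t =>
    ⟨Int.fract_nonneg _, (Int.fract_lt_one _).le⟩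
  have hstep : ∀ m : ℤ, dist (p m) (p (m + 1)) = l := fun m => by
    rw [hp]; push_cast; rw [sub_add_cancel_left, abs_neg, abs_one, one_mul]
  have hfl : ∀ t : ℝ, (⌊t / l⌋ : ℝ) * l + Int.fract (t / l) * l = t := fun t => by
    rw [← add_mul, Int.floor_add_fract, div_mul_cancel₀ _ hl.ne']
  have hL : ∀ t, dist (p ⌊t / l⌋) (τ t) = t - ⌊t / l⌋ * l := fun t => by
    rw [hτ, dist_left_geo _ _ (hfr t), hstep]; linarith [hfl t]
  have hR : ∀ t, dist (τ t) (p (⌊t / l⌋ + 1)) = (⌊t / l⌋ + 1) * l - t := fun t => by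
    rw [hτ, dist_geo_right _ _ (hfr t), hstep]; linarith [hfl t]
  -- The path through the intermediate points gives the upper bound; the lower one holds because the
  -- outer nodes are exactly as far apart as that path is long.
  have hdist : ∀ s t, s ≤ t → dist (τ s) (τ t) = t - s := by
    intro s t hst
    have hmono : ⌊s / l⌋ ≤ ⌊t / l⌋ := Int.floor_mono (by gcongr)
    rcases eq_or_lt_of_le hmono with h | h
    · have e : τ t = geo (p ⌊s / l⌋) (p (⌊s / l⌋ + 1)) (Int.fract (t / l)) := by rw [hτ, h]
      have e1 := hfl s
      have e2 := hfl t
      rw [← h] at e2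
      rw [e, hτ, dist_geo_geo _ _ (hfr s) (hfr t), hstep, abs_sub_comm, abs_of_nonneg]
      · linarith
      · by_contra! hneg
        nlinarith
    · have h' : ⌊s / l⌋ + 1 ≤ ⌊t / l⌋ := h
      have h'r : (⌊s / l⌋ : ℝ) + 1 ≤ ⌊t / l⌋ := by exact_mod_cast h'
      have d1 : dist (p (⌊s / l⌋ + 1)) (p ⌊t / l⌋) = (⌊t / l⌋ - (⌊s / l⌋ + 1)) * l := by
        rw [hp, abs_sub_comm]; push_cast; rw [abs_of_nonneg (by linarith)]
      have d2 : dist (p ⌊s / l⌋) (p (⌊t / l⌋ + 1)) = (⌊t / l⌋ + 1 - ⌊s / l⌋) * l := by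
        rw [hp, abs_sub_comm]; push_cast; rw [abs_of_nonneg (by linarith)]
      have t1 := dist_triangle4 (τ s) (p (⌊s / l⌋ + 1)) (p ⌊t / l⌋) (τ t)
      have t2 := dist_triangle4 (p ⌊s / l⌋) (τ s) (τ t) (p (⌊t / l⌋ + 1))
      rw [hR, hL, d1] at t1
      rw [hR, hL, d2] at t2
      apply le_antisymm <;> linarith
  refine ⟨⟨τ, Isometry.of_dist_eq fun s t => ?_⟩, fun t => rfl⟩
  rw [Real.dist_eq]
  rcases le_total s t with h | h
  · rw [hdist s t h, abs_sub_comm, abs_of_nonneg (by linarith)]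
  · rw [dist_comm, hdist t s h, abs_of_nonneg (by linarith)]

/-- An isometry whose displacement function attains a positive minimum has an axis. -/
lemma exists_axis_of_min {φ : X ≃ᵢ X} {z : X} (h : ∀ w, dist z (φ z) ≤ dist w (φ w))
    (hpos : 0 < dist z (φ z)) :
    ∃ τ : GeodesicLine X, τ 0 = z ∧ ∀ t, φ (τ t) = τ (t + dist z (φ z)) := by
  set l := dist z (φ z) with hl
  have hp : ∀ j k : ℤ, dist ((φ ^ j) z) ((φ ^ k) z) = |(j : ℝ) - k| * l := by
    have hle : ∀ j k : ℤ, j ≤ k → dist ((φ ^ j) z) ((φ ^ k) z) = |(j : ℝ) - k| * l := by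
      intro j k hjk
      obtain ⟨n, rfl⟩ := Int.le.dest hjk
      rw [zpow_add, IsometryEquiv.mul_apply, (φ ^ j).isometry.dist_eq, zpow_natCast,
        dist_pow_apply_of_min h]
      push_cast
      rw [sub_add_cancel_left, abs_neg, abs_of_nonneg (Nat.cast_nonneg n)]
    intro j k
    rcases le_total j k with hjk | hjk
    · exact hle j k hjk
    · rw [dist_comm, abs_sub_comm, hle k j hjk]
  obtain ⟨τ, hτ⟩ := exists_line_through hpos hp
  refine ⟨τ, by rw [hτ]; simp [geo_zero], fun t => ?_⟩
  have hdiv : (t + l) / l = t / l + 1 := by rw [add_div, div_self hpos.ne']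
  rw [hτ, hτ, hdiv, Int.floor_add_one, Int.fract_add_one,
    map_geo φ.isometry _ _ ⟨Int.fract_nonneg _, (Int.fract_lt_one _).le⟩,
    ← IsometryEquiv.mul_apply, ← IsometryEquiv.mul_apply, ← zpow_one_add, ← zpow_one_add]
  congr 3 <;> ring_nf

end MinimalDisplacement

/-! ### Ping-pong for the product of `A` and the inverse of `B` -/

section PingPong
variable {X : Type*} [MetricSpace X]

/-- Two isometries `A`, `B` with contracting axes `α`, `β` which have bounded projections to each
other, and with large translation lengths `s`, `r`. -/
structure PingPong (α β : GeodesicLine X) (A B : X ≃ᵢ X) (s r K : ℝ) (o : X) : Prop where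
  apply_left : ∀ t, A (α t) = α (t + s)
  apply_right : ∀ t, B (β t) = β (t + r)
  contracting_left : α.Contracting K
  contracting_right : β.Contracting K
  dist_left : dist o (α 0) ≤ K
  dist_right : dist o (β 0) ≤ K
  proj_le : ∀ y, K < |α.proj y| → |β.proj y| ≤ K
  lt_left : 12 * K + 2 < s
  lt_right : 12 * K + 2 < r

namespace PingPong
variable {α β : GeodesicLine X} {A B : X ≃ᵢ X} {s r K : ℝ} {o : X}

/-- The exchange replaces `A * B⁻¹` by its inverse, so each statement about forward powers and `α`
yields one about backward powers and `β`. -/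
lemma symm (h : PingPong α β A B s r K o) : PingPong β α B A r s K o where
  apply_left := h.apply_right
  apply_right := h.apply_left
  contracting_left := h.contracting_right
  contracting_right := h.contracting_left
  dist_left := h.dist_right
  dist_right := h.dist_left
  proj_le y hy := by
    by_contra! hcon
    exact hy.not_ge (h.proj_le y hcon)
  lt_left := h.lt_right
  lt_right := h.lt_left

lemma symm_mul : (B * A⁻¹ : X ≃ᵢ X) = (A * B⁻¹)⁻¹ := by group

lemma nonneg (h : PingPong α β A B s r K o) : 0 ≤ K := h.contracting_left.nonneg

lemma proj_right_le (h : PingPong α β A B s r K o) {y : X} (hy : K < α.proj y) : β.proj y ≤ K :=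
  (le_abs_self _).trans (h.proj_le y (hy.trans_le (le_abs_self _)))

variable [CNSpace X]

lemma abs_proj_base_le (h : PingPong α β A B s r K o) : |α.proj o| ≤ K := by
  have := α.abs_sub_proj_le o 0
  rw [zero_sub, abs_neg] at this
  exact this.trans h.dist_left

lemma proj_left (h : PingPong α β A B s r K o) (y : X) : α.proj (A y) = α.proj y + s := by
  have := proj_zpow h.apply_left 1 y
  rwa [zpow_one, Int.cast_one, one_mul] at this

lemma proj_right_inv (h : PingPong α β A B s r K o) (y : X) : β.proj (B⁻¹ y) = β.proj y - r := by
  have := proj_zpow h.apply_right (-1) y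
  rw [zpow_neg_one, Int.cast_neg, Int.cast_one] at this
  linarith

/-- `B⁻¹` moves the projection to `β` below `-K`, so the projection to `α` is at least `-K`, and
then `A` shifts it by `s`. -/
lemma le_proj_apply (h : PingPong α β A B s r K o) {y : X} (hy : β.proj y ≤ K) :
    s - K ≤ α.proj ((A * B⁻¹) y) := by
  have hK := h.nonneg
  have h0 := h.lt_right
  have h1 := h.symm.proj_le (B⁻¹ y) (by
    rw [h.proj_right_inv]
    exact lt_abs.2 (Or.inr (by linarith)))
  rw [IsometryEquiv.mul_apply, h.proj_left]
  linarith [(abs_le.1 h1).1]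

lemma le_proj_pow_apply (h : PingPong α β A B s r K o) {y : X} (hy : β.proj y ≤ K) (k : ℕ) :
    s - K ≤ α.proj (((A * B⁻¹) ^ (k + 1)) y) := by
  have h0 := h.lt_left
  have hK := h.nonneg
  induction k with
  | zero => rw [zero_add, pow_one]; exact h.le_proj_apply hy
  | succ k ih =>
    rw [pow_succ', IsometryEquiv.mul_apply]
    exact h.le_proj_apply (h.proj_right_le (by linarith))

lemma le_proj_pow_inv_apply (h : PingPong α β A B s r K o) {y : X} (hy : α.proj y ≤ K) (k : ℕ) :
    r - K ≤ β.proj (((A * B⁻¹)⁻¹ ^ (k + 1)) y) := by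
  rw [← symm_mul]
  exact h.symm.le_proj_pow_apply hy k

/-- A geodesic which crosses the line `α` passes close to the base point. -/
lemma dist_add_dist_le (h : PingPong α β A B s r K o) {y y' : X} (hy : 3 * K ≤ α.proj y)
    (hy' : α.proj y' ≤ K) : dist y o + dist o y' ≤ dist y y' + 8 * K := by
  -- The geodesic passes within `K` of `α (2 K)`, hence within `4 K` of `o`; the detour through `o`
  -- costs twice this.
  obtain ⟨u, hu, hd⟩ := h.contracting_left.exists_dist_le' (x := y) (y := y') (t := 2 * K)
    (by linarith) (by linarith)
  have h1 := dist_left_geo y y' hu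
  have h2 := dist_geo_right y y' hu
  have h3 := dist_triangle4 (geo y y' u) (α (2 * K)) (α 0) o
  rw [α.dist_eq, sub_zero, abs_of_nonneg (by linarith [h.nonneg]), dist_comm (α 0) o,
    dist_comm (geo y y' u) o] at h3
  have h4 := h.dist_left
  have h5 := dist_triangle_right y o (geo y y' u)
  have h6 := dist_triangle o (geo y y' u) y'
  linarith

/-- With `φ = A * B⁻¹`, the geodesic from `φ⁻¹ o` to `φᵏ o` crosses `β` near `o`, so each further
power adds at least `d(o, φ⁻¹ o) - 8 K ≥ r - 10 K > 1`. -/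
lemma le_dist_pow (h : PingPong α β A B s r K o) (k : ℕ) : k ≤ dist o (((A * B⁻¹) ^ k) o) := by
  have hK := h.nonneg
  have hr := h.lt_right
  have hs := h.lt_left
  have hbase := abs_le.1 h.abs_proj_base_le
  have hbase' := abs_le.1 h.symm.abs_proj_base_le
  induction k with
  | zero => simp
  | succ k ih =>
    have h1 : β.proj (((A * B⁻¹) ^ k) o) ≤ K := by
      cases k with
      | zero => simpa using hbase'.2
      | succ k =>
        exact h.proj_right_le (by linarith [h.le_proj_pow_apply hbase'.2 k])
    have h2 := h.le_proj_pow_inv_apply hbase.2 0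
    rw [zero_add, pow_one] at h2
    have h3 := h.symm.dist_add_dist_le (y := (A * B⁻¹)⁻¹ o) (by linarith) h1
    have h4 := (le_abs_self _).trans (β.abs_proj_sub_proj_le ((A * B⁻¹)⁻¹ o) o)
    have h5 : dist ((A * B⁻¹)⁻¹ o) (((A * B⁻¹) ^ k) o) = dist o (((A * B⁻¹) ^ (k + 1)) o) := by
      rw [← (A * B⁻¹).isometry.dist_eq, ← IsometryEquiv.mul_apply, ← IsometryEquiv.mul_apply,
        mul_inv_cancel, ← pow_succ']
      rfl
    rw [h5] at h3
    push_cast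
    linarith

/-- If the whole orbit of `z` stayed in the region `K < α.proj`, the geodesics from `φ⁻ⁿ o` to `φ⁻ⁿ
z` would pass near `o`. This bounds `d(o, φⁿ o)` in terms of `d(o, z)`, against `le_dist_pow`. -/
lemma exists_proj_left_le (h : PingPong α β A B s r K o) (z : X) :
    ∃ k : ℤ, α.proj (((A * B⁻¹) ^ k) z) ≤ K := by
  by_contra! hcon
  obtain ⟨n, hn⟩ := exists_nat_gt (dist o z + 8 * K)
  have h1 := h.le_proj_pow_inv_apply (abs_le.1 h.abs_proj_base_le).2 n
  have h2 := h.proj_right_le (hcon (-(n + 1 : ℕ)))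
  rw [zpow_neg, zpow_natCast, ← inv_pow] at h2
  have h3 := h.symm.dist_add_dist_le (y := ((A * B⁻¹)⁻¹ ^ (n + 1)) o)
    (by linarith [h.lt_right, h.nonneg]) h2
  rw [((A * B⁻¹)⁻¹ ^ (n + 1)).isometry.dist_eq] at h3
  have h4 : dist (((A * B⁻¹)⁻¹ ^ (n + 1)) o) o = dist o (((A * B⁻¹) ^ (n + 1)) o) := by
    rw [← ((A * B⁻¹) ^ (n + 1)).isometry.dist_eq, ← IsometryEquiv.mul_apply, inv_pow,
      mul_inv_cancel]
    rfl
  have h5 := h.le_dist_pow (n + 1)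
  have h6 := dist_nonneg (x := o) (y := ((A * B⁻¹)⁻¹ ^ (n + 1)) z)
  push_cast at h5
  linarith

lemma exists_proj_right_le (h : PingPong α β A B s r K o) (z : X) :
    ∃ k : ℤ, β.proj (((A * B⁻¹) ^ k) z) ≤ K := by
  obtain ⟨k, hk⟩ := h.symm.exists_proj_left_le z
  rw [symm_mul, inv_zpow, ← zpow_neg] at hk
  exact ⟨-k, hk⟩

/-- Membership of `w` in a fundamental domain of `A * B⁻¹`. -/
def Central (α β : GeodesicLine X) (A B : X ≃ᵢ X) (K : ℝ) (w : X) : Prop :=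
  (α.proj w ≤ K ∧ β.proj w ≤ K) ∨ (K < β.proj w ∧ K < α.proj ((A * B⁻¹) w))

/-- Without a central point, an orbit point outside the region `K < α.proj` lies in the region `K <
β.proj`, which the orbit then leaves neither forwards nor backwards, contrary to
`exists_proj_right_le`. -/
lemma exists_central (h : PingPong α β A B s r K o) (z : X) :
    ∃ k : ℤ, Central α β A B K (((A * B⁻¹) ^ k) z) := by
  by_contra! hcon
  have hK := h.nonneg
  have hs := h.lt_left
  have hr := h.lt_right
  have hsucc : ∀ k : ℤ, K < β.proj (((A * B⁻¹) ^ k) z) → K < β.proj (((A * B⁻¹) ^ (k + 1)) z) := by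
    intro k hk
    have h1 := hcon k
    have h2 := hcon (k + 1)
    simp only [Central, not_or, not_and, not_lt, not_le] at h1 h2
    refine h2.1 ?_
    rw [add_comm, zpow_one_add, IsometryEquiv.mul_apply]
    exact h1.2 hk
  have hpred : ∀ k : ℤ, K < β.proj (((A * B⁻¹) ^ k) z) → K < β.proj (((A * B⁻¹) ^ (k - 1)) z) := by
    intro k hk
    have h1 := h.le_proj_pow_inv_apply (h.symm.proj_right_le hk) 0
    rw [zero_add, pow_one, ← IsometryEquiv.mul_apply, ← zpow_neg_one, ← zpow_add,
      neg_add_eq_sub] at h1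
    linarith
  obtain ⟨i, hi⟩ := h.exists_proj_left_le z
  obtain ⟨j, hj⟩ := h.exists_proj_right_le z
  have h1 := hcon i
  simp only [Central, not_or, not_and, not_lt, not_le] at h1
  have hall : ∀ k : ℤ, K < β.proj (((A * B⁻¹) ^ k) z) := fun k : ℤ =>
    Int.inductionOn' (motive := fun k => K < β.proj (((A * B⁻¹) ^ k) z)) k i (h1.1 hi)
      (fun k _ hk => hsucc k hk) (fun k _ hk => hpred k hk)
  exact (hall j).not_ge hj

/-- The geodesic from a central point `w` to its image passes near `o`. So the displacement controls
the distance to `o` on the fundamental domain, and its minimum is attained. -/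
lemma Central.dist_le (h : PingPong α β A B s r K o) {w : X} (hw : Central α β A B K w) :
    dist w o ≤ dist w ((A * B⁻¹) w) + 8 * K := by
  have hK := h.nonneg
  have hs := h.lt_left
  have hr := h.lt_right
  have key1 : 3 * K ≤ α.proj ((A * B⁻¹) w) → α.proj w ≤ K →
      dist w o ≤ dist w ((A * B⁻¹) w) + 8 * K := fun h1 h2 => by
    have h3 := h.dist_add_dist_le h1 h2
    rw [dist_comm o w, dist_comm _ w] at h3
    linarith [dist_nonneg (x := (A * B⁻¹) w) (y := o)]
  rcases hw with ⟨h1, h2⟩ | ⟨h1, h2⟩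
  · exact key1 (by linarith [h.le_proj_apply h2]) h1
  · have e1 := h.proj_right_inv w
    have e2 := h.proj_left (B⁻¹ w)
    rw [← IsometryEquiv.mul_apply] at e2
    -- According to the position of `B⁻¹ w`, the crossing takes place along `β` or along `α`.
    rcases le_or_gt (|β.proj (B⁻¹ w)|) K with h3 | h3
    · have h4 := h.symm.dist_add_dist_le (y := w) (y' := (A * B⁻¹) w)
        (by linarith [(abs_le.1 h3).1]) (h.proj_right_le h2)
      linarith [dist_nonneg (x := o) (y := (A * B⁻¹) w)]
    · have h4 := h.symm.proj_le _ h3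
      exact key1 (by linarith [(abs_le.1 h4).1]) (h.symm.proj_right_le h1)

lemma Central.le_proj_pow (h : PingPong α β A B s r K o) {w : X} (hw : Central α β A B K w)
    (k : ℕ) : s - K ≤ α.proj (((A * B⁻¹) ^ (k + 2)) w) := by
  rcases hw with ⟨-, h2⟩ | ⟨-, h2⟩
  · exact h.le_proj_pow_apply h2 (k + 1)
  · rw [show k + 2 = (k + 1) + 1 from rfl, pow_succ, IsometryEquiv.mul_apply]
    exact h.le_proj_pow_apply (h.proj_right_le h2) k

lemma Central.le_proj_pow_inv (h : PingPong α β A B s r K o) {w : X} (hw : Central α β A B K w)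
    (k : ℕ) : r - K ≤ β.proj (((A * B⁻¹)⁻¹ ^ (k + 1)) w) := by
  rcases hw with ⟨h1, -⟩ | ⟨h1, -⟩
  · exact h.le_proj_pow_inv_apply h1 k
  · exact h.le_proj_pow_inv_apply (h.symm.proj_right_le h1) k

lemma exists_axis [ProperSpace X] (h : PingPong α β A B s r K o) :
    ∃ (τ : GeodesicLine X) (l : ℝ), 0 < l ∧ (∀ t, (A * B⁻¹) (τ t) = τ (t + l)) ∧
      (∀ k : ℕ, s - K ≤ α.proj (τ ((k + 2 : ℕ) * l))) ∧
      ∀ k : ℕ, r - K ≤ β.proj (τ (-((k + 1 : ℕ) * l))) := by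
  set φ := A * B⁻¹ with hφ
  have hcont : Continuous fun w => dist w (φ w) := continuous_id.dist φ.continuous
  have hK := h.nonneg
  obtain ⟨z₁, -, hz₁⟩ := (isCompact_closedBall o (dist o (φ o) + 8 * K)).exists_isMinOn
    ⟨o, Metric.mem_closedBall_self (by positivity)⟩ hcont.continuousOn
  have hinv : ∀ (k : ℤ) (w : X), dist ((φ ^ k) w) (φ ((φ ^ k) w)) = dist w (φ w) := by
    intro k w
    rw [← IsometryEquiv.mul_apply, ← zpow_one_add, add_comm, zpow_add_one,
      IsometryEquiv.mul_apply, (φ ^ k).isometry.dist_eq]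
  have hmin₁ : ∀ w, dist z₁ (φ z₁) ≤ dist w (φ w) := by
    intro w
    rcases le_or_gt (dist w (φ w)) (dist o (φ o)) with hw | hw
    · obtain ⟨k, hk⟩ := h.exists_central w
      have h1 := hk.dist_le h
      rw [← hφ, hinv] at h1
      have h2 : dist z₁ (φ z₁) ≤ dist ((φ ^ k) w) (φ ((φ ^ k) w)) :=
        hz₁ (Metric.mem_closedBall.2 (h1.trans (by linarith)))
      rwa [hinv] at h2
    · have h2 : dist z₁ (φ z₁) ≤ dist o (φ o) :=
        hz₁ (Metric.mem_closedBall_self (by positivity))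
      linarith
  -- Displacement is constant on orbits, so the minimum may be taken at a central point; the axis
  -- through it then has the required projections.
  obtain ⟨k, hk⟩ := h.exists_central z₁
  rw [← hφ] at hk
  set z := (φ ^ k) z₁ with hz
  have hmin : ∀ w, dist z (φ z) ≤ dist w (φ w) := fun w => by rw [hz, hinv]; exact hmin₁ w
  have hpos : 0 < dist z (φ z) := by
    by_contra! hle
    have hfix : dist z (φ z) = 0 := le_antisymm hle dist_nonneg
    obtain ⟨n, hn⟩ := exists_nat_gt (dist o z + dist z o)
    have h1 := h.le_dist_pow n
    have h2 := dist_triangle4 o z ((φ ^ n) z) ((φ ^ n) o)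
    rw [(φ ^ n).isometry.dist_eq, dist_pow_apply_of_min hmin, hfix] at h2
    rw [← hφ] at h1
    linarith
  obtain ⟨τ, hτ0, hτ⟩ := exists_axis_of_min hmin hpos
  refine ⟨τ, _, hpos, hτ, fun n => ?_, fun n => ?_⟩
  · have h1 := hk.le_proj_pow h n
    have h2 := zpow_apply_axis hτ ((n + 2 : ℕ) : ℤ) 0
    rw [hτ0, zero_add, zpow_natCast, Int.cast_natCast] at h2
    rw [← h2]
    exact h1
  · have h1 := hk.le_proj_pow_inv h n
    have h2 := zpow_apply_axis hτ (-((n + 1 : ℕ) : ℤ)) 0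
    rw [hτ0, zero_add, zpow_neg, zpow_natCast, Int.cast_neg, Int.cast_natCast, neg_mul] at h2
    rw [← h2, ← inv_pow]
    exact h1

/-- A line which crosses the contracting line `α` does not bound a flat half-plane. -/
lemma not_boundsFlatHalfPlane {τ : GeodesicLine X} (hα : α.Contracting K) {u v : ℝ}
    (hu : α.proj (τ u) ≤ K) (hv : 7 * K + 2 ≤ α.proj (τ v)) : ¬ τ.BoundsFlatHalfPlane := by
  rintro ⟨f, hf, hf0⟩
  have hK := hα.nonneg
  -- The parallel line at distance `2 K + 1` also crosses `α`. Both lines then pass within `K` of `α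
  -- (4 K + 1)`, so they come within `2 K` of each other.
  set D : ℝ≥0 := 2 * K.toNNReal + 1 with hD
  have hDK : (D : ℝ) = 2 * K + 1 := by
    rw [hD]; push_cast; rw [Real.coe_toNNReal _ hK]
  let τ' : GeodesicLine X := ⟨f D, Isometry.of_dist_eq fun s t => by
    rw [hf, sub_self, zero_pow two_ne_zero, zero_add, Real.sqrt_sq_eq_abs, Real.dist_eq]⟩
  have hττ' : ∀ s t, (D : ℝ) ≤ dist (τ s) (τ' t) := by
    intro s t
    rw [hf0]
    change _ ≤ dist (f 0 s) (f D t)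
    rw [hf]
    refine Real.le_sqrt_of_sq_le ?_
    rw [NNReal.coe_zero, zero_sub, neg_sq]
    nlinarith [sq_nonneg (s - t)]
  have hττ : ∀ s, dist (τ s) (τ' s) = D := by
    intro s
    rw [hf0]
    change dist (f 0 s) (f D s) = _
    rw [hf, sub_self, NNReal.coe_zero, zero_sub, neg_sq, zero_pow two_ne_zero, add_zero,
      Real.sqrt_sq D.coe_nonneg]
  have h1 := α.abs_proj_sub_proj_le (τ u) (τ' u)
  have h2 := α.abs_proj_sub_proj_le (τ v) (τ' v)
  rw [hττ, hDK] at h1 h2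
  have h1' := abs_le.1 h1
  have h2' := abs_le.1 h2
  obtain ⟨a, ha, had⟩ := hα.exists_dist_le (x := τ u) (y := τ v) (t := 4 * K + 1)
    (by linarith) (by linarith)
  obtain ⟨b, hb, hbd⟩ := hα.exists_dist_le (x := τ' u) (y := τ' v) (t := 4 * K + 1)
    (by linarith) (by linarith)
  rw [← GeodesicLine.eq_geo _ u v ha] at had
  rw [← GeodesicLine.eq_geo _ u v hb] at hbd
  have h3 := hττ' ((1 - a) * u + a * v) ((1 - b) * u + b * v)
  have h4 := dist_triangle_right (τ ((1 - a) * u + a * v)) (τ' ((1 - b) * u + b * v))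
    (α (4 * K + 1))
  linarith

end PingPong

/-! ### Rank one elements with prescribed fixed points -/

lemma pow_apply_axis {g : X ≃ᵢ X} {σ : GeodesicLine X} {l : ℝ} (hg : ∀ t, g (σ t) = σ (t + l))
    (n : ℕ) (t : ℝ) : (g ^ n) (σ t) = σ (t + n * l) := by
  have := zpow_apply_axis hg n t
  rwa [zpow_natCast, Int.cast_natCast] at this

variable [CNSpace X]

/-- This is the hypothesis of `tendsto_endpoint`: the points of `τ` at multiples of `l` project to
`α` beyond `s - K`, so the geodesics to them pass near `α (s - 2 K)`. -/
lemma GeodesicLine.frequently_near {α τ : GeodesicLine X} {K l s : ℝ} (hα : α.Contracting K)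
    (hl : 0 < l) (hs : 3 * K ≤ s) (h : ∀ k : ℕ, s - K ≤ α.proj (τ ((k + 2 : ℕ) * l))) :
    ∃ᶠ t in atTop, ∃ u ∈ Icc (0 : ℝ) 1,
      dist (geo (α.posRay 0) (τ.posRay t) u) (α.posRay (s - 2 * K).toNNReal) ≤ K := by
  rw [frequently_atTop]
  intro t₀
  obtain ⟨k, hk⟩ := exists_nat_ge (t₀ / l)
  rw [div_le_iff₀ hl] at hk
  have hnn : 0 ≤ ((k + 2 : ℕ) : ℝ) * l := by positivity
  refine ⟨NNReal.mk _ hnn, ?_, ?_⟩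
  · rw [← NNReal.coe_le_coe]
    change (t₀ : ℝ) ≤ ((k + 2 : ℕ) : ℝ) * l
    push_cast
    nlinarith
  · have hK := hα.nonneg
    obtain ⟨u, hu, hd⟩ := hα.exists_dist_le (x := α 0) (y := τ ((k + 2 : ℕ) * l)) (t := s - 2 * K)
      (by rw [α.proj_self]; linarith) (by linarith [h k])
    refine ⟨u, hu, ?_⟩
    change dist (geo (α ((0 : ℝ≥0) : ℝ)) (τ ((k + 2 : ℕ) * l)) u) (α ((s - 2 * K).toNNReal : ℝ)) ≤ K
    rwa [Real.coe_toNNReal _ (by linarith), NNReal.coe_zero]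

variable [ProperSpace X]

/-- If `a` and `b` have contracting axes without common end points, then `aⁿ b⁻ⁿ` is a rank one
isometry for `n` large, with attractive fixed point close to `a⁺` and repulsive fixed point close
to `b⁺`. -/
theorem eventually_rankOne {a b : X ≃ᵢ X} {α β : GeodesicLine X} {C C' : ℝ} (ha : IsAxis a α)
    (hb : IsAxis b β) (hα : α.Contracting C) (hβ : β.Contracting C') (hd : α.DisjointEnds β)
    {U V : Set (GeometricBoundary X)} (hU : U ∈ 𝓝 α.posRay.endpoint)
    (hV : V ∈ 𝓝 β.posRay.endpoint) : ∀ᶠ n : ℕ in atTop, ∃ τ : GeodesicLine X,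
      IsAxis (a ^ n * (b ^ n)⁻¹) τ ∧ ¬ τ.BoundsFlatHalfPlane ∧ τ.posRay.endpoint ∈ U ∧
        τ.negRay.endpoint ∈ V := by
  obtain ⟨la, hla, hag⟩ := ha
  obtain ⟨lb, hlb, hbg⟩ := hb
  obtain ⟨K₀, hK₀, hK₁, hK₂, hK₃⟩ := GeodesicLine.exists_proj_bound hα hβ hd
  -- Including `dist (α 0) (β 0)` lets `α 0` serve as base point for both lines.
  set K := max (max C C') (max K₀ (dist (α 0) (β 0))) with hKdef
  have hCK : C ≤ K := by simp [hKdef]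
  have hC'K : C' ≤ K := by simp [hKdef]
  have hK₀K : K₀ ≤ K := by simp [hKdef]
  have hdK : dist (α 0) (β 0) ≤ K := by simp [hKdef]
  have hαK := hα.mono hCK
  have hβK := hβ.mono hC'K
  have hKnn := hαK.nonneg
  have htop : ∀ l : ℝ, 0 < l → Tendsto (fun n : ℕ => (n : ℝ) * l) atTop atTop := fun l hl =>
    tendsto_natCast_atTop_atTop.atTop_mul_const hl
  have hpp : ∀ᶠ n : ℕ in atTop, PingPong α β (a ^ n) (b ^ n) (n * la) (n * lb) K (α 0) := by
    filter_upwards [(htop la hla).eventually_gt_atTop (12 * K + 2),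
      (htop lb hlb).eventually_gt_atTop (12 * K + 2)] with n h1 h2
    exact ⟨pow_apply_axis hag n, pow_apply_axis hbg n, hαK, hβK, by simpa using hKnn, hdK,
      fun y hy => (hK₃ y (hK₀K.trans_lt hy)).trans hK₀K, h1, h2⟩
  obtain ⟨τ, hτ⟩ := (hpp.mono fun n hn => hn.exists_axis).choice
  have hT : ∀ l : ℝ, 0 < l → Tendsto (fun n : ℕ => ((n : ℝ) * l - 2 * K).toNNReal) atTop atTop :=
    fun l hl => tendsto_real_toNNReal_atTop.comp (tendsto_atTop_add_const_right _ _ (htop l hl))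
  have hpos := α.posRay.tendsto_endpoint (ν := fun n => (τ n).posRay) (hT la hla) K (by
    filter_upwards [hτ, hpp] with n ⟨l, hl, _, h1, _⟩ hn
    exact GeodesicLine.frequently_near hαK hl (by linarith [hn.lt_left]) h1)
  -- The bound on the `β` side already holds from the first multiple of `l`, hence the shift by one.
  have hneg := β.posRay.tendsto_endpoint (ν := fun n => (τ n).rev.posRay) (hT lb hlb) K (by
    filter_upwards [hτ, hpp] with n ⟨l, hl, _, _, h2⟩ hn
    exact GeodesicLine.frequently_near hβK hl (by linarith [hn.lt_right]) fun k => h2 (k + 1))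
  filter_upwards [hτ, hpp, hpos hU, hneg hV] with n ⟨l, hl, hax, h1, h2⟩ hn hnU hnV
  refine ⟨τ n, ⟨l, hl, hax⟩, ?_, hnU, hnV⟩
  refine PingPong.not_boundsFlatHalfPlane hαK (u := -((0 + 1 : ℕ) * l)) (v := (0 + 2 : ℕ) * l)
    (hn.symm.proj_right_le ?_) ?_
  · linarith [h2 0, hn.lt_right]
  · linarith [h1 0, hn.lt_left]

end PingPong

/-! ### Independence and convergence in one factor -/

section Factor
variable {X : Type*} [MetricSpace X]

lemma IsAxis.rev {g : X ≃ᵢ X} {σ : GeodesicLine X} (h : IsAxis g σ) : IsAxis g⁻¹ σ.rev := by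
  obtain ⟨l, hl, hg⟩ := h
  exact ⟨l, hl, GeodesicLine.inv_apply_rev hg⟩

lemma IsAxis.map {g : X ≃ᵢ X} {σ : GeodesicLine X} (h : IsAxis g σ) (δ : X ≃ᵢ X) :
    IsAxis (δ * g * δ⁻¹) (σ.map δ) := by
  obtain ⟨l, hl, hg⟩ := h
  refine ⟨l, hl, fun t => ?_⟩
  have h1 : δ⁻¹ (δ (σ t)) = σ t := δ.symm_apply_apply _
  rw [GeodesicLine.map_apply, GeodesicLine.map_apply, IsometryEquiv.mul_apply,
    IsometryEquiv.mul_apply, h1, hg]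

lemma eventually_ne_of_tendsto {κ Y : Type*} [TopologicalSpace Y] [T2Space Y] {l : Filter κ}
    {f g : κ → Y} {a b : Y} (hf : Tendsto f l (𝓝 a)) (hg : Tendsto g l (𝓝 b)) (hab : a ≠ b) :
    ∀ᶠ n in l, f n ≠ g n :=
  (hf.prodMk_nhds hg).eventually ((isOpen_ne_fun continuous_fst continuous_snd).mem_nhds hab)

lemma GeodesicLine.posRay_endpoint_ne_negRay_endpoint (σ : GeodesicLine X) :
    σ.posRay.endpoint ≠ σ.negRay.endpoint := by
  intro h
  obtain ⟨C, hC⟩ := GeodesicRay.endpoint_eq_iff.1 h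
  obtain ⟨n, hn⟩ := exists_nat_gt C
  have h1 : dist (σ ((n : ℝ≥0) : ℝ)) (σ (-((n : ℝ≥0) : ℝ))) ≤ C := hC n
  rw [σ.dist_eq, NNReal.coe_natCast, sub_neg_eq_add, abs_of_nonneg (by positivity)] at h1
  have h2 : (0 : ℝ) ≤ n := Nat.cast_nonneg n
  linarith

lemma AreIndependent.symm {g h : X ≃ᵢ X} (H : AreIndependent g h) : AreIndependent h g := by
  intro x
  have := (H x).comp (Prod.swap_injective (α := ℤ) (β := ℤ)).tendsto_cofinite
  exact this.congr fun p => dist_comm _ _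

lemma AreIndependent.inv_left {g h : X ≃ᵢ X} (H : AreIndependent g h) :
    AreIndependent g⁻¹ h := by
  intro x
  have hinj : Function.Injective fun p : ℤ × ℤ => (-p.1, p.2) :=
    fun p q hpq => by simpa [Prod.ext_iff] using hpq
  exact ((H x).comp hinj.tendsto_cofinite).congr fun p => by simp

/-- For asymptotic axes choose `n` with `n l'` within `l'` of `m l`: then `gᵐ x` and `hⁿ x` stay at
bounded distance for infinitely many pairs `(m, n)`. -/
lemma AreIndependent.endpoint_ne {g h : X ≃ᵢ X} {σ τ : GeodesicLine X} (H : AreIndependent g h)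
    (hσ : IsAxis g σ) (hτ : IsAxis h τ) : σ.posRay.endpoint ≠ τ.posRay.endpoint := by
  intro he
  obtain ⟨l, hl, hg⟩ := hσ
  obtain ⟨l', hl', hh⟩ := hτ
  obtain ⟨C, hC⟩ := GeodesicRay.endpoint_eq_iff.1 he
  have hinj : Function.Injective fun m : ℕ => ((m : ℤ), ⌊(m : ℝ) * l / l'⌋) := fun m n hmn => by
    simpa using (Prod.ext_iff.1 hmn).1
  obtain ⟨m, hm⟩ := (((H (σ 0)).comp hinj.tendsto_cofinite).eventually_gt_atTop
    (C + l' + dist (τ 0) (σ 0))).exists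
  set n := ⌊(m : ℝ) * l / l'⌋ with hn
  have h1 : (n : ℝ) * l' ≤ m * l := by
    rw [← le_div_iff₀ hl']; exact Int.floor_le _
  have h2 : (m : ℝ) * l ≤ (n + 1) * l' := by
    rw [← div_le_iff₀ hl']; exact (Int.lt_floor_add_one _).le
  have e1 : (g ^ (m : ℤ)) (σ 0) = σ (m * l) := by
    rw [zpow_apply_axis hg, zero_add, Int.cast_natCast]
  have e2 : (h ^ n) (τ 0) = τ (n * l') := by rw [zpow_apply_axis hh, zero_add]
  have h3 := dist_triangle4 (σ (m * l)) (τ (m * l)) (τ (n * l')) ((h ^ n) (σ 0))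
  conv_rhs at h3 => rw [← e2, (h ^ n).isometry.dist_eq, e2]
  rw [τ.dist_eq, abs_of_nonneg (by linarith)] at h3
  have h4 : dist (σ (m * l)) (τ (m * l)) ≤ C := hC (NNReal.mk (m * l) (by positivity))
  simp only [Function.comp_apply] at hm
  rw [e1] at hm
  linarith

lemma AreIndependent.disjointEnds {g h : X ≃ᵢ X} {σ τ : GeodesicLine X} (H : AreIndependent g h)
    (hσ : IsAxis g σ) (hτ : IsAxis h τ) : σ.DisjointEnds τ where
  pos_pos := H.endpoint_ne hσ hτ
  pos_neg := H.symm.inv_left.symm.endpoint_ne hσ hτ.rev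
  neg_pos := H.inv_left.endpoint_ne hσ.rev hτ
  neg_neg := H.inv_left.symm.inv_left.symm.endpoint_ne hσ.rev hτ.rev

variable [CNSpace X]

lemma geo_geo (x y : X) {s t : ℝ} (hs : s ∈ Icc (0 : ℝ) 1) (ht : t ∈ Icc (0 : ℝ) 1) :
    geo x (geo x y t) s = geo x y (s * t) := by
  have hst : s * t ∈ Icc (0 : ℝ) 1 := ⟨mul_nonneg hs.1 ht.1, mul_le_one₀ hs.2 ht.1 ht.2⟩
  refine eq_geo hst ?_ ?_
  · rw [dist_left_geo _ _ hs, dist_left_geo _ _ ht, mul_assoc]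
  · have h1 := dist_triangle (geo x (geo x y t) s) (geo x y t) y
    rw [dist_geo_right _ _ hs, dist_left_geo _ _ ht, dist_geo_right _ _ ht] at h1
    linarith

/-- Sequences of points at bounded distance from points `ρ (T n)` of a ray converge to the end
point of the ray. -/
lemma GeodesicRay.tendsto_inner (ρ : GeodesicRay X) {y : ℕ → X} {T : ℕ → ℝ≥0}
    (hT : Tendsto T atTop atTop) {D : ℝ} (hD : ∀ n, dist (y n) (ρ (T n)) ≤ D) :
    Tendsto (fun n => GeometricCompletion.inner (y n)) atTop (𝓝 (.bdry ρ.endpoint)) := by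
  refine tendsto_bdry_iff.2 fun c R ε hR hε hξ => ?_
  obtain ⟨c', hc'0, hc', hc'R⟩ := hξ
  obtain ⟨D₀, hD₀⟩ := endpoint_eq_iff.1 hc'
  set D₁ := D + D₀ with hD₁
  have hyc : ∀ n, dist (y n) (c' (T n)) ≤ D₁ := fun n => by
    have := dist_triangle_right (y n) (c' (T n)) (ρ (T n))
    linarith [hD n, hD₀ (T n)]
  have hD₁0 : 0 ≤ D₁ := dist_nonneg.trans (hyc 0)
  set δ := ε - dist (c' R) (c R) with hδ
  have hδ0 : 0 < δ := sub_pos.2 hc'R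
  have hT' : Tendsto (fun n => (T n : ℝ)) atTop atTop := NNReal.tendsto_coe_atTop.2 hT
  filter_upwards [hT'.eventually_gt_atTop (R + D₁ + 2 * R * D₁ / δ)] with n hn
  have hR0 : (0 : ℝ) < R := hR
  have hS : |dist (c 0) (y n) - T n| ≤ D₁ := by
    have h1 := abs_dist_sub_le (y n) (c' (T n)) (c 0)
    rw [dist_comm _ (c 0), dist_comm _ (c 0), ← hc'0, c'.dist_zero, hc'0] at h1
    exact h1.trans (hyc n)
  set S := dist (c 0) (y n) with hSd
  have hS' := abs_le.1 hS
  have h2 : 0 ≤ 2 * R * D₁ / δ := by positivity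
  have hRS : (R : ℝ) < S := by linarith
  have hS0 : 0 < S := by linarith
  have h3 : 2 * R * D₁ < S * δ := by
    rw [← div_lt_iff₀ hδ0]; linarith
  refine ⟨hRS, _, isGeodesicPath_geo (c 0) (y n), by simp [geo_zero], ?_, ?_⟩
  · rw [← hSd, div_self hS0.ne', geo_one]
  rw [← hSd]
  set μ := (R : ℝ) / S with hμ
  have hμS : μ * S = R := div_mul_cancel₀ _ hS0.ne'
  have hμ1 : μ ∈ Icc (0 : ℝ) 1 := ⟨by positivity, (div_le_one hS0).2 hRS.le⟩
  have h4 := dist_geo_geo_left_le (c 0) (y n) (c' (T n)) hμ1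
  have h5 : geo (c 0) (c' (T n)) μ = c' (μ.toNNReal * T n) := by
    rw [← hc'0, c'.apply_toNNReal_mul hμ1]
  have h6 : dist (c' (μ.toNNReal * T n)) (c' R) ≤ μ * D₁ := by
    rw [c'.dist_eq, NNReal.coe_mul, Real.coe_toNNReal _ hμ1.1, ← hμS, ← mul_sub, abs_mul,
      abs_of_nonneg hμ1.1, abs_sub_comm]
    exact mul_le_mul_of_nonneg_left hS hμ1.1
  rw [h5] at h4
  have h7 := mul_le_mul_of_nonneg_left (hyc n) hμ1.1
  have h8 := dist_triangle4 (geo (c 0) (y n) μ) (c' (μ.toNNReal * T n)) (c' R) (c R)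
  have h9 : 2 * (μ * D₁) < δ := by
    have : S * (2 * (μ * D₁)) < S * δ := by
      calc S * (2 * (μ * D₁)) = 2 * (μ * S) * D₁ := by ring
        _ = 2 * R * D₁ := by rw [hμS]
        _ < S * δ := h3
    exact lt_of_mul_lt_mul_left this hS0.le
  linarith

variable [ProperSpace X]

/-- Translates of a contracting line converge to a boundary point if a base point does so and has
bounded projections to the translates. -/
lemma tendsto_map_endpoint {α : GeodesicLine X} {C : ℝ} (hα : α.Contracting C) {c : GeodesicRay X}
    {x : X} {γ δ : ℕ → X ≃ᵢ X} {T : ℕ → ℝ≥0} (hT : Tendsto T atTop atTop) {K E : ℝ}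
    (hK : ∀ n, |α.proj ((δ n)⁻¹ x)| ≤ K) (hE : ∀ n, dist (δ n x) (γ n x) ≤ E)
    (hγ : ∀ n, ∃ u ∈ Icc (0 : ℝ) 1, dist (geo (c 0) (γ n x) u) (c (T n)) ≤ 1) :
    Tendsto (fun n => (α.map (δ n)).posRay.endpoint) atTop (𝓝 c.endpoint) := by
  -- This puts `t` at least `C` beyond the projection of `c 0` to every translate, so geodesics from
  -- `c 0` to remote points of the translate pass near its point `t`, at bounded distance from `γ n
  -- x`.
  set t := K + dist (c 0) x + C with ht
  have hC := hα.nonneg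
  have hK0 := (abs_nonneg _).trans (hK 0)
  have ht0 : 0 ≤ t := by positivity
  refine c.tendsto_endpoint hT (C + t + dist (α 0) x + E + 1) (Eventually.of_forall fun n => ?_)
  refine Eventually.frequently ?_
  filter_upwards [eventually_ge_atTop (t + C).toNNReal] with s hs
  have hs' : t + C ≤ s := Real.toNNReal_le_iff_le_coe.1 hs
  obtain ⟨u, hu, hud⟩ := hγ n
  have hx : (α.map (δ n)).proj x = α.proj ((δ n)⁻¹ x) := α.proj_map' (δ n) x
  have h1 := ((α.map (δ n)).abs_proj_sub_proj_le (c 0) x)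
  rw [hx] at h1
  obtain ⟨v, hv, hvd⟩ := (hα.map (δ n)).exists_dist_le (x := c 0) (y := α.map (δ n) s) (t := t)
    (by linarith [(abs_le.1 h1).2, (abs_le.1 (hK n)).2])
    (by rw [(α.map (δ n)).proj_self]; exact hs')
  refine ⟨u * v, ⟨mul_nonneg hu.1 hv.1, mul_le_one₀ hu.2 hv.1 hv.2⟩, ?_⟩
  change dist (geo (c 0) (α.map (δ n) s) (u * v)) _ ≤ _
  rw [← geo_geo _ _ hu hv]
  set w := geo (c 0) (α.map (δ n) s) v with hw
  have h2 := dist_geo_geo_left_le (c 0) w (γ n x) hu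
  have h3 : dist w (γ n x) ≤ C + t + dist (α 0) x + E := by
    have e1 := dist_triangle4 w (α.map (δ n) t) (α.map (δ n) 0) (δ n x)
    have e2 := dist_triangle w (δ n x) (γ n x)
    have e3 : dist (α.map (δ n) 0) (δ n x) = dist (α 0) x := (δ n).isometry.dist_eq _ _
    rw [(α.map (δ n)).dist_eq, sub_zero, abs_of_nonneg ht0, e3] at e1
    linarith [hE n]
  have h4 := dist_triangle (geo (c 0) w u) (geo (c 0) (γ n x) u) (c (T n))
  have h5 : u * dist w (γ n x) ≤ dist w (γ n x) := by
    nlinarith [hu.2, dist_nonneg (x := w) (y := γ n x)]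
  linarith

end Factor

/-! ### The Furstenberg limit set -/

section ProductSpace
variable {ι : Type*} [Fintype ι] {X : ι → Type*} [∀ i, MetricSpace (X i)]

lemma finite_upper_bound {κ : Type*} [Finite κ] (f : κ → ℝ) : ∃ K, ∀ i, f i ≤ K := by
  obtain ⟨K, hK⟩ := (finite_range f).bddAbove
  exact ⟨K, fun i => hK (mem_range_self i)⟩

/-- The product ray in direction of the axes of the components of a regular axial isometry. -/
lemma exists_product_ray [Nonempty ι] (σ : ∀ i, GeodesicLine (X i)) (l : ι → ℝ)
    (hl : ∀ i, 0 < l i) : ∃ (ρ : GeodesicRay (PiLp 2 X)) (θ : ι → ℝ≥0) (L : ℝ≥0), 0 < L ∧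
      (∀ i, 0 < θ i) ∧ ∑ i, θ i ^ 2 = 1 ∧ (∀ i, (θ i * L : ℝ) = l i) ∧
      ∀ t i, ρ t i = (σ i).posRay (θ i * t) := by
  have hpos : 0 < ∑ i, l i ^ 2 := Finset.sum_pos (fun i _ => pow_pos (hl i) 2)
    Finset.univ_nonempty
  set L := √(∑ i, l i ^ 2) with hL
  have hL0 : 0 < L := Real.sqrt_pos.2 hpos
  have hL2 : L ^ 2 = ∑ i, l i ^ 2 := Real.sq_sqrt hpos.le
  set θ : ι → ℝ≥0 := fun i => (l i / L).toNNReal with hθ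
  have hθc : ∀ i, (θ i : ℝ) = l i / L := fun i => Real.coe_toNNReal _ (div_pos (hl i) hL0).le
  have hsumR : ∑ i, (θ i : ℝ) ^ 2 = 1 := by
    simp only [hθc, div_pow, ← Finset.sum_div, ← hL2]
    exact div_self (pow_pos hL0 2).ne'
  have hsum : ∑ i, θ i ^ 2 = 1 := by exact_mod_cast hsumR
  refine ⟨⟨fun t => WithLp.toLp 2 fun i => (σ i).posRay (θ i * t), ?_⟩, θ, L.toNNReal,
    Real.toNNReal_pos.2 hL0, fun i => Real.toNNReal_pos.2 (div_pos (hl i) hL0), hsum,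
    fun i => ?_, fun t i => rfl⟩
  · refine Isometry.of_dist_eq fun s t => ?_
    refine (pow_left_inj₀ dist_nonneg dist_nonneg two_ne_zero).1 ?_
    rw [piLp_dist_sq, NNReal.dist_eq, sq_abs]
    calc ∑ i, dist ((σ i).posRay (θ i * s)) ((σ i).posRay (θ i * t)) ^ 2
        = ∑ i, (θ i : ℝ) ^ 2 * ((s : ℝ) - t) ^ 2 := Finset.sum_congr rfl fun i _ => by
          rw [GeodesicRay.dist_eq, sq_abs, NNReal.coe_mul, NNReal.coe_mul]; ring
      _ = _ := by rw [← Finset.sum_mul, hsumR, one_mul]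
  · rw [hθc, Real.coe_toNNReal _ hL0.le, div_mul_cancel₀ _ hL0.ne']

variable [∀ i, CNSpace (X i)]

/-- `γ` translates the product ray by `L`, so `γⁿ x` stays at distance `d(x, ρ 0)` from `ρ (n L)`.
Positive translation lengths make the direction regular. -/
lemma endpoint_mem_furstenbergLimitSet [Nonempty ι] {Γ : Subgroup (∀ i, X i ≃ᵢ X i)}
    {γ : ∀ i, X i ≃ᵢ X i} (hγ : γ ∈ Γ) {σ : ∀ i, GeodesicLine (X i)}
    (hσ : ∀ i, IsAxis (γ i) (σ i)) (x : PiLp 2 X) :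
    (fun i => (σ i).posRay.endpoint) ∈ furstenbergLimitSet Γ x := by
  choose l hl hax using hσ
  obtain ⟨ρ, θ, L, hL, hθ, hsum, hθL, hρ⟩ := exists_product_ray σ l hl
  refine ⟨ρ.endpoint, ?_, ρ, θ, fun i => (σ i).posRay, hθ, hsum, hρ, rfl, fun i => rfl⟩
  have hT : Tendsto (fun n : ℕ => (n : ℝ≥0) * L) atTop atTop :=
    tendsto_natCast_atTop_atTop.atTop_mul_const hL
  refine mem_closure_of_tendsto (ρ.tendsto_inner (y := fun n => productAct (γ ^ n) x) hT
    (D := dist x (ρ 0)) fun n => le_of_eq ?_)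
    (Eventually.of_forall fun n => ⟨γ ^ n, Γ.pow_mem hγ n, rfl⟩)
  refine (pow_left_inj₀ dist_nonneg dist_nonneg two_ne_zero).1 ?_
  rw [piLp_dist_sq, piLp_dist_sq]
  refine Finset.sum_congr rfl fun i _ => ?_
  have h1 : ρ (n * L) i = (γ i ^ n) (ρ 0 i) := by
    rw [hρ, hρ, mul_zero]
    change σ i ((θ i * (n * L) : ℝ≥0) : ℝ) = (γ i ^ n) (σ i ((0 : ℝ≥0) : ℝ))
    rw [pow_apply_axis (hax i), NNReal.coe_zero, zero_add, ← hθL i]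
    congr 1
    push_cast
    ring
  rw [h1]
  change dist ((γ i ^ n) (x i)) _ ^ 2 = _
  rw [(γ i ^ n).isometry.dist_eq]

/-- A point of the Furstenberg limit set is approached by an orbit in each factor. -/
lemma exists_orbit_of_mem_furstenbergLimitSet {Γ : Subgroup (∀ i, X i ≃ᵢ X i)} {x : PiLp 2 X}
    {ξ : FurstenbergBoundary X} (hξ : ξ ∈ furstenbergLimitSet Γ x) :
    ∃ (c : ∀ i, GeodesicRay (X i)) (θ : ι → ℝ≥0), (∀ i, 0 < θ i) ∧ (∀ i, (c i).endpoint = ξ i) ∧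
      ∀ n : ℕ, ∃ γ ∈ Γ, ∀ i, ∃ u ∈ Icc (0 : ℝ) 1,
        dist (geo (c i 0) (γ i (x i)) u) (c i (θ i * (n + 1))) ≤ 1 := by
  obtain ⟨ζ, hζ, σ, θ, c, hθ, -, hσ, rfl, hc⟩ := hξ
  refine ⟨c, θ, hθ, hc, fun n => ?_⟩
  -- Radius `n + 1` rather than `n`, because cone neighbourhoods require a positive radius.
  obtain ⟨-, hz, γ, hγ, rfl⟩ := mem_closure_iff.1 hζ _
    (isOpen_coneNhd σ (R := (n : ℝ≥0) + 1) (by positivity) one_pos) ⟨σ, rfl, rfl, by simp⟩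
  obtain ⟨hlt, τ, hτ, hτ0, hτ1, hd⟩ := hz
  refine ⟨γ, hγ, fun i => ?_⟩
  set y := productAct γ x with hy
  set S := dist (σ 0) y with hS
  have hR0 : (0 : ℝ) < ((n : ℝ≥0) + 1 : ℝ≥0) := by positivity
  have hS0 : 0 < S := hR0.trans hlt
  have hu : (((n : ℝ≥0) + 1 : ℝ≥0) : ℝ) / S ∈ Icc (0 : ℝ) 1 :=
    ⟨by positivity, (div_le_one hS0).2 hlt.le⟩
  refine ⟨_, hu, ?_⟩
  have h1 := hτ.eq_geo hu hS0.le
  rw [div_mul_cancel₀ _ hS0.ne', hτ0, hτ1] at h1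
  rw [h1] at hd
  have h2 := (piLp_dist_apply_le _ _ i).trans hd.le
  rw [piLp_geo_apply _ _ hu, hσ, hσ, mul_zero] at h2
  exact h2

/-- Among boundedly many conjugates of a regular axial element, there is one such that all
projections of a given point to its axes are bounded. -/
lemma exists_proj_le {h : ∀ i, X i ≃ᵢ X i} {α β : ∀ i, GeodesicLine (X i)} {C C' : ι → ℝ}
    (hβ : ∀ i, IsAxis (h i) (β i)) (hα : ∀ i, (α i).Contracting (C i))
    (hβ' : ∀ i, (β i).Contracting (C' i)) (hd : ∀ i, (α i).DisjointEnds (β i)) :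
    ∃ (K : ℝ) (m : ℕ), ∀ y : ∀ i, X i, ∃ k : Fin (Fintype.card ι + 1), ∀ i,
      |(α i).proj ((h i ^ (m * k : ℕ))⁻¹ (y i))| ≤ K := by
  choose l hl hax using hβ
  choose K hK0 _ _ hK using fun i => GeodesicLine.exists_proj_bound (hα i) (hβ' i) (hd i)
  obtain ⟨K', hK'⟩ := finite_upper_bound K
  obtain ⟨M, hM⟩ := finite_upper_bound fun i => 2 * K i / l i
  obtain ⟨m, hm⟩ := exists_nat_gt M
  refine ⟨K', m, fun y => ?_⟩
  by_contra! hcon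
  choose i hi using hcon
  -- Pigeonhole: two exponents fail in the same factor `i₀`. Failure at `k` puts the projection of
  -- `y` to `β` within `K i₀` of `m k l`, and these windows are disjoint since `m l > 2 K i₀`.
  obtain ⟨j, k, hjk, hijk⟩ := Fintype.exists_ne_map_eq_of_card_lt i (by simp)
  have key : ∀ j, |(β (i j)).proj (y (i j)) - (m * j : ℕ) * l (i j)| ≤ K (i j) := by
    intro j
    have h1 := hK (i j) _ ((hK' (i j)).trans_lt (hi j))
    have h2 := proj_zpow (hax (i j)) (-((m * j : ℕ) : ℤ)) (y (i j))
    rw [zpow_neg, zpow_natCast] at h2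
    rw [h2] at h1
    push_cast at h1 ⊢
    rwa [neg_mul, ← sub_eq_add_neg] at h1
  have h1 := key j
  have h2 := key k
  rw [← hijk] at h2
  set i₀ := i j
  have h3 : 2 * K i₀ < m * l i₀ := by
    rw [← div_lt_iff₀ (hl i₀)]
    exact (hM i₀).trans_lt hm
  have h4 : (1 : ℝ) ≤ |((j : ℕ) : ℝ) - (k : ℕ)| := by
    have : ((j : ℕ) : ℤ) - (k : ℕ) ≠ 0 := by
      intro h0
      exact hjk (Fin.ext (by omega))
    exact_mod_cast Int.one_le_abs this
  have h5 : |((j : ℕ) : ℝ) - (k : ℕ)| * (m * l i₀) ≤ 2 * K i₀ := by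
    have hml : (0 : ℝ) ≤ m * l i₀ := mul_nonneg (Nat.cast_nonneg m) (hl i₀).le
    have e : |((j : ℕ) : ℝ) - (k : ℕ)| * (m * l i₀) =
        |(m * j : ℕ) * l i₀ - (m * k : ℕ) * l i₀| := by
      rw [← abs_of_nonneg hml, ← abs_mul]
      push_cast
      ring_nf
    rw [e]
    have h6 := abs_sub_le ((m * j : ℕ) * l i₀) ((β i₀).proj (y i₀)) ((m * k : ℕ) * l i₀)
    rw [abs_sub_comm] at h1
    linarith
  have h6 := le_mul_of_one_le_left (mul_nonneg (Nat.cast_nonneg m) (hl i₀).le) h4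
  linarith

variable [∀ i, ProperSpace (X i)]

/-- The points of the Furstenberg limit set are limits of fixed points of conjugates of a given
regular axial element. -/
lemma exists_tendsto_of_mem_furstenbergLimitSet {Γ : Subgroup (∀ i, X i ≃ᵢ X i)}
    {h : ∀ i, X i ≃ᵢ X i} (hΓ : h ∈ Γ) {α β : ∀ i, GeodesicLine (X i)} {C C' : ι → ℝ}
    (hβ : ∀ i, IsAxis (h i) (β i)) (hα : ∀ i, (α i).Contracting (C i))
    (hβ' : ∀ i, (β i).Contracting (C' i)) (hd : ∀ i, (α i).DisjointEnds (β i)) {x : PiLp 2 X}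
    {ξ : FurstenbergBoundary X} (hξ : ξ ∈ furstenbergLimitSet Γ x) :
    ∃ δ : ℕ → ∀ i, X i ≃ᵢ X i, (∀ n, δ n ∈ Γ) ∧ ∀ i,
      Tendsto (fun n => ((α i).map (δ n i)).posRay.endpoint) atTop (𝓝 (ξ i)) ∧
      Tendsto (fun n => ((α i).map (δ n i)).negRay.endpoint) atTop (𝓝 (ξ i)) := by
  obtain ⟨c, θ, hθ, hc, horb⟩ := exists_orbit_of_mem_furstenbergLimitSet hξ
  choose γ hγΓ hγ using horb
  obtain ⟨K, m, hK⟩ := exists_proj_le hβ hα hβ' hd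
  obtain ⟨E, hE⟩ := finite_upper_bound fun p : ι × Fin (Fintype.card ι + 1) =>
    dist ((h p.1 ^ (m * p.2 : ℕ)) (x p.1)) (x p.1)
  -- The correction by a power of `h` with boundedly many exponents keeps the orbit point within
  -- bounded distance, and one exponent serves all factors.
  have hδ : ∀ n, ∃ δ ∈ Γ, ∀ i, |(α i).proj ((δ i)⁻¹ (x i))| ≤ K ∧
      dist (δ i (x i)) (γ n i (x i)) ≤ E := by
    intro n
    obtain ⟨k, hk⟩ := hK fun i => (γ n i)⁻¹ (x i)
    refine ⟨γ n * h ^ (m * k : ℕ), Γ.mul_mem (hγΓ n) (Γ.pow_mem hΓ _), fun i => ⟨?_, ?_⟩⟩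
    · rw [Pi.mul_apply, Pi.pow_apply, mul_inv_rev, IsometryEquiv.mul_apply]
      exact hk i
    · rw [Pi.mul_apply, Pi.pow_apply, IsometryEquiv.mul_apply, (γ n i).isometry.dist_eq]
      exact hE (i, k)
  choose δ hδΓ hδ using hδ
  refine ⟨δ, hδΓ, fun i => ?_⟩
  have hT : Tendsto (fun n : ℕ => θ i * ((n : ℝ≥0) + 1)) atTop atTop := by
    have h1 : Tendsto (fun n : ℕ => (n : ℝ≥0) + 1) atTop atTop :=
      tendsto_atTop_mono (fun n => le_self_add) tendsto_natCast_atTop_atTop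
    exact h1.const_mul_atTop (hθ i)
  rw [← hc i]
  refine ⟨tendsto_map_endpoint (hα i) hT (fun n => (hδ n i).1) (fun n => (hδ n i).2)
    fun n => hγ n i, ?_⟩
  exact tendsto_map_endpoint (hα i).rev hT
    (fun n => by rw [GeodesicLine.proj_rev, abs_neg]; exact (hδ n i).1) (fun n => (hδ n i).2)
    fun n => hγ n i

/-- If `a`, `b` are regular axial elements of `Γ` without common fixed points, then `(a⁺, b⁺)` is
a limit of pairs of fixed points of regular axial elements of `Γ`. -/
lemma endpoints_mem_closure {Γ : Subgroup (∀ i, X i ≃ᵢ X i)} {a b : ∀ i, X i ≃ᵢ X i} (ha : a ∈ Γ)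
    (hb : b ∈ Γ) {α β : ∀ i, GeodesicLine (X i)} {C C' : ι → ℝ} (hα : ∀ i, IsAxis (a i) (α i))
    (hβ : ∀ i, IsAxis (b i) (β i)) (hα' : ∀ i, (α i).Contracting (C i))
    (hβ' : ∀ i, (β i).Contracting (C' i)) (hd : ∀ i, (α i).DisjointEnds (β i)) :
    ((fun i => (α i).posRay.endpoint, fun i => (β i).posRay.endpoint) :
      FurstenbergBoundary X × FurstenbergBoundary X) ∈ closure (regularAxialFixedPairs Γ) := by
  refine mem_closure_iff_nhds.2 fun W hW => ?_
  obtain ⟨U, hU, V, hV, hUV⟩ := mem_nhds_prod_iff.1 hW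
  rw [nhds_pi] at hU hV
  obtain ⟨I, U', hU', hIU⟩ := Filter.mem_pi'.1 hU
  obtain ⟨J, V', hV', hJV⟩ := Filter.mem_pi'.1 hV
  -- There are finitely many factors, so one exponent `n` works in all of them.
  obtain ⟨n, hn⟩ := (eventually_all.2 fun i =>
    eventually_rankOne (hα i) (hβ i) (hα' i) (hβ' i) (hd i) (hU' i) (hV' i)).exists
  choose τ hτ hτf hτU hτV using hn
  refine ⟨(fun i => (τ i).posRay.endpoint, fun i => (τ i).negRay.endpoint),
    hUV ⟨hIU fun i _ => hτU i, hJV fun i _ => hτV i⟩,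
    a ^ n * (b ^ n)⁻¹, Γ.mul_mem (Γ.pow_mem ha n) (Γ.inv_mem (Γ.pow_mem hb n)),
    fun i => ⟨τ i, hτ i, hτf i⟩, fun i => ⟨τ i, hτ i, rfl, rfl⟩⟩

end ProductSpace
end

/-! ### The theorem -/

theorem theoremC {ι : Type*} [Fintype ι] [Nonempty ι] {X : ι → Type*}
    [∀ i, MetricSpace (X i)] [∀ i, LocallyCompactSpace (X i)]
    (hX : ∀ i, IsHadamardSpace (X i))
    (Γ : Subgroup (∀ i, X i ≃ᵢ X i)) (hΓ : ActsProperlyDiscontinuously Γ)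
    (hind : ∃ g ∈ Γ, ∃ h ∈ Γ, IsRegularAxial g ∧ IsRegularAxial h ∧
      ∀ i, AreIndependent (g i) (h i))
    (x : PiLp 2 X) :
    regularAxialFixedPairs Γ ⊆
        (furstenbergLimitSet Γ x ×ˢ furstenbergLimitSet Γ x) \ generalizedDiagonal X ∧
      (furstenbergLimitSet Γ x ×ˢ furstenbergLimitSet Γ x) \ generalizedDiagonal X ⊆
        closure (regularAxialFixedPairs Γ) := by
  have : ∀ i, CNSpace (X i) := fun i => (hX i).cnSpace
  have : ∀ i, ProperSpace (X i) := fun i => (hX i).properSpace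
  constructor
  · rintro ⟨ξ, η⟩ ⟨γ, hγ, -, hfix⟩
    choose σ hσ hξ hη using hfix
    have hξ' : (fun i => (σ i).posRay.endpoint) = ξ := funext hξ
    have hη' : (fun i => (σ i).rev.posRay.endpoint) = η := funext hη
    refine ⟨⟨?_, ?_⟩, ?_⟩
    · rw [← hξ']
      exact endpoint_mem_furstenbergLimitSet hγ hσ x
    · rw [← hη']
      exact endpoint_mem_furstenbergLimitSet (Γ.inv_mem hγ) (fun i => (hσ i).rev) x
    · rintro ⟨i, hi⟩
      exact (σ i).posRay_endpoint_ne_negRay_endpoint ((hξ i).trans (hi.trans (hη i).symm))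
  · rintro ⟨ξ, η⟩ ⟨⟨hξ, hη⟩, hne⟩
    obtain ⟨g, hg, h, hh, hgr, hhr, hgh⟩ := hind
    choose α hα hαf using hgr
    choose β hβ hβf using hhr
    choose C hC using fun i => GeodesicLine.exists_contracting (hα i) (hαf i)
    choose C' hC' using fun i => GeodesicLine.exists_contracting (hβ i) (hβf i)
    have hd := fun i => (hgh i).disjointEnds (hα i) (hβ i)
    obtain ⟨δ, hδ, hδξ⟩ := exists_tendsto_of_mem_furstenbergLimitSet hh hβ hC hC' hd hξ
    obtain ⟨ε, hε, hεη⟩ := exists_tendsto_of_mem_furstenbergLimitSet hh hβ hC hC' hd hη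
    have hξη : ∀ i, ξ i ≠ η i := fun i hi => hne ⟨i, hi⟩
    have hlim : Tendsto (fun n => ((fun i => ((α i).map (δ n i)).posRay.endpoint,
        fun i => ((α i).map (ε n i)).posRay.endpoint) :
          FurstenbergBoundary X × FurstenbergBoundary X)) atTop (𝓝 (ξ, η)) :=
      (tendsto_pi_nhds.2 fun i => (hδξ i).1).prodMk_nhds (tendsto_pi_nhds.2 fun i => (hεη i).1)
    refine isClosed_closure.mem_of_tendsto hlim ?_
    -- Both ends of the `δ n`-translate of the axis of `g` tend to `ξ i`, both ends of the `ε
    -- n`-translate to `η i`; as `ξ i ≠ η i` and the boundary is Hausdorff, the ends are eventually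
    -- disjoint.
    have hdis : ∀ᶠ n in atTop, ∀ i, ((α i).map (δ n i)).DisjointEnds ((α i).map (ε n i)) := by
      refine eventually_all.2 fun i => ?_
      filter_upwards [eventually_ne_of_tendsto (hδξ i).1 (hεη i).1 (hξη i),
        eventually_ne_of_tendsto (hδξ i).1 (hεη i).2 (hξη i), eventually_ne_of_tendsto (hδξ i).2 (hεη i).1 (hξη i),
        eventually_ne_of_tendsto (hδξ i).2 (hεη i).2 (hξη i)] with n h1 h2 h3 h4
      exact ⟨h1, h2, h3, h4⟩
    filter_upwards [hdis] with n hn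
    exact endpoints_mem_closure (a := δ n * g * (δ n)⁻¹) (b := ε n * g * (ε n)⁻¹)
      (Γ.mul_mem (Γ.mul_mem (hδ n) hg) (Γ.inv_mem (hδ n)))
      (Γ.mul_mem (Γ.mul_mem (hε n) hg) (Γ.inv_mem (hε n)))
      (fun i => (hα i).map (δ n i)) (fun i => (hα i).map (ε n i))
      (fun i => (hC i).map (δ n i)) (fun i => (hC i).map (ε n i)) hn
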